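/- A $3$-graph is a finite family $\mathcal F$ of $3$-element subsets (edges) of a finite vertex set $[n]=\{1,\dots,n\}$, $n$ arbitrary. Its matching number $\nu(\mathcal F)$ is the maximum number of pairwise disjoint edges in $\mathcal F$. $\mathcal F$ is called $2$-resilient if for every set $T\subseteq[n]$ of at most $2$ vertices, $\nu(\{F\in\mathcal F: F\cap T=\emptyset\})=\nu(\mathcal F)$. Let $$m(3,2)=\max\{|\mathcal F| : \mathcal F \text{ is a 2-resilient 3-graph (on any number } n \text{ of vertices) with } \nu(\mathcal F)=2\}.$$ **Theorem 1.6.** The maximum $m(3,2)$ exists and $$m(3,2)=\binom{8}{3}=56.$$ Moreover, it is attained by the complete $3$-graph $\binom{[8]}{3}$, which is $2$-resilient and has matching number $2$. -/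

import Mathlib

namespace ResilientHypergraph

/-- The matching number `ν(F)`: the maximum number of pairwise disjoint members of the family `F`. -/
def matchingNumber {V : Type*} [DecidableEq V] (F : Finset (Finset V)) : ℕ :=
  (F.powerset.filter fun M => ∀ A ∈ M, ∀ B ∈ M, A ≠ B → Disjoint A B).sup Finset.card

/-- The family of those members of `F` that are disjoint from `T`, i.e. what remains of `F` when
the vertices in `T` are omitted. -/
def deleteVerts {V : Type*} [DecidableEq V] (F : Finset (Finset V)) (T : Finset V) :
    Finset (Finset V) :=
  F.filter fun A => Disjoint A T

/-- `F` is `t`-resilient if omitting any set of at most `t` vertices leaves the matching number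
unchanged. -/
def IsResilient {V : Type*} [DecidableEq V] (t : ℕ) (F : Finset (Finset V)) : Prop :=
  ∀ T : Finset V, T.card ≤ t → matchingNumber (deleteVerts F T) = matchingNumber F

/-- The complete `k`-graph on the vertex set `Fin n`. -/
def completeKGraph (n k : ℕ) : Finset (Finset (Fin n)) :=
  Finset.univ.powersetCard k

/-- The set of all numbers of edges of `(k - 1)`-resilient `k`-graphs with matching number `s`,
on any finite number `n` of vertices. It is used for `1 ≤ k`. -/
def resilientSizes (k s : ℕ) : Set ℕ :=
  {N | ∃ (n : ℕ) (F : Finset (Finset (Fin n))), F ⊆ completeKGraph n k ∧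
    IsResilient (k - 1) F ∧ matchingNumber F = s ∧ F.card = N}

/-- `m(k, s)`: the maximum number of edges of a `(k - 1)`-resilient `k`-graph with matching
number `s` (a supremum in `ℕ`, hence the maximum whenever one exists). -/
noncomputable def m (k s : ℕ) : ℕ :=
  sSup (resilientSizes k s)

end ResilientHypergraph

/-!
The complete `3`-graph on eight vertices is easily seen to be `2`-resilient with matching number
`2`, so the point is the upper bound `#F ≤ 56`, `Resilient.card_le`. A `2`-resilient `3`-graph with
matching number `2` has no three pairwise disjoint edges, and any two vertices are avoided by two
disjoint edges; every edge meets the union of such a pair of edges. Hence two vertices have at most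
`6` common edges. The next consequences are that a vertex has degree at most `24`
(`Resilient.degree_le`), because the unions of disjoint edges avoiding it are six-element covers of
its link graph, and that at most `40` edges meet a given pair of vertices
(`Resilient.card_meet_pair_le`). If every edge meets some set of seven vertices at least twice, the
bound follows by double counting (`Resilient.card_le_of_seven`).

Now fix disjoint edges `E₁` and `E₂`.

* Suppose that any two disjoint edges have at least three vertices in `E₁ ∪ E₂`
  (`Resilient.card_le_of_rigid`). Then every edge meets these six vertices, and two vertices among
  them have at most three common edges with a third vertex outside. The edges with a single vertex
  in `E₁ ∪ E₂` define link graphs outside, and the graphs of different vertices are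
  cross-intersecting. If one of them has two disjoint edges, the other counts are small. If all
  their edges have a common vertex, the bound for seven vertices applies. Otherwise their edges form
  a triangle, and the numbers of edges with given trace on `E₁ ∪ E₂` satisfy a system of
  inequalities, `TriangleCounts`, which bounds their sum by `56`.

* Otherwise there are edges `D₁` and `D₂` such that `E₁ ∩ D₁ = {o₁}` and `E₂ ∩ D₂ = {o₂}`, while the
  two pairs are disjoint from each other (`CrossedPairs`). An edge without `o₁` and `o₂` meets both
  edges of one of the pairs. If all these edges have vertices in both halves of the configuration,
  there are at most `16` of them, and `16 + 40 = 56` (`Resilient.card_le_of_mixed`). Otherwise,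
  up to symmetry, some edge `P` forms a triangle with `E₁` and `D₁` that is disjoint from `E₂` and
  `D₂`. If there is a second triangle on the other side, every edge meets all three edges of one of
  the two triangles, and at most `28` edges do so for either of them
  (`Resilient.card_le_of_triangles`). If not, at most `24` edges contain `o₂`, at most `20` of the
  others meet all three edges of the triangle (`Resilient.card_le_of_triangle`), and the remaining
  ones, at most `12`, consist of a vertex of `E₂`, a vertex of `D₂` and a vertex of the triangle
  (`Resilient.card_le_of_notMixed`).
-/

namespace ResilientHypergraph

open Finset

/-! ### Resilient families and the patterns of their edges -/

section

variable {V : Type*} [DecidableEq V]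

/-- The properties of a `2`-resilient `3`-graph with matching number `2` that the proof of the
bound `56` uses: edges are triples, no three edges are pairwise disjoint, and any two vertices are
avoided by some pair of disjoint edges. -/
structure Resilient (F : Finset (Finset V)) : Prop where
  card3 : ∀ A ∈ F, A.card = 3
  no_three : ∀ A ∈ F, ∀ B ∈ F, ∀ C ∈ F, Disjoint A B → Disjoint A C → ¬ Disjoint B C
  avoid : ∀ x y : V, ∃ P ∈ F, ∃ Q ∈ F, Disjoint P Q ∧ x ∉ P ∧ x ∉ Q ∧ y ∉ P ∧ y ∉ Q

/-- Every edge meets the union of two disjoint edges. -/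
theorem Resilient.hits {F : Finset (Finset V)} (h : Resilient F) {P Q A : Finset V} (hP : P ∈ F)
    (hQ : Q ∈ F) (hPQ : Disjoint P Q) (hA : A ∈ F) : ∃ z ∈ A, z ∈ P ∪ Q := by
  by_contra! hc
  refine h.no_three A hA P hP Q hQ ?_ ?_ hPQ <;> rw [disjoint_left] <;> intro z hz hz' <;>
    exact hc z hz (by simp [hz'])

/-- The third vertex of an edge through `x` and `y` lies in the union of two disjoint edges that
avoid `x` and `y`. -/
theorem Resilient.codegree_le {F : Finset (Finset V)} (h : Resilient F) {x y : V} (hxy : x ≠ y) :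
    #{A ∈ F | x ∈ A ∧ y ∈ A} ≤ 6 := by
  obtain ⟨P, hP, Q, hQ, hPQ, hx, hx', hy, hy'⟩ := h.avoid x y
  calc _ ≤ #((P ∪ Q).image fun z => ({x, y, z} : Finset V)) := by
        refine card_le_card fun A hA => ?_
        simp only [mem_filter] at hA
        obtain ⟨z, hz, hz'⟩ := h.hits hP hQ hPQ hA.1
        refine mem_image.2 ⟨z, hz', ?_⟩
        have hzx : z ≠ x := by rintro rfl; simp [hx, hx'] at hz'
        have hzy : z ≠ y := by rintro rfl; simp [hy, hy'] at hz'
        refine eq_of_subset_of_card_le ?_ ?_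
        · intro w; simp only [mem_insert, mem_singleton]; rintro (rfl | rfl | rfl) <;> tauto
        · rw [h.card3 A hA.1, card_eq_three.2 ⟨x, y, z, hxy, hzx.symm, hzy.symm, rfl⟩]
    _ ≤ _ := card_image_le
    _ ≤ 6 := by
        have := card_union_le P Q
        rw [h.card3 P hP, h.card3 Q hQ] at this
        exact this

section Labels

variable {k : ℕ}

/-- The pattern of a set `A` on labelled vertices `v 0, …, v (k - 1)`: the labels of the vertices
that `A` contains. -/
def pat (v : Fin k ↪ V) (A : Finset V) : Finset (Fin k) := univ.filter fun i => v i ∈ A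

/-- The number of edges of `F` with pattern `B` on the labelled vertices `v`. -/
def cnt (F : Finset (Finset V)) (v : Fin k ↪ V) (B : Finset (Fin k)) : ℕ :=
  #{A ∈ F | pat v A = B}

/-- The unlabelled vertices that complete the labelled vertices in `B` to an edge of `F`. -/
def ext [Fintype V] (F : Finset (Finset V)) (v : Fin k ↪ V) (B : Finset (Fin k)) : Finset V :=
  univ.filter fun z => z ∉ univ.map v ∧ insert z (B.map v) ∈ F

@[simp] theorem mem_pat {v : Fin k ↪ V} {A : Finset V} {i : Fin k} : i ∈ pat v A ↔ v i ∈ A := by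
  simp [pat]

theorem map_pat (v : Fin k ↪ V) (A : Finset V) : (pat v A).map v = A ∩ univ.map v := by
  ext z; simp only [mem_map, mem_pat, mem_inter, mem_univ, true_and]
  constructor
  · rintro ⟨i, hi, rfl⟩; exact ⟨hi, i, rfl⟩
  · rintro ⟨hz, i, rfl⟩; exact ⟨i, hz, rfl⟩

theorem card_pat (v : Fin k ↪ V) (A : Finset V) : #(pat v A) = #(A ∩ univ.map v) := by
  rw [← map_pat, card_map]

theorem map_pat_subset (v : Fin k ↪ V) (A : Finset V) : (pat v A).map v ⊆ A := by
  rw [map_pat]; exact inter_subset_left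

@[simp] theorem pat_map (v : Fin k ↪ V) (B : Finset (Fin k)) : pat v (B.map v) = B := by
  ext i; simp

theorem pat_eq_map {v : Fin k ↪ V} {A : Finset V} (h : #A ≤ #(pat v A)) :
    A = (pat v A).map v :=
  (eq_of_subset_of_card_le (map_pat_subset v A) (by rwa [card_map])).symm

theorem card_pat_le (v : Fin k ↪ V) (A : Finset V) : #(pat v A) ≤ #A := by
  rw [card_pat]; exact card_le_card inter_subset_left

/-- An edge with exactly two labelled vertices has one further vertex. -/
theorem exists_insert {v : Fin k ↪ V} {A : Finset V} (hA : #A = 3) (h : #(pat v A) = 2) :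
    ∃ z, z ∉ univ.map v ∧ A = insert z ((pat v A).map v) := by
  have h1 : #(A \ (pat v A).map v) = 1 := by
    rw [card_sdiff_of_subset (map_pat_subset v A), card_map]; omega
  obtain ⟨z, hz⟩ := card_eq_one.1 h1
  have hz' : z ∈ A \ (pat v A).map v := by rw [hz]; simp
  rw [mem_sdiff, map_pat, mem_inter] at hz'
  refine ⟨z, fun hc => hz'.2 ⟨hz'.1, hc⟩, ?_⟩
  rw [insert_eq, ← hz, sdiff_union_of_subset (map_pat_subset v A)]

theorem cnt_le_ext [Fintype V] {F : Finset (Finset V)} (h3 : ∀ A ∈ F, #A = 3) (v : Fin k ↪ V)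
    {B : Finset (Fin k)} (hB : #B = 2) : cnt F v B ≤ #(ext F v B) := by
  calc cnt F v B ≤ #((ext F v B).image fun z => insert z (B.map v)) := by
        refine card_le_card fun A hA => ?_
        rw [mem_filter] at hA
        obtain ⟨hA, rfl⟩ := hA
        obtain ⟨z, hz, hz'⟩ := exists_insert (h3 A hA) hB
        refine mem_image.2 ⟨z, ?_, hz'.symm⟩
        simp only [ext, mem_filter, mem_univ, true_and]
        exact ⟨by simpa using hz, hz' ▸ hA⟩
    _ ≤ _ := card_image_le

theorem cnt_le_one {F : Finset (Finset V)} (h3 : ∀ A ∈ F, #A = 3) (v : Fin k ↪ V)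
    {B : Finset (Fin k)} (hB : #B = 3) : cnt F v B ≤ 1 := by
  refine card_le_one.2 fun A hA A' hA' => ?_
  rw [mem_filter] at hA hA'
  rw [pat_eq_map (v := v) (A := A) (by rw [hA.2, hB, h3 A hA.1]),
    pat_eq_map (v := v) (A := A') (by rw [hA'.2, hB, h3 A' hA'.1]), hA.2, hA'.2]

/-- A labelled triple that is counted is an edge. -/
theorem map_mem_of_cnt {F : Finset (Finset V)} (h3 : ∀ A ∈ F, #A = 3) {v : Fin k ↪ V}
    {B : Finset (Fin k)} (hB : #B = 3) (h : cnt F v B ≠ 0) : B.map v ∈ F := by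
  obtain ⟨A, hA⟩ := card_ne_zero.1 h
  rw [mem_filter] at hA
  rw [← hA.2, ← pat_eq_map (v := v) (A := A) (by rw [hA.2, hB, h3 A hA.1])]
  exact hA.1

theorem cnt_pos {F : Finset (Finset V)} {v : Fin k ↪ V} {B : Finset (Fin k)}
    (h : B.map v ∈ F) : 1 ≤ cnt F v B :=
  card_pos.2 ⟨_, mem_filter.2 ⟨h, pat_map v B⟩⟩

theorem mem_ext [Fintype V] {F : Finset (Finset V)} {v : Fin k ↪ V} {B : Finset (Fin k)} {z : V} :
    z ∈ ext F v B ↔ z ∉ univ.map v ∧ insert z (B.map v) ∈ F := by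
  simp only [ext, mem_filter, mem_univ, true_and]

/-- Counting a family by the patterns of its members. -/
theorem card_le_sum_cnt {F : Finset (Finset V)} (v : Fin k ↪ V) (L : List (Finset (Fin k)))
    (hL : ∀ A ∈ F, pat v A ∈ L) : #F ≤ (L.map (cnt F v)).sum := by
  suffices H : ∀ (L : List (Finset (Fin k))) (F' : Finset (Finset V)), F' ⊆ F →
      (∀ A ∈ F', pat v A ∈ L) → #F' ≤ (L.map (cnt F v)).sum from H L F subset_rfl hL
  intro L
  induction L with
  | nil =>
    intro F' _ h
    simp only [List.not_mem_nil, imp_false] at h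
    simp [eq_empty_of_forall_notMem h]
  | cons B L ih =>
    intro F' hF' h
    have h1 := card_filter_add_card_filter_not (s := F') (fun A => pat v A = B)
    have h2 : #{A ∈ F' | pat v A = B} ≤ cnt F v B := card_le_card (filter_subset_filter _ hF')
    have h3 := ih {A ∈ F' | ¬ pat v A = B} ((filter_subset _ _).trans hF') (by
      intro A hA
      rw [mem_filter] at hA
      have := h A hA.1
      rw [List.mem_cons] at this
      exact this.resolve_left hA.2)
    rw [List.map_cons, List.sum_cons]
    omega

/-- Members of a family with different patterns are different. -/
theorem sum_cnt_le_card {F : Finset (Finset V)} (v : Fin k ↪ V) (L : List (Finset (Fin k)))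
    (hd : L.Nodup) : (L.map (cnt F v)).sum ≤ #{A ∈ F | pat v A ∈ L} := by
  induction L with
  | nil => simp
  | cons B L ih =>
    rw [List.nodup_cons] at hd
    rw [List.map_cons, List.sum_cons]
    have h1 := card_filter_add_card_filter_not (s := {A ∈ F | pat v A ∈ B :: L})
      (fun A => pat v A = B)
    have h2 : cnt F v B ≤ #{A ∈ {A ∈ F | pat v A ∈ B :: L} | pat v A = B} := by
      refine card_le_card fun A hA => ?_
      simp only [mem_filter] at hA ⊢
      simp [hA.1, hA.2]
    have h3 : #{A ∈ F | pat v A ∈ L} ≤ #{A ∈ {A ∈ F | pat v A ∈ B :: L} | ¬ pat v A = B} := by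
      refine card_le_card fun A hA => ?_
      simp only [mem_filter] at hA ⊢
      refine ⟨⟨hA.1, by simp [hA.2]⟩, ?_⟩
      rintro rfl; exact hd.1 hA.2
    have := ih hd.2
    omega

theorem disjoint_insert_map {v : Fin k ↪ V} {B B' : Finset (Fin k)} (h : Disjoint B B') {z z' : V}
    (hz : z ∉ univ.map v) (hz' : z' ∉ univ.map v) (hne : z ≠ z') :
    Disjoint (insert z (B.map v)) (insert z' (B'.map v)) := by
  have hs : ∀ C : Finset (Fin k), C.map v ⊆ univ.map v := fun C => map_subset_map.2 (subset_univ C)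
  rw [disjoint_insert_left, disjoint_insert_right, disjoint_map, mem_insert]
  exact ⟨by rintro (h | h); exacts [hne h, hz (hs _ h)], fun h => hz' (hs _ h), h⟩

theorem disjoint_insert_map' {v : Fin k ↪ V} {B B' : Finset (Fin k)} (h : Disjoint B B') {z : V}
    (hz : z ∉ univ.map v) : Disjoint (insert z (B.map v)) (B'.map v) := by
  have hs : ∀ C : Finset (Fin k), C.map v ⊆ univ.map v := fun C => map_subset_map.2 (subset_univ C)
  rw [disjoint_insert_left, disjoint_map]
  exact ⟨fun h => hz (hs _ h), h⟩

end Labels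

end

/-! ### Families meeting a set of seven vertices twice -/

section

variable {V : Type*} [DecidableEq V]

omit [DecidableEq V] in
theorem card_le_one_of_forall_eq {N N' : Finset V} (h : ∀ z ∈ N, ∀ z' ∈ N', z = z')
    (hN' : N'.Nonempty) : #N ≤ 1 := by
  obtain ⟨w, hw⟩ := hN'
  exact card_le_one.2 fun a ha b hb => (h a ha w hw).trans (h b hb w hw).symm

section

variable [Fintype V] {k : ℕ} {F : Finset (Finset V)}

/-- The vertices completing a labelled set to an edge lie in the union of any two disjoint edges
avoiding that set. -/
theorem Resilient.ext_subset (h : Resilient F) {v : Fin k ↪ V} {B : Finset (Fin k)}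
    {P Q : Finset V} (hP : P ∈ F) (hQ : Q ∈ F) (hPQ : Disjoint P Q)
    (hB : ∀ i ∈ B, v i ∉ P ∧ v i ∉ Q) : ext F v B ⊆ (P ∪ Q) \ univ.map v := by
  intro z hz
  rw [mem_ext] at hz
  obtain ⟨w, hw, hw'⟩ := h.hits hP hQ hPQ hz.2
  rw [mem_insert] at hw
  rcases hw with rfl | hw
  · exact mem_sdiff.2 ⟨hw', hz.1⟩
  · rw [mem_map] at hw
    obtain ⟨i, hi, rfl⟩ := hw
    have := hB i hi
    simp [this.1, this.2] at hw'

/-- If an edge is disjoint from two disjoint labelled pairs, these have no distinct completions. -/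
theorem Resilient.ext_eq (h : Resilient F) {v : Fin k ↪ V} {B B' : Finset (Fin k)}
    (hBB : Disjoint B B') {C : Finset V} (hC : C ∈ F) (hCB : Disjoint C (B.map v))
    (hCB' : Disjoint C (B'.map v)) {z z' : V} (hz : z ∈ ext F v B) (hz' : z' ∈ ext F v B')
    (hzC : z ∉ C) (hzC' : z' ∉ C) : z = z' := by
  by_contra hne
  rw [mem_ext] at hz hz'
  refine h.no_three C hC _ hz.2 _ hz'.2 ?_ ?_ (disjoint_insert_map hBB hz.1 hz'.1 hne)
  · rw [disjoint_insert_right]; exact ⟨hzC, hCB⟩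
  · rw [disjoint_insert_right]; exact ⟨hzC', hCB'⟩

/-- If every edge meets a set `W` of seven vertices at least twice, there are at most `56` edges.
Every pair in `W` has at most two completions outside `W`. If a triple `T ⊆ W` is an edge, two
complementary pairs of `W \ T` have at most two completions in total, so that
`∑ s_P + 6 [T ∈ F] ≤ 12`, the sum being over the pairs `P ⊆ W \ T`. The bound follows by summing
over all `35` triples, each pair being counted ten times. -/
theorem Resilient.card_le_of_seven (h : Resilient F) (v : Fin 7 ↪ V)
    (hW : ∀ A ∈ F, 2 ≤ #(pat v A)) : #F ≤ 56 := by
  have hs : ∀ P ∈ powersetCard 2 (univ : Finset (Fin 7)), cnt F v P ≤ 2 := by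
    intro P hP
    rw [mem_powersetCard] at hP
    refine (cnt_le_ext h.card3 v hP.2).trans ?_
    obtain ⟨i, j, hij, rfl⟩ := card_eq_two.1 hP.2
    obtain ⟨A, hA, B, hB, hAB, h1, h2, h3, h4⟩ := h.avoid (v i) (v j)
    refine (card_le_card (h.ext_subset hA hB hAB (B := {i, j}) ?_)).trans ?_
    · intro l hl
      rw [mem_insert, mem_singleton] at hl
      rcases hl with rfl | rfl <;> tauto
    · rw [union_sdiff_distrib]
      refine (card_union_le _ _).trans ?_
      have a1 := card_sdiff_add_card_inter A (univ.map v)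
      have b1 := card_sdiff_add_card_inter B (univ.map v)
      rw [← card_pat] at a1 b1
      have := hW A hA
      have := hW B hB
      have := h.card3 A hA
      have := h.card3 B hB
      omega
  have hT : ∀ T ∈ powersetCard 3 (univ : Finset (Fin 7)),
      ∑ P ∈ powersetCard 2 Tᶜ, cnt F v P + 6 * cnt F v T ≤ 12 := by
    intro T hT
    rw [mem_powersetCard] at hT
    have hc : #(powersetCard 2 Tᶜ) = 6 := by
      rw [card_powersetCard, card_compl, hT.2]; rfl
    have h1 := cnt_le_one h.card3 v hT.2
    rcases Nat.eq_zero_or_pos (cnt F v T) with h0 | h0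
    · have : ∑ P ∈ powersetCard 2 Tᶜ, cnt F v P ≤ #(powersetCard 2 Tᶜ) • 2 :=
        sum_le_card_nsmul _ _ _ fun P hP => hs P (powersetCard_mono (subset_univ _) hP)
      rw [hc] at this
      simp only [smul_eq_mul] at this
      omega
    · have hTF := map_mem_of_cnt h.card3 hT.2 h0.ne'
      have hcouple : ∀ P ∈ powersetCard 2 Tᶜ, cnt F v P + cnt F v (Tᶜ \ P) ≤ 2 := by
        intro P hP
        have hP2 := hs P (powersetCard_mono (subset_univ _) hP)
        rw [mem_powersetCard] at hP
        have hP' : #(Tᶜ \ P) = 2 := by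
          rw [card_sdiff_of_subset hP.1, card_compl, hT.2, hP.2]; rfl
        have hP'2 := hs (Tᶜ \ P) (mem_powersetCard.2 ⟨subset_univ _, hP'⟩)
        have e1 := cnt_le_ext h.card3 v hP.2
        have e2 := cnt_le_ext h.card3 v hP'
        have heq : ∀ z ∈ ext F v P, ∀ z' ∈ ext F v (Tᶜ \ P), z = z' := by
          intro z hz z' hz'
          have ht : ∀ {B} {z}, z ∈ ext F v B → z ∉ T.map v := fun hz hc =>
            (mem_ext.1 hz).1 (map_subset_map.2 (subset_univ _) hc)
          refine h.ext_eq disjoint_sdiff hTF ?_ ?_ hz hz' (ht hz) (ht hz')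
          · rw [disjoint_map]
            exact disjoint_of_subset_right hP.1 disjoint_compl_right
          · rw [disjoint_map]
            exact disjoint_of_subset_right sdiff_subset disjoint_compl_right
        rcases (ext F v P).eq_empty_or_nonempty with hN | hN
        · rw [hN, card_empty] at e1; omega
        rcases (ext F v (Tᶜ \ P)).eq_empty_or_nonempty with hN' | hN'
        · rw [hN', card_empty] at e2; omega
        have := card_le_one_of_forall_eq heq hN'
        have := card_le_one_of_forall_eq (fun z hz z' hz' => (heq z' hz' z hz).symm) hN
        omega
      have hsym : ∑ P ∈ powersetCard 2 Tᶜ, cnt F v (Tᶜ \ P)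
          = ∑ P ∈ powersetCard 2 Tᶜ, cnt F v P := by
        have hm : ∀ P ∈ powersetCard 2 Tᶜ, Tᶜ \ P ∈ powersetCard 2 Tᶜ := by
          intro P hP
          rw [mem_powersetCard] at hP ⊢
          refine ⟨sdiff_subset, ?_⟩
          rw [card_sdiff_of_subset hP.1, card_compl, hT.2, hP.2]; rfl
        refine sum_nbij' (fun P => Tᶜ \ P) (fun P => Tᶜ \ P) hm hm ?_ ?_ ?_
        · exact fun P hP => Finset.sdiff_sdiff_eq_self (mem_powersetCard.1 hP).1
        · exact fun P hP => Finset.sdiff_sdiff_eq_self (mem_powersetCard.1 hP).1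
        · exact fun P hP => rfl
      have := sum_le_card_nsmul _ _ 2 hcouple
      rw [sum_add_distrib, hsym, hc] at this
      simp only [smul_eq_mul] at this
      omega
  have hsum := sum_le_card_nsmul _ _ 12 hT
  rw [sum_add_distrib, ← mul_sum] at hsum
  have hdc : ∑ T ∈ powersetCard 3 (univ : Finset (Fin 7)), ∑ P ∈ powersetCard 2 Tᶜ, cnt F v P
      = 10 * ∑ P ∈ powersetCard 2 (univ : Finset (Fin 7)), cnt F v P := by
    rw [sum_comm' (t' := powersetCard 2 univ) (s' := fun P => powersetCard 3 Pᶜ), mul_sum]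
    · refine sum_congr rfl fun P hP => ?_
      rw [sum_const, card_powersetCard, card_compl, (mem_powersetCard.1 hP).2, smul_eq_mul,
        Fintype.card_fin, show Nat.choose (7 - 2) 3 = 10 from by decide]
    · intro T P
      rw [mem_powersetCard, mem_powersetCard, mem_powersetCard, mem_powersetCard]
      constructor
      · rintro ⟨⟨-, h1⟩, h2, h3⟩
        exact ⟨⟨subset_compl_comm.1 h2, h1⟩, subset_univ _, h3⟩
      · rintro ⟨⟨h1, h2⟩, -, h3⟩
        exact ⟨⟨subset_univ _, h2⟩, subset_compl_comm.1 h1, h3⟩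
  have htot : #F ≤ ∑ P ∈ powersetCard 2 (univ : Finset (Fin 7)), cnt F v P
      + ∑ T ∈ powersetCard 3 (univ : Finset (Fin 7)), cnt F v T := by
    rw [← sum_union (by
      rw [disjoint_left]; intro B hB hB'
      have := (mem_powersetCard.1 hB).2
      have := (mem_powersetCard.1 hB').2
      omega)]
    refine (card_eq_sum_card_fiberwise (f := pat v) fun A hA => ?_).le
    have h2 := hW A hA
    have h3 := card_pat_le v A
    rw [h.card3 A hA] at h3
    simp only [coe_union, Set.mem_union, mem_coe, mem_powersetCard, subset_univ, true_and]
    omega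
  have hone : ∑ T ∈ powersetCard 3 (univ : Finset (Fin 7)), cnt F v T ≤ 35 := by
    refine (sum_le_card_nsmul _ _ 1 fun T hT =>
      cnt_le_one h.card3 v (mem_powersetCard.1 hT).2).trans ?_
    rw [card_powersetCard, card_univ, Fintype.card_fin]; decide
  have h35 : #(powersetCard 3 (univ : Finset (Fin 7))) = 35 := by
    rw [card_powersetCard, card_univ, Fintype.card_fin]; decide
  rw [h35, hdc, smul_eq_mul] at hsum
  omega

end

/-! ### Degrees -/

section

variable {F : Finset (Finset V)}

/-- At most `6 |B|` edges contain `x` and meet `B`. -/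
theorem Resilient.card_meet_le (h : Resilient F) {x : V} {B : Finset V} (hx : x ∉ B) :
    #{A ∈ F | x ∈ A ∧ ∃ p ∈ B, p ∈ A} ≤ 6 * #B := by
  calc _ ≤ #(B.biUnion fun p => {A ∈ F | x ∈ A ∧ p ∈ A}) := by
        refine card_le_card fun A hA => ?_
        simp only [mem_filter, mem_biUnion] at hA ⊢
        obtain ⟨hA, hxA, p, hp, hpA⟩ := hA
        exact ⟨p, hp, hA, hxA, hpA⟩
    _ ≤ ∑ p ∈ B, #{A ∈ F | x ∈ A ∧ p ∈ A} := card_biUnion_le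
    _ ≤ ∑ p ∈ B, 6 := sum_le_sum fun p hp => h.codegree_le (by rintro rfl; exact hx hp)
    _ = 6 * #B := by rw [sum_const, smul_eq_mul, mul_comm]

/-- At most `|X| |Y|` triples contain `x`, a vertex of `X` and a vertex of `Y`. -/
theorem card_cross_le (h3 : ∀ A ∈ F, #A = 3) {x : V} {X Y : Finset V} (hX : x ∉ X) (hY : x ∉ Y)
    (hXY : Disjoint X Y) : #{A ∈ F | x ∈ A ∧ ∃ p ∈ X, ∃ q ∈ Y, p ∈ A ∧ q ∈ A} ≤ #X * #Y := by
  rw [← card_product]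
  refine le_trans (card_le_card fun A hA => ?_)
    (card_image_le (f := fun w : V × V => ({x, w.1, w.2} : Finset V)))
  simp only [mem_filter] at hA
  obtain ⟨hA, hxA, p, hp, q, hq, hpA, hqA⟩ := hA
  refine mem_image.2 ⟨(p, q), mem_product.2 ⟨hp, hq⟩, ?_⟩
  have hxp : x ≠ p := by rintro rfl; exact hX hp
  have hxq : x ≠ q := by rintro rfl; exact hY hq
  have hpq : p ≠ q := by rintro rfl; exact disjoint_left.1 hXY hp hq
  refine eq_of_subset_of_card_le ?_ ?_
  · intro w; simp only [mem_insert, mem_singleton]; rintro (rfl | rfl | rfl) <;> assumption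
  · rw [h3 A hA, card_eq_three.2 ⟨x, p, q, hxp, hxq, hpq, rfl⟩]

theorem eq_of_mem_card_three {A : Finset V} (hA : #A = 3) {x p q r : V} (hx : x ∈ A) (hp : p ∈ A)
    (hq : q ∈ A) (hr : r ∈ A) (hxp : x ≠ p) (hxq : x ≠ q) (hxr : x ≠ r) :
    p = q ∨ p = r ∨ q = r := by
  by_contra! hc
  have : #({x, p, q, r} : Finset V) ≤ #A := card_le_card (by
    intro w; simp only [mem_insert, mem_singleton]; rintro (rfl | rfl | rfl | rfl) <;> assumption)
  rw [card_insert_of_notMem (by simp [hxp, hxq, hxr]),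
    card_eq_three.2 ⟨p, q, r, hc.1, hc.2.1, hc.2.2, rfl⟩] at this
  omega

end

end

section

variable {V : Type*} [DecidableEq V] {F : Finset (Finset V)}

/-- Two covers `E₁ ∪ E₂` and `D₁ ∪ D₂` of the link graph of `x` with two opposite empty
intersections: as `E₁ ∪ D₁` and `E₂ ∪ D₂` are covers as well, a link edge meets `(E₁ ∩ D₂) ∪ (E₂ ∩
D₁)`, or joins `E₁ \ D₂` to `D₂ \ E₁`, or joins `E₂ \ D₁` to `D₁ \ E₂`. -/
theorem Resilient.degree_le_of_two_empty (h : Resilient F) {x : V} {E₁ E₂ D₁ D₂ : Finset V}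
    (hE₁ : E₁ ∈ F) (hE₂ : E₂ ∈ F) (hD₁ : D₁ ∈ F) (hD₂ : D₂ ∈ F)
    (x1 : x ∉ E₁) (x2 : x ∉ E₂) (x3 : x ∉ D₁) (x4 : x ∉ D₂)
    (hE : Disjoint E₁ E₂) (hD : Disjoint D₁ D₂) (h1 : Disjoint E₁ D₁) (h2 : Disjoint E₂ D₂)
    (hc : #(E₁ ∩ D₂) + #(E₂ ∩ D₁) ≤ 3) : #{A ∈ F | x ∈ A} ≤ 24 := by
  have a1 : 1 ≤ #(E₁ ∩ D₂) := by
    obtain ⟨z, hz, hz'⟩ := h.hits hE₂ hD₂ h2 hE₁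
    refine card_pos.2 ⟨z, ?_⟩
    have := disjoint_left.1 hE hz
    simp_all
  have a2 : 1 ≤ #(E₂ ∩ D₁) := by
    obtain ⟨z, hz, hz'⟩ := h.hits hE₁ hD₁ h1 hE₂
    refine card_pos.2 ⟨z, ?_⟩
    have := disjoint_right.1 hE hz
    simp_all
  have hsub : ({A ∈ F | x ∈ A} : Finset (Finset V)) ⊆
      ({A ∈ F | x ∈ A ∧ ∃ p ∈ (E₁ ∩ D₂) ∪ (E₂ ∩ D₁), p ∈ A} : Finset (Finset V)) ∪
      (({A ∈ F | x ∈ A ∧ ∃ p ∈ E₁ \ D₂, ∃ q ∈ D₂ \ E₁, p ∈ A ∧ q ∈ A} : Finset (Finset V)) ∪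
      ({A ∈ F | x ∈ A ∧ ∃ p ∈ E₂ \ D₁, ∃ q ∈ D₁ \ E₂, p ∈ A ∧ q ∈ A} : Finset (Finset V))) := by
    intro A hA
    rw [mem_filter] at hA
    obtain ⟨hA, hxA⟩ := hA
    obtain ⟨p, hp, hp'⟩ := h.hits hE₁ hE₂ hE hA
    obtain ⟨q, hq, hq'⟩ := h.hits hD₁ hD₂ hD hA
    obtain ⟨r, hr, hr'⟩ := h.hits hE₁ hD₁ h1 hA
    obtain ⟨s, hs, hs'⟩ := h.hits hE₂ hD₂ h2 hA
    rw [disjoint_left] at hE hD h1 h2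
    have k1 := eq_of_mem_card_three (h.card3 A hA) hxA hp hq hr (by grind) (by grind) (by grind)
    have k2 := eq_of_mem_card_three (h.card3 A hA) hxA hp hq hs (by grind) (by grind) (by grind)
    have k3 := eq_of_mem_card_three (h.card3 A hA) hxA hp hr hs (by grind) (by grind) (by grind)
    have k4 := eq_of_mem_card_three (h.card3 A hA) hxA hq hr hs (by grind) (by grind) (by grind)
    simp only [mem_union, mem_filter, mem_sdiff, mem_inter] at *
    grind
  have hm := h.card_meet_le (x := x) (B := (E₁ ∩ D₂) ∪ (E₂ ∩ D₁)) (by simp [x1, x2])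
  have c1 := card_cross_le (x := x) h.card3 (X := E₁ \ D₂) (Y := D₂ \ E₁) (by simp [x1])
    (by simp [x4]) (disjoint_of_subset_right sdiff_subset sdiff_disjoint)
  have c2 := card_cross_le (x := x) h.card3 (X := E₂ \ D₁) (Y := D₁ \ E₂) (by simp [x2])
    (by simp [x3]) (disjoint_of_subset_right sdiff_subset sdiff_disjoint)
  have hu := card_union_le (E₁ ∩ D₂) (E₂ ∩ D₁)
  have e1 := card_sdiff_add_card_inter E₁ D₂
  have e2 := card_sdiff_add_card_inter D₂ E₁
  have e3 := card_sdiff_add_card_inter E₂ D₁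
  have e4 := card_sdiff_add_card_inter D₁ E₂
  rw [inter_comm D₂ E₁, h.card3 _ hD₂] at e2
  rw [inter_comm D₁ E₂, h.card3 _ hD₁] at e4
  rw [h.card3 _ hE₁] at e1
  rw [h.card3 _ hE₂] at e3
  refine (card_le_card hsub).trans ((card_union_le _ _).trans ?_)
  refine (Nat.add_le_add_left (card_union_le _ _) _).trans ?_
  generalize #(E₁ ∩ D₂) = m at *
  generalize #(E₂ ∩ D₁) = n at *
  have q1 : #(E₁ \ D₂) = 3 - m := by omega
  have q2 : #(D₂ \ E₁) = 3 - m := by omega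
  have q3 : #(E₂ \ D₁) = 3 - n := by omega
  have q4 : #(D₁ \ E₂) = 3 - n := by omega
  rw [q1, q2] at c1
  rw [q3, q4] at c2
  have : m = 1 ∨ m = 2 := by omega
  have : n = 1 ∨ n = 2 := by omega
  rcases ‹m = 1 ∨ m = 2› with rfl | rfl <;> rcases ‹n = 1 ∨ n = 2› with rfl | rfl <;> omega

/-- Two covers `E₁ ∪ E₂` and `D₁ ∪ D₂` of the link graph of `x` with three intersections of size one
and one empty intersection: as `E₂ ∪ D₂` is a cover as well, at most `12` link edges meet `E₁ ∩ D₂`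
or `E₂ ∩ D₁`, at most `4` of the others meet `E₁ ∩ D₁`, and at most `6 + 2` remain. -/
theorem Resilient.degree_le_of_one_empty (h : Resilient F) {x : V} {E₁ E₂ D₁ D₂ : Finset V}
    (hE₁ : E₁ ∈ F) (hE₂ : E₂ ∈ F) (hD₁ : D₁ ∈ F) (hD₂ : D₂ ∈ F)
    (x1 : x ∉ E₁) (x2 : x ∉ E₂) (x3 : x ∉ D₁) (x4 : x ∉ D₂)
    (hE : Disjoint E₁ E₂) (hD : Disjoint D₁ D₂) (h2 : Disjoint E₂ D₂)
    (h11 : #(E₁ ∩ D₁) = 1) (h12 : #(E₁ ∩ D₂) = 1) (h21 : #(E₂ ∩ D₁) = 1) :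
    #{A ∈ F | x ∈ A} ≤ 24 := by
  have hsub : ({A ∈ F | x ∈ A} : Finset (Finset V)) ⊆
      ({A ∈ F | x ∈ A ∧ ∃ p ∈ (E₁ ∩ D₂) ∪ (E₂ ∩ D₁), p ∈ A} : Finset (Finset V)) ∪
      (({A ∈ F | x ∈ A ∧ ∃ p ∈ E₁ ∩ D₁, ∃ q ∈ (E₂ \ D₁) ∪ (D₂ \ E₁), p ∈ A ∧ q ∈ A} :
        Finset (Finset V)) ∪
      (({A ∈ F | x ∈ A ∧ ∃ p ∈ (E₁ \ (D₁ ∪ D₂)) ∪ (E₂ \ D₁), ∃ q ∈ D₂ \ E₁, p ∈ A ∧ q ∈ A} :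
        Finset (Finset V)) ∪
      ({A ∈ F | x ∈ A ∧ ∃ p ∈ E₂ \ D₁, ∃ q ∈ D₁ \ (E₁ ∪ E₂), p ∈ A ∧ q ∈ A} :
        Finset (Finset V)))) := by
    intro A hA
    rw [mem_filter] at hA
    obtain ⟨hA, hxA⟩ := hA
    obtain ⟨p, hp, hp'⟩ := h.hits hE₁ hE₂ hE hA
    obtain ⟨q, hq, hq'⟩ := h.hits hD₁ hD₂ hD hA
    obtain ⟨s, hs, hs'⟩ := h.hits hE₂ hD₂ h2 hA
    rw [disjoint_left] at hE hD h2
    have k2 := eq_of_mem_card_three (h.card3 A hA) hxA hp hq hs (by grind) (by grind) (by grind)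
    simp only [mem_union, mem_filter, mem_sdiff, mem_inter] at *
    grind
  have hm := h.card_meet_le (x := x) (B := (E₁ ∩ D₂) ∪ (E₂ ∩ D₁)) (by simp [x1, x2])
  rw [disjoint_left] at hE hD h2
  have c1 := card_cross_le (x := x) h.card3 (X := E₁ ∩ D₁) (Y := (E₂ \ D₁) ∪ (D₂ \ E₁))
    (by simp [x1]) (by simp [x2, x4]) (by rw [disjoint_left]; grind)
  have c2 := card_cross_le (x := x) h.card3 (X := (E₁ \ (D₁ ∪ D₂)) ∪ (E₂ \ D₁)) (Y := D₂ \ E₁)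
    (by simp [x1, x2]) (by simp [x4]) (by rw [disjoint_left]; grind)
  have c3 := card_cross_le (x := x) h.card3 (X := E₂ \ D₁) (Y := D₁ \ (E₁ ∪ E₂)) (by simp [x2])
    (by simp [x3]) (by rw [disjoint_left]; grind)
  have hu := card_union_le (E₁ ∩ D₂) (E₂ ∩ D₁)
  have e2 := card_sdiff_add_card_inter D₂ E₁
  have e3 := card_sdiff_add_card_inter E₂ D₁
  have e5 : #(E₁ \ (D₁ ∪ D₂)) ≤ 1 := by
    have := card_sdiff_add_card_inter E₁ (D₁ ∪ D₂)
    rw [h.card3 _ hE₁, inter_union_distrib_left, card_union_of_disjoint (by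
      rw [disjoint_left]; grind)] at this
    omega
  have e6 : #(D₁ \ (E₁ ∪ E₂)) ≤ 1 := by
    have := card_sdiff_add_card_inter D₁ (E₁ ∪ E₂)
    rw [h.card3 _ hD₁, inter_union_distrib_left, card_union_of_disjoint (by
      rw [disjoint_left]; grind), inter_comm D₁ E₁, inter_comm D₁ E₂] at this
    omega
  rw [inter_comm D₂ E₁, h.card3 _ hD₂] at e2
  rw [h.card3 _ hE₂] at e3
  have q2 : #(D₂ \ E₁) = 2 := by omega
  have q3 : #(E₂ \ D₁) = 2 := by omega
  have u1 := card_union_le (E₂ \ D₁) (D₂ \ E₁)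
  have u2 := card_union_le (E₁ \ (D₁ ∪ D₂)) (E₂ \ D₁)
  rw [h11] at c1
  rw [q2] at c2
  rw [q3] at c3
  refine (card_le_card hsub).trans ((card_union_le _ _).trans ?_)
  refine (Nat.add_le_add_left ((card_union_le _ _).trans
    (Nat.add_le_add_left (card_union_le _ _) _)) _).trans ?_
  omega

/-- Two covers of the link graph of `x` with at most three common vertices, and one of the four
intersections empty. -/
theorem Resilient.degree_le_of_disjoint (h : Resilient F) {x : V} {E₁ E₂ D₁ D₂ : Finset V}
    (hE₁ : E₁ ∈ F) (hE₂ : E₂ ∈ F) (hD₁ : D₁ ∈ F) (hD₂ : D₂ ∈ F)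
    (x1 : x ∉ E₁) (x2 : x ∉ E₂) (x3 : x ∉ D₁) (x4 : x ∉ D₂)
    (hE : Disjoint E₁ E₂) (hD : Disjoint D₁ D₂) (h2 : #(E₂ ∩ D₂) = 0)
    (hc : #(E₁ ∩ D₁) + #(E₁ ∩ D₂) + #(E₂ ∩ D₁) ≤ 3) : #{A ∈ F | x ∈ A} ≤ 24 := by
  rw [card_eq_zero, ← disjoint_iff_inter_eq_empty] at h2
  have a1 : 1 ≤ #(E₁ ∩ D₂) := by
    obtain ⟨z, hz, hz'⟩ := h.hits hE₁ hE₂ hE hD₂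
    refine card_pos.2 ⟨z, ?_⟩
    have := disjoint_right.1 h2 hz
    simp_all
  have a2 : 1 ≤ #(E₂ ∩ D₁) := by
    obtain ⟨z, hz, hz'⟩ := h.hits hD₁ hD₂ hD hE₂
    refine card_pos.2 ⟨z, ?_⟩
    have := disjoint_left.1 h2 hz
    simp_all
  rcases Nat.eq_zero_or_pos #(E₁ ∩ D₁) with h0 | h0
  · rw [h0] at hc
    rw [card_eq_zero, ← disjoint_iff_inter_eq_empty] at h0
    exact h.degree_le_of_two_empty hE₁ hE₂ hD₁ hD₂ x1 x2 x3 x4 hE hD h0 h2 (by omega)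
  · exact h.degree_le_of_one_empty hE₁ hE₂ hD₁ hD₂ x1 x2 x3 x4 hE hD h2 (by omega) (by omega)
      (by omega)

/-- Every vertex has degree at most `24`. The union of any two disjoint edges avoiding `x` is a
vertex cover of the link graph of `x`, whose maximum degree is at most `6`. Two such covers with
at most three common vertices yield the bound directly. If any two of them share at least four
vertices, fix `S ≠ S'` and `I = S ∩ S'`: the cover avoiding `q ∈ I` has at most `8 - |I|` vertices
outside `I`, so that most link edges at `q` have both ends in `I` and are counted twice in the
sum of the degrees over `I`. -/
theorem Resilient.degree_le (h : Resilient F) (x : V) : #{A ∈ F | x ∈ A} ≤ 24 := by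
  by_cases hsmall : ∃ E₁ ∈ F, ∃ E₂ ∈ F, ∃ D₁ ∈ F, ∃ D₂ ∈ F, Disjoint E₁ E₂ ∧ Disjoint D₁ D₂ ∧
      x ∉ E₁ ∧ x ∉ E₂ ∧ x ∉ D₁ ∧ x ∉ D₂ ∧ #((E₁ ∪ E₂) ∩ (D₁ ∪ D₂)) ≤ 3
  · obtain ⟨E₁, hE₁, E₂, hE₂, D₁, hD₁, D₂, hD₂, hE, hD, x1, x2, x3, x4, hc⟩ := hsmall
    have hcell : #((E₁ ∪ E₂) ∩ (D₁ ∪ D₂)) =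
        #(E₁ ∩ D₁) + #(E₁ ∩ D₂) + (#(E₂ ∩ D₁) + #(E₂ ∩ D₂)) := by
      have hE' := disjoint_left.1 hE
      have hD' := disjoint_left.1 hD
      rw [union_inter_distrib_right, card_union_of_disjoint (by rw [disjoint_left]; grind),
        inter_union_distrib_left, inter_union_distrib_left,
        card_union_of_disjoint (by rw [disjoint_left]; grind),
        card_union_of_disjoint (by rw [disjoint_left]; grind)]
    rw [hcell] at hc
    have : #(E₂ ∩ D₂) = 0 ∨ #(E₂ ∩ D₁) = 0 ∨ #(E₁ ∩ D₂) = 0 ∨ #(E₁ ∩ D₁) = 0 := by omega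
    rcases this with h0 | h0 | h0 | h0
    · exact h.degree_le_of_disjoint hE₁ hE₂ hD₁ hD₂ x1 x2 x3 x4 hE hD h0 (by omega)
    · exact h.degree_le_of_disjoint hE₁ hE₂ hD₂ hD₁ x1 x2 x4 x3 hE hD.symm h0 (by omega)
    · exact h.degree_le_of_disjoint hE₂ hE₁ hD₁ hD₂ x2 x1 x3 x4 hE.symm hD h0 (by omega)
    · exact h.degree_le_of_disjoint hE₂ hE₁ hD₂ hD₁ x2 x1 x4 x3 hE.symm hD.symm h0 (by omega)
  push Not at hsmall
  obtain ⟨E₁, hE₁, E₂, hE₂, hE, x1, x2, -, -⟩ := h.avoid x x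
  obtain ⟨y, hy⟩ : E₁.Nonempty := card_pos.1 (by rw [h.card3 _ hE₁]; omega)
  obtain ⟨D₁, hD₁, D₂, hD₂, hD, x3, x4, y3, y4⟩ := h.avoid x y
  have hI4 := hsmall E₁ hE₁ E₂ hE₂ D₁ hD₁ D₂ hD₂ hE hD x1 x2 x3 x4
  have hcover : ∀ A ∈ F, x ∈ A → (∃ p ∈ (E₁ ∪ E₂) ∩ (D₁ ∪ D₂), p ∈ A) ∨
      ∃ p ∈ (E₁ ∪ E₂) \ (D₁ ∪ D₂), ∃ q ∈ (D₁ ∪ D₂) \ (E₁ ∪ E₂), p ∈ A ∧ q ∈ A := by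
    intro A hA hxA
    obtain ⟨p, hp, hp'⟩ := h.hits hE₁ hE₂ hE hA
    obtain ⟨q, hq, hq'⟩ := h.hits hD₁ hD₂ hD hA
    clear hsmall
    simp only [mem_inter, mem_sdiff]
    by_cases h1 : p ∈ D₁ ∪ D₂
    · exact Or.inl ⟨p, ⟨hp', h1⟩, hp⟩
    by_cases h2 : q ∈ E₁ ∪ E₂
    · exact Or.inl ⟨q, ⟨h2, hq'⟩, hq⟩
    exact Or.inr ⟨p, ⟨hp', h1⟩, q, ⟨hq', h2⟩, hp, hq⟩
  have hS : #(E₁ ∪ E₂) = 6 := by rw [card_union_of_disjoint hE, h.card3 _ hE₁, h.card3 _ hE₂]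
  have hS' : #(D₁ ∪ D₂) = 6 := by rw [card_union_of_disjoint hD, h.card3 _ hD₁, h.card3 _ hD₂]
  have hcross := card_cross_le (x := x) h.card3 (X := (E₁ ∪ E₂) \ (D₁ ∪ D₂))
    (Y := (D₁ ∪ D₂) \ (E₁ ∪ E₂)) (by simp [x1, x2]) (by simp [x3, x4])
    (disjoint_of_subset_right sdiff_subset sdiff_disjoint)
  have hxI : x ∉ (E₁ ∪ E₂) ∩ (D₁ ∪ D₂) := by simp [x1, x2]
  have b1 := card_sdiff_add_card_inter (E₁ ∪ E₂) (D₁ ∪ D₂)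
  have b2 := card_sdiff_add_card_inter (D₁ ∪ D₂) (E₁ ∪ E₂)
  rw [inter_comm (D₁ ∪ D₂)] at b2
  have hI5 : #((E₁ ∪ E₂) ∩ (D₁ ∪ D₂)) ≤ 5 := by
    have : #((E₁ ∪ E₂) ∩ (D₁ ∪ D₂)) < #(E₁ ∪ E₂) := card_lt_card (by
      refine ⟨inter_subset_left, fun hc => ?_⟩
      have := hc (mem_union_left _ hy)
      simp [y3, y4] at this)
    omega
  set I := (E₁ ∪ E₂) ∩ (D₁ ∪ D₂) with hIdef
  -- link edges at `q` that leave `I` end in the part outside `I` of the cover avoiding `q`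
  have hleave : ∀ q ∈ I, #{A ∈ F | x ∈ A ∧ A ∩ I = {q}} ≤ 8 - #I := by
    intro q hq
    obtain ⟨P, hP, Q, hQ, hPQ, x5, x6, q5, q6⟩ := h.avoid x q
    have h4 := hsmall E₁ hE₁ E₂ hE₂ P hP Q hQ hE hPQ x1 x2 x5 x6
    have hP6 : #(P ∪ Q) = 6 := by rw [card_union_of_disjoint hPQ, h.card3 _ hP, h.card3 _ hQ]
    have hb : #((P ∪ Q) \ I) ≤ 8 - #I := by
      have c1 := card_sdiff_add_card_inter (P ∪ Q) I
      have c2 : #((E₁ ∪ E₂) ∩ (P ∪ Q)) ≤ #((P ∪ Q) ∩ I) + #((E₁ ∪ E₂) \ (D₁ ∪ D₂)) := by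
        refine (card_le_card ?_).trans (card_union_le _ _)
        rw [hIdef]; intro z; simp only [mem_inter, mem_union, mem_sdiff]; tauto
      omega
    have := card_cross_le (x := x) h.card3 (X := {q}) (Y := (P ∪ Q) \ I)
      (by rw [mem_singleton]; rintro rfl; exact hxI hq) (by simp [x5, x6])
      (by simp [q5, q6])
    rw [card_singleton, one_mul] at this
    refine le_trans (card_le_card fun A hA => ?_) (this.trans hb)
    simp only [mem_filter] at hA ⊢
    obtain ⟨hA, hxA, hAI⟩ := hA
    obtain ⟨z, hz, hz'⟩ := h.hits hP hQ hPQ hA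
    have hqA : q ∈ A ∩ I := by rw [hAI]; simp
    refine ⟨hA, hxA, q, by simp, z, mem_sdiff.2 ⟨hz', fun hzI => ?_⟩, (mem_inter.1 hqA).1, hz⟩
    have : z ∈ A ∩ I := mem_inter.2 ⟨hz, hzI⟩
    rw [hAI, mem_singleton] at this
    subst this
    simp [q5, q6] at hz'
  have hmeet : 2 * #{A ∈ F | x ∈ A ∧ ∃ p ∈ I, p ∈ A} ≤
      ∑ q ∈ I, (#{A ∈ F | x ∈ A ∧ q ∈ A} + #{A ∈ F | x ∈ A ∧ A ∩ I = {q}}) := by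
    simp only [card_filter, ← sum_add_distrib]
    rw [sum_comm, mul_sum]
    refine sum_le_sum fun A hA => ?_
    by_cases hxA : x ∈ A
    swap
    · simp [hxA]
    simp only [hxA, true_and]
    split_ifs with hp
    · obtain ⟨p, hpI, hpA⟩ := hp
      by_cases hq : ∃ q ∈ I, q ∈ A ∧ q ≠ p
      · obtain ⟨q, hqI, hqA, hqp⟩ := hq
        refine le_trans ?_ (sum_le_sum_of_subset (s := {p, q}) ?_)
        · rw [sum_pair hqp.symm, if_pos hpA, if_pos hqA]; omega
        · intro z; simp only [mem_insert, mem_singleton]; rintro (rfl | rfl) <;> assumption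
      · push Not at hq
        have : A ∩ I = {p} := by
          ext z; simp only [mem_inter, mem_singleton]
          exact ⟨fun hz => hq z hz.2 hz.1, by rintro rfl; exact ⟨hpA, hpI⟩⟩
        refine le_trans ?_ (single_le_sum (fun _ _ => Nat.zero_le _) hpI)
        rw [if_pos hpA, if_pos this]; norm_num
    · simp
  have hsum : ∑ q ∈ I, (#{A ∈ F | x ∈ A ∧ q ∈ A} + #{A ∈ F | x ∈ A ∧ A ∩ I = {q}}) ≤
      #I • (6 + (8 - #I)) := by
    refine sum_le_card_nsmul _ _ _ fun q hq => add_le_add ?_ (hleave q hq)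
    exact h.codegree_le (by rintro rfl; exact hxI hq)
  have htot : #{A ∈ F | x ∈ A} ≤ #{A ∈ F | x ∈ A ∧ ∃ p ∈ I, p ∈ A} +
      #{A ∈ F | x ∈ A ∧ ∃ p ∈ (E₁ ∪ E₂) \ (D₁ ∪ D₂), ∃ q ∈ (D₁ ∪ D₂) \ (E₁ ∪ E₂),
        p ∈ A ∧ q ∈ A} := by
    refine (card_le_card fun A hA => ?_).trans (card_union_le _ _)
    rw [mem_filter] at hA
    rw [mem_union, mem_filter, mem_filter]
    rcases hcover A hA.1 hA.2 with hc | hc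
    · exact Or.inl ⟨hA.1, hA.2, hc⟩
    · exact Or.inr ⟨hA.1, hA.2, hc⟩
  have q1 : #((E₁ ∪ E₂) \ (D₁ ∪ D₂)) = 6 - #I := by omega
  have q2 : #((D₁ ∪ D₂) \ (E₁ ∪ E₂)) = 6 - #I := by omega
  rw [q1, q2] at hcross
  have hI : #I = 4 ∨ #I = 5 := by omega
  rcases hI with hI | hI <;> rw [hI] at hcross hsum <;> simp only [smul_eq_mul] at hsum <;> omega

end

/-! ### Intersecting and cross-intersecting graphs -/

section

variable {V : Type*} [DecidableEq V]

section Graphs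

variable {L L' : Finset (Finset V)}

theorem eq_pair_of_card_two {e : Finset V} (he : #e = 2) {a b : V} (ha : a ∈ e) (hb : b ∈ e)
    (hab : a ≠ b) : e = {a, b} := by
  symm
  refine eq_of_subset_of_card_le ?_ (by rw [he, card_pair hab])
  intro w; simp only [mem_insert, mem_singleton]; rintro (rfl | rfl) <;> assumption

/-- An intersecting graph is a star or is contained in a triangle. -/
theorem star_or_triangle (h2 : ∀ e ∈ L, #e = 2) (hL : L.Nonempty)
    (hi : ∀ e ∈ L, ∀ f ∈ L, ¬ Disjoint e f) :
    (∃ v, ∀ e ∈ L, v ∈ e) ∨ ∃ T : Finset V, #T = 3 ∧ (∀ e ∈ L, e ⊆ T) ∧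
      ∀ v ∈ T, ∃ e ∈ L, v ∉ e := by
  by_cases hs : ∃ v, ∀ e ∈ L, v ∈ e
  · exact Or.inl hs
  right
  push Not at hs
  obtain ⟨e, he⟩ := hL
  obtain ⟨a, b, hab, rfl⟩ := card_eq_two.1 (h2 e he)
  obtain ⟨f, hf, haf⟩ := hs a
  obtain ⟨g, hg, hbg⟩ := hs b
  have key : ∀ e ∈ L, ∀ f ∈ L, ∃ z ∈ e, z ∈ f := fun e he f hf => not_disjoint_iff.1 (hi e he f hf)
  have hbf : b ∈ f := by
    obtain ⟨z, hz, hz'⟩ := key _ he f hf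
    simp only [mem_insert, mem_singleton] at hz
    rcases hz with rfl | rfl
    · exact absurd hz' haf
    · exact hz'
  have hag : a ∈ g := by
    obtain ⟨z, hz, hz'⟩ := key _ he g hg
    simp only [mem_insert, mem_singleton] at hz
    rcases hz with rfl | rfl
    · exact hz'
    · exact absurd hz' hbg
  obtain ⟨c, hcf, hcg⟩ := key f hf g hg
  have hac : a ≠ c := by rintro rfl; exact haf hcf
  have hbc : b ≠ c := by rintro rfl; exact hbg hcg
  obtain rfl := eq_pair_of_card_two (h2 f hf) hbf hcf hbc
  obtain rfl := eq_pair_of_card_two (h2 g hg) hag hcg hac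
  refine ⟨{a, b, c}, card_eq_three.2 ⟨a, b, c, hab, hac, hbc, rfl⟩, ?_, fun v _ => hs v⟩
  intro k hk
  obtain ⟨x, hx, hx'⟩ := key _ he k hk
  obtain ⟨y, hy, hy'⟩ := key _ hf k hk
  obtain ⟨z, hz, hz'⟩ := key _ hg k hk
  simp only [mem_insert, mem_singleton] at hx hy hz
  have : ∃ p ∈ k, ∃ q ∈ k, p ≠ q ∧ p ∈ ({a, b, c} : Finset V) ∧ q ∈ ({a, b, c} : Finset V) := by
    by_cases hxy : x = y
    · refine ⟨x, hx', z, hz', ?_, by simp; tauto, by simp; tauto⟩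
      subst hxy
      rintro rfl
      grind
    · exact ⟨x, hx', y, hy', hxy, by simp; tauto, by simp; tauto⟩
  obtain ⟨p, hp, q, hq, hpq, hp', hq'⟩ := this
  rw [eq_pair_of_card_two (h2 k hk) hp hq hpq]
  intro w hw
  rw [mem_insert, mem_singleton] at hw
  rcases hw with rfl | rfl <;> assumption

/-- The edges meeting both of two disjoint pairs `e` and `f` lie in a `4`-cycle. -/
theorem subset_cycle (h2 : ∀ e ∈ L, #e = 2) {e f : Finset V} (hef : Disjoint e f)
    (he : ∀ k ∈ L, ¬ Disjoint e k) (hf : ∀ k ∈ L, ¬ Disjoint f k) :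
    L ⊆ (e ×ˢ f).image fun w => {w.1, w.2} := by
  intro k hk
  obtain ⟨p, hp, hp'⟩ := not_disjoint_iff.1 (he k hk)
  obtain ⟨q, hq, hq'⟩ := not_disjoint_iff.1 (hf k hk)
  have hpq : p ≠ q := by rintro rfl; exact disjoint_left.1 hef hp hq
  exact mem_image.2 ⟨(p, q), mem_product.2 ⟨hp, hq⟩,
    (eq_pair_of_card_two (h2 k hk) hp' hq' hpq).symm⟩

theorem card_cycle_le {e f : Finset V} (he : #e = 2) (hf : #f = 2) :
    #((e ×ˢ f).image fun w => ({w.1, w.2} : Finset V)) ≤ 4 :=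
  card_image_le.trans (by rw [card_product, he, hf])

/-- A graph whose edges all meet two disjoint pairs is contained in a `4`-cycle. -/
theorem card_le_four_of_cross (h2 : ∀ e ∈ L, #e = 2) (h2' : ∀ e ∈ L', #e = 2)
    (hc : ∀ e ∈ L, ∀ f ∈ L', ¬ Disjoint e f) {e f : Finset V} (he : e ∈ L) (hf : f ∈ L)
    (hef : Disjoint e f) : #L' ≤ 4 :=
  (card_le_card (subset_cycle h2' hef (hc e he) (hc f hf))).trans
    (card_cycle_le (h2 e he) (h2 f hf))

/-- Two cross-intersecting subgraphs of a `4`-cycle have at most four edges in total, since the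
complements of the edges of one of them are not in the other. -/
theorem card_add_card_le_four {e f : Finset V} (he : #e = 2) (hf : #f = 2) (hef : Disjoint e f)
    (hL : L ⊆ (e ×ˢ f).image fun w => {w.1, w.2}) (hL' : L' ⊆ (e ×ˢ f).image fun w => {w.1, w.2})
    (hc : ∀ k ∈ L, ∀ k' ∈ L', ¬ Disjoint k k') : #L + #L' ≤ 4 := by
  have hin : ∀ k ∈ L, k ⊆ e ∪ f := by
    intro k hk
    obtain ⟨⟨p, q⟩, hpq, rfl⟩ := mem_image.1 (hL hk)
    rw [mem_product] at hpq
    intro w hw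
    simp only [mem_insert, mem_singleton] at hw
    rcases hw with rfl | rfl
    · exact mem_union_left _ hpq.1
    · exact mem_union_right _ hpq.2
  have hsub : L.image (fun k => (e ∪ f) \ k) ∪ L' ⊆
      (e ×ˢ f).image fun w => ({w.1, w.2} : Finset V) := by
    refine union_subset ?_ hL'
    intro k' hk₀
    obtain ⟨k, hk, rfl⟩ := mem_image.1 hk₀
    obtain ⟨⟨p, q⟩, hpq, hk'⟩ := mem_image.1 (hL hk)
    subst hk'
    obtain ⟨hp, hq⟩ := mem_product.1 hpq
    obtain ⟨p', hp'⟩ : (e.erase p).Nonempty := card_pos.1 (by rw [card_erase_of_mem hp, he]; simp)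
    obtain ⟨q', hq'⟩ : (f.erase q).Nonempty := card_pos.1 (by rw [card_erase_of_mem hq, hf]; simp)
    rw [mem_erase] at hp' hq'
    have e1 := eq_pair_of_card_two he hp hp'.2 hp'.1.symm
    have e2 := eq_pair_of_card_two hf hq hq'.2 hq'.1.symm
    refine mem_image.2 ⟨(p', q'), mem_product.2 ⟨hp'.2, hq'.2⟩, ?_⟩
    have hd := disjoint_left.1 hef
    subst e1 e2
    ext z
    simp only [mem_insert, mem_singleton, mem_sdiff, mem_union] at *
    grind
  have hdis : Disjoint (L.image fun k => (e ∪ f) \ k) L' := by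
    rw [disjoint_left]
    intro k hk₀ hk'
    obtain ⟨k, hk, rfl⟩ := mem_image.1 hk₀
    exact hc _ hk _ hk' disjoint_sdiff
  have := (card_le_card hsub).trans (card_cycle_le he hf)
  rwa [card_union_of_disjoint hdis, card_image_of_injOn] at this
  intro k hk k' hk' hkk
  have := congrArg (fun s => (e ∪ f) \ s) hkk
  simpa only [Finset.sdiff_sdiff_eq_self (hin k hk), Finset.sdiff_sdiff_eq_self (hin k' hk')]
    using this

/-- An intersecting subgraph of a `4`-cycle has at most two edges. -/
theorem card_le_two_of_cross (h2 : ∀ e ∈ L, #e = 2) (h2' : ∀ e ∈ L', #e = 2)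
    (hc : ∀ e ∈ L, ∀ f ∈ L', ¬ Disjoint e f) {e f : Finset V} (he : e ∈ L) (hf : f ∈ L)
    (hef : Disjoint e f) (hi : ∀ e ∈ L', ∀ f ∈ L', ¬ Disjoint e f) : #L' ≤ 2 := by
  have hsub := subset_cycle h2' hef (hc e he) (hc f hf)
  have := card_add_card_le_four (h2 e he) (h2 f hf) hef hsub hsub hi
  omega

theorem star_of_cross_star (h2 : ∀ e ∈ L, #e = 2) (h2' : ∀ e ∈ L', #e = 2)
    (hc : ∀ e ∈ L, ∀ f ∈ L', ¬ Disjoint e f) {v : V} (hv : ∀ e ∈ L, v ∈ e) (h3 : 3 ≤ #L) :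
    ∀ f ∈ L', v ∈ f := by
  intro f hf
  by_contra hvf
  have : #L ≤ #(f.image fun z => ({v, z} : Finset V)) := by
    refine card_le_card fun e he => ?_
    obtain ⟨z, hz, hz'⟩ := not_disjoint_iff.1 (hc e he f hf)
    have : v ≠ z := by rintro rfl; exact hvf hz'
    exact mem_image.2 ⟨z, hz', (eq_pair_of_card_two (h2 e he) (hv e he) hz this).symm⟩
  have := card_image_le.trans (h2' f hf).le |> this.trans
  omega

omit [DecidableEq V] in
theorem card_le_three_of_subset (h2 : ∀ e ∈ L, #e = 2) {T : Finset V} (hT : #T = 3)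
    (h : ∀ e ∈ L, e ⊆ T) : #L ≤ 3 := by
  have : L ⊆ powersetCard 2 T := fun e he => mem_powersetCard.2 ⟨h e he, h2 e he⟩
  have := card_le_card this
  rwa [card_powersetCard, hT] at this

/-- Two cross-intersecting graphs are stars with a common centre, or one of them has at most two
edges, or both have at most four. -/
theorem cross_intersecting (h2 : ∀ e ∈ L, #e = 2) (h2' : ∀ e ∈ L', #e = 2)
    (hc : ∀ e ∈ L, ∀ f ∈ L', ¬ Disjoint e f) :
    (∃ v, (∀ e ∈ L, v ∈ e) ∧ (∀ e ∈ L', v ∈ e) ∧ L.Nonempty) ∨ #L ≤ 2 ∨ #L' ≤ 2 ∨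
      (#L ≤ 4 ∧ #L' ≤ 4) := by
  have hc' : ∀ e ∈ L', ∀ f ∈ L, ¬ Disjoint e f := fun e he f hf h => hc f hf e he h.symm
  by_cases h3 : #L ≤ 2
  · exact Or.inr (Or.inl h3)
  by_cases h3' : #L' ≤ 2
  · exact Or.inr (Or.inr (Or.inl h3'))
  have hne : L.Nonempty := card_pos.1 (by omega)
  have hne' : L'.Nonempty := card_pos.1 (by omega)
  by_cases hi : ∀ e ∈ L, ∀ f ∈ L, ¬ Disjoint e f
  · by_cases hi' : ∀ e ∈ L', ∀ f ∈ L', ¬ Disjoint e f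
    · rcases star_or_triangle h2 hne hi with ⟨v, hv⟩ | ⟨T, hT, hTL, -⟩
      · exact Or.inl ⟨v, hv, star_of_cross_star h2 h2' hc hv (by omega), hne⟩
      rcases star_or_triangle h2' hne' hi' with ⟨v, hv⟩ | ⟨T', hT', hTL', -⟩
      · exact Or.inl ⟨v, star_of_cross_star h2' h2 hc' hv (by omega), hv, hne⟩
      have := card_le_three_of_subset h2 hT hTL
      have := card_le_three_of_subset h2' hT' hTL'
      exact Or.inr (Or.inr (Or.inr (by omega)))
    · push Not at hi'
      obtain ⟨e, he, f, hf, hef⟩ := hi'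
      exact Or.inr (Or.inl (card_le_two_of_cross h2' h2 hc' he hf hef hi))
  · push Not at hi
    obtain ⟨e, he, f, hf, hef⟩ := hi
    by_cases hi' : ∀ e ∈ L', ∀ f ∈ L', ¬ Disjoint e f
    · exact Or.inr (Or.inr (Or.inl (card_le_two_of_cross h2 h2' hc he hf hef hi')))
    · push Not at hi'
      obtain ⟨e', he', f', hf', hef'⟩ := hi'
      exact Or.inr (Or.inr (Or.inr ⟨card_le_four_of_cross h2' h2 hc' he' hf' hef',
        card_le_four_of_cross h2 h2' hc he hf hef⟩))

end Graphs

/-! ### Edges meeting a pair of vertices -/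

variable {F : Finset (Finset V)}

/-- The edges that contain `x` but not `y`, meet `P` and avoid `Q`. -/
def oneSided (F : Finset (Finset V)) (x y : V) (P Q : Finset V) : Finset (Finset V) :=
  {A ∈ F | x ∈ A ∧ y ∉ A ∧ ¬ Disjoint A P ∧ Disjoint A Q}

/-- The edges that contain `x` but not `y` and meet both `P` and `Q`. -/
def twoSided (F : Finset (Finset V)) (x y : V) (P Q : Finset V) : Finset (Finset V) :=
  {A ∈ F | x ∈ A ∧ y ∉ A ∧ ¬ Disjoint A P ∧ ¬ Disjoint A Q}

theorem twoSided_comm (x y : V) (P Q : Finset V) : twoSided F x y P Q = twoSided F x y Q P := by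
  unfold twoSided
  refine filter_congr fun A _ => ?_
  tauto

theorem Resilient.card_twoSided_le (h : Resilient F) {x y : V} {P Q : Finset V} (hP : x ∉ P)
    (hQ : x ∉ Q) (hPQ : Disjoint P Q) : #(twoSided F x y P Q) ≤ #P * #Q := by
  refine (card_le_card fun A hA => ?_).trans (card_cross_le (x := x) h.card3 hP hQ hPQ)
  simp only [twoSided, mem_filter, not_disjoint_iff] at hA ⊢
  obtain ⟨hA, hxA, -, ⟨p, hp, hp'⟩, q, hq, hq'⟩ := hA
  exact ⟨hA, hxA, p, hp', q, hq', hp, hq⟩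

/-- The codegree bound, summed over the vertices of `P`. -/
theorem Resilient.card_side_le (h : Resilient F) {x y : V} {P Q : Finset V} (hP : x ∉ P) :
    #(oneSided F x y P Q) + #(twoSided F x y P Q) + #{A ∈ F | x ∈ A ∧ y ∈ A ∧ ¬ Disjoint A P} ≤
      6 * #P := by
  refine le_trans ?_ (h.card_meet_le hP)
  rw [← card_union_of_disjoint, ← card_union_of_disjoint]
  · refine card_le_card fun A hA => ?_
    simp only [oneSided, twoSided, mem_union, mem_filter, not_disjoint_iff] at hA ⊢
    rcases hA with (hA | hA) | hA <;> obtain ⟨z, hz⟩ : ∃ z, z ∈ A ∧ z ∈ P := by tauto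
    all_goals exact ⟨hA.1, hA.2.1, z, hz.2, hz.1⟩
  · rw [disjoint_left]; intro A; simp only [oneSided, twoSided, mem_union, mem_filter]; tauto
  · rw [disjoint_left]; intro A; simp only [oneSided, twoSided, mem_filter]; tauto

/-- If the edges of the one-sided family have a common vertex `v ∈ P`, its size is bounded through
the codegree of `x` and `v`. -/
theorem Resilient.card_oneSided_of_star (h : Resilient F) {x y v : V} {P Q : Finset V} (hP : x ∉ P)
    (hv : v ∈ P) (hs : ∀ A ∈ oneSided F x y P Q, v ∈ A) :
    #(oneSided F x y P Q) + #{A ∈ twoSided F x y P Q | v ∈ A} ≤ 6 := by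
  refine le_trans ?_ (h.codegree_le (x := x) (y := v) (by rintro rfl; exact hP hv))
  rw [← card_union_of_disjoint]
  · refine card_le_card fun A hA => ?_
    simp only [mem_union, mem_filter] at hA ⊢
    rcases hA with hA | hA
    · have := hs A hA
      simp only [oneSided, mem_filter] at hA
      exact ⟨hA.1, hA.2.1, this⟩
    · simp only [twoSided, mem_filter] at hA
      exact ⟨hA.1.1, hA.1.2.1, hA.2⟩
  · rw [disjoint_left]; intro A; simp only [oneSided, twoSided, mem_filter]; tauto

/-- Apart from the members through `v`, the two-sided family has at most `2 · 3` members. -/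
theorem Resilient.card_twoSided_of_star (h : Resilient F) {x y v : V} {P Q : Finset V} (hP : x ∉ P)
    (hQ : x ∉ Q) (hPQ : Disjoint P Q) (hP3 : #P = 3) (hQ3 : #Q = 3) (hv : v ∈ P) :
    #(twoSided F x y P Q) ≤ #{A ∈ twoSided F x y P Q | v ∈ A} + 6 := by
  have := card_cross_le (x := x) h.card3 (X := P.erase v) (Y := Q) (by simp [hP]) hQ
    (disjoint_of_subset_left (erase_subset _ _) hPQ)
  rw [card_erase_of_mem hv, hP3, hQ3] at this
  refine le_trans (card_le_card fun A hA => ?_) ((card_union_le _ _).trans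
    (Nat.add_le_add_left this _))
  simp only [twoSided, mem_union, mem_filter, not_disjoint_iff, mem_erase] at hA ⊢
  by_cases hvA : v ∈ A
  · left; tauto
  · obtain ⟨hA, hxA, hy, ⟨p, hp, hp'⟩, q, hq, hq'⟩ := hA
    exact Or.inr ⟨hA, hxA, p, ⟨by rintro rfl; exact hvA hp, hp'⟩, q, hq', hp, hq⟩

/-- Apart from the members through `v` or `w`, the two-sided family has at most `2 · 2` members. -/
theorem Resilient.card_twoSided_of_stars (h : Resilient F) {x y v w : V} {P Q : Finset V}
    (hP : x ∉ P) (hQ : x ∉ Q) (hPQ : Disjoint P Q) (hP3 : #P = 3) (hQ3 : #Q = 3) (hv : v ∈ P)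
    (hw : w ∈ Q) : #(twoSided F x y P Q) ≤
      #{A ∈ twoSided F x y P Q | v ∈ A} + #{A ∈ twoSided F x y P Q | w ∈ A} + 4 := by
  have := card_cross_le (x := x) h.card3 (X := P.erase v) (Y := Q.erase w) (by simp [hP])
    (by simp [hQ]) (disjoint_of_subset_left (erase_subset _ _)
      (disjoint_of_subset_right (erase_subset _ _) hPQ))
  rw [card_erase_of_mem hv, hP3, card_erase_of_mem hw, hQ3] at this
  refine le_trans (card_le_card fun A hA => ?_) ((card_union_le _ _).trans
    (Nat.add_le_add (card_union_le _ _) this))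
  simp only [twoSided, mem_union, mem_filter, not_disjoint_iff, mem_erase] at hA ⊢
  by_cases hvA : v ∈ A
  · left; left; tauto
  by_cases hwA : w ∈ A
  · left; right; tauto
  · obtain ⟨hA, hxA, hy, ⟨p, hp, hp'⟩, q, hq, hq'⟩ := hA
    exact Or.inr ⟨hA, hxA, p, ⟨by rintro rfl; exact hvA hp, hp'⟩, q,
      ⟨by rintro rfl; exact hwA hq, hq'⟩, hp, hq⟩

/-- The one-sided families of `x` and of `y` on the same edge `P` are cross-intersecting outside
`x` and `y`, as two disjoint members would form a matching of size three with `Q`. -/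
theorem Resilient.oneSided_cases (h : Resilient F) {x y : V} {P Q : Finset V}
    (hQ : Q ∈ F) (hx : x ∉ P) (hy : y ∉ P) (hP3 : #P = 3) :
    (∃ v ∈ P, (∀ A ∈ oneSided F x y P Q, v ∈ A) ∧ ∀ A ∈ oneSided F y x P Q, v ∈ A) ∨
      #(oneSided F x y P Q) ≤ 2 ∨ #(oneSided F y x P Q) ≤ 2 ∨
      (#(oneSided F x y P Q) ≤ 4 ∧ #(oneSided F y x P Q) ≤ 4) := by
  have hmem : ∀ {x y A}, A ∈ oneSided F x y P Q →
      A ∈ F ∧ x ∈ A ∧ y ∉ A ∧ ¬ Disjoint A P ∧ Disjoint A Q := fun hA => by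
    simpa only [oneSided, mem_filter] using hA
  have hcard : ∀ x y, #((oneSided F x y P Q).image fun A => A.erase x) = #(oneSided F x y P Q) := by
    intro x y
    refine card_image_of_injOn fun A hA B hB hAB => ?_
    have := congrArg (insert x) hAB
    simpa only [insert_erase (hmem hA).2.1, insert_erase (hmem hB).2.1] using this
  have h2 : ∀ x y, ∀ e ∈ (oneSided F x y P Q).image fun A => A.erase x, #e = 2 := by
    intro x y e he
    obtain ⟨A, hA, rfl⟩ := mem_image.1 he
    rw [card_erase_of_mem (hmem hA).2.1, h.card3 A (hmem hA).1]
  -- a common vertex outside `P` leaves room for three members only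
  have hout : ∀ {x y v}, x ∉ P → v ≠ x → v ∉ P → (∀ A ∈ oneSided F x y P Q, v ∈ A) →
      #(oneSided F x y P Q) ≤ 4 := by
    intro x y v hx hvx hv hs
    have := card_cross_le (x := x) h.card3 (X := {v}) (Y := P) (by simpa using hvx.symm) hx
      (by simpa using hv)
    rw [card_singleton, hP3] at this
    refine (card_le_card fun A hA => ?_).trans (this.trans (by norm_num))
    have hvA := hs A hA
    obtain ⟨hA, hxA, -, hAP, -⟩ := hmem hA
    obtain ⟨p, hp, hp'⟩ := not_disjoint_iff.1 hAP
    exact mem_filter.2 ⟨hA, hxA, v, by simp, p, hp', hvA, hp⟩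
  rcases cross_intersecting (h2 x y) (h2 y x) (by
    intro e he f hf hef
    obtain ⟨A, hA, rfl⟩ := mem_image.1 he
    obtain ⟨B, hB, rfl⟩ := mem_image.1 hf
    have hA' := hmem hA
    have hB' := hmem hB
    refine h.no_three A hA'.1 B hB'.1 Q hQ ?_ hA'.2.2.2.2 hB'.2.2.2.2
    rw [disjoint_left] at hef ⊢
    intro z hzA hzB
    refine hef (mem_erase.2 ⟨?_, hzA⟩) (mem_erase.2 ⟨?_, hzB⟩)
    · rintro rfl; exact hB'.2.2.1 hzB
    · rintro rfl; exact hA'.2.2.1 hzA) with ⟨v, hv, hv', hne⟩ | hc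
  · have hvx : v ≠ x := by
      obtain ⟨e, he⟩ := hne
      have := hv e he
      obtain ⟨A, hA, rfl⟩ := mem_image.1 he
      exact (mem_erase.1 this).1
    have s1 : ∀ A ∈ oneSided F x y P Q, v ∈ A := fun A hA =>
      (mem_erase.1 (hv _ (mem_image_of_mem _ hA))).2
    have s2 : ∀ A ∈ oneSided F y x P Q, v ∈ A := fun A hA =>
      (mem_erase.1 (hv' _ (mem_image_of_mem _ hA))).2
    by_cases hvP : v ∈ P
    · exact Or.inl ⟨v, hvP, s1, s2⟩
    · by_cases hvy : v = y
      · subst hvy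
        have hempty : oneSided F x v P Q = ∅ := by
          refine eq_empty_of_forall_notMem fun A hA => ?_
          exact (hmem hA).2.2.1 (s1 A hA)
        right; left; rw [hempty]; simp
      · exact Or.inr (Or.inr (Or.inr ⟨hout hx hvx hvP s1, hout hy hvy hvP s2⟩))
  · rw [hcard, hcard] at hc
    exact Or.inr hc

/-- At most `40` edges meet a given pair of vertices. For disjoint edges `P`, `Q` that avoid `x` and
`y`, the edges through exactly one of `x`, `y` are one-sided or two-sided. The alternatives of
`Resilient.oneSided_cases` for `P` and for `Q`, together with the bounds on degrees and codegrees,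
leave a finite problem in the sizes of these families. -/
theorem Resilient.card_meet_pair_le (h : Resilient F) {x y : V} (hxy : x ≠ y) :
    #{A ∈ F | x ∈ A ∨ y ∈ A} ≤ 40 := by
  obtain ⟨P, hP, Q, hQ, hPQ, xP, xQ, yP, yQ⟩ := h.avoid x y
  have hP3 := h.card3 P hP
  have hQ3 := h.card3 Q hQ
  have hhit : ∀ A ∈ F, ¬ Disjoint A P ∨ ¬ Disjoint A Q := by
    intro A hA
    by_contra! hc
    exact h.no_three A hA P hP Q hQ hc.1 hc.2 hPQ
  have hsplit : ∀ x y, ({A ∈ F | x ∈ A ∧ y ∉ A} : Finset (Finset V)) ⊆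
      oneSided F x y P Q ∪ oneSided F x y Q P ∪ twoSided F x y P Q := by
    intro x y A hA
    simp only [oneSided, twoSided, mem_union, mem_filter] at hA ⊢
    have := hhit A hA.1
    tauto
  have hboth : #{A ∈ F | x ∈ A ∧ y ∈ A} ≤ #{A ∈ F | x ∈ A ∧ y ∈ A ∧ ¬ Disjoint A P} +
      #{A ∈ F | x ∈ A ∧ y ∈ A ∧ ¬ Disjoint A Q} := by
    refine (card_le_card fun A hA => ?_).trans (card_union_le _ _)
    simp only [mem_union, mem_filter] at hA ⊢
    have := hhit A hA.1
    tauto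
  have hdeg : ∀ x y, #(oneSided F x y P Q) + #(oneSided F x y Q P) + #(twoSided F x y P Q) +
      #{A ∈ F | x ∈ A ∧ y ∈ A} ≤ 24 := by
    intro x y
    refine le_trans ?_ (h.degree_le x)
    rw [← card_union_of_disjoint, ← card_union_of_disjoint, ← card_union_of_disjoint]
    · refine card_le_card fun A hA => ?_
      simp only [oneSided, twoSided, mem_union, mem_filter] at hA ⊢
      tauto
    all_goals
      rw [disjoint_left]; intro A; simp only [oneSided, twoSided, mem_union, mem_filter]; tauto
  have htot : #{A ∈ F | x ∈ A ∨ y ∈ A} ≤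
      (#(oneSided F x y P Q) + #(oneSided F x y Q P) + #(twoSided F x y P Q)) +
      (#(oneSided F y x P Q) + #(oneSided F y x Q P) + #(twoSided F y x P Q)) +
      #{A ∈ F | x ∈ A ∧ y ∈ A} := by
    have t1 : #{A ∈ F | x ∈ A ∨ y ∈ A} ≤ #{A ∈ F | x ∈ A ∧ y ∉ A} + #{A ∈ F | y ∈ A ∧ x ∉ A} +
        #{A ∈ F | x ∈ A ∧ y ∈ A} := by
      refine (card_le_card fun A hA => ?_).trans ((card_union_le _ _).trans
        (Nat.add_le_add_right (card_union_le _ _) _))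
      simp only [mem_union, mem_filter] at hA ⊢
      tauto
    have t2 := (card_le_card (hsplit x y)).trans ((card_union_le _ _).trans
        (Nat.add_le_add_right (card_union_le _ _) _))
    have t3 := (card_le_card (hsplit y x)).trans ((card_union_le _ _).trans
        (Nat.add_le_add_right (card_union_le _ _) _))
    omega
  have d1 := hdeg x y
  have d2 := hdeg y x
  have hcomm : #{A ∈ F | y ∈ A ∧ x ∈ A} = #{A ∈ F | x ∈ A ∧ y ∈ A} := by simp only [and_comm]
  have hcommP : ∀ P, #{A ∈ F | y ∈ A ∧ x ∈ A ∧ ¬ Disjoint A P} =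
      #{A ∈ F | x ∈ A ∧ y ∈ A ∧ ¬ Disjoint A P} := fun P => by simp only [and_left_comm]
  rw [hcomm] at d2
  have hcod := h.codegree_le hxy
  have a1 := h.card_side_le (y := y) (Q := Q) xP
  have a2 := h.card_side_le (y := y) (Q := P) xQ
  have a3 := h.card_side_le (y := x) (Q := Q) yP
  have a4 := h.card_side_le (y := x) (Q := P) yQ
  rw [hcommP] at a3 a4
  rw [twoSided_comm _ _ Q P] at a2 a4
  have b1 := h.card_twoSided_le (y := y) xP xQ hPQ
  have b2 := h.card_twoSided_le (y := x) yP yQ hPQ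
  rw [hP3] at a1 a3 b1 b2
  rw [hQ3] at a2 a4 b1 b2
  have cP := h.oneSided_cases hQ xP yP hP3
  have cQ := h.oneSided_cases hP xQ yQ hQ3
  have starP : ∀ {x y : V}, x ∉ P → x ∉ Q → ∀ v ∈ P, (∀ A ∈ oneSided F x y P Q, v ∈ A) →
      #(oneSided F x y P Q) + #(twoSided F x y P Q) ≤ 12 := fun {x y} hx hx' v hv hs => by
    have := h.card_oneSided_of_star (y := y) hx hv hs
    have := h.card_twoSided_of_star (y := y) hx hx' hPQ hP3 hQ3 hv
    omega
  have starQ : ∀ {x y : V}, x ∉ P → x ∉ Q → ∀ v ∈ Q, (∀ A ∈ oneSided F x y Q P, v ∈ A) →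
      #(oneSided F x y Q P) + #(twoSided F x y P Q) ≤ 12 := fun {x y} hx hx' v hv hs => by
    have k1 := h.card_oneSided_of_star (y := y) hx' hv hs
    have k2 := h.card_twoSided_of_star (y := y) hx' hx hPQ.symm hQ3 hP3 hv
    rw [twoSided_comm x y Q P] at k1 k2
    omega
  have starPQ : ∀ {x y : V}, x ∉ P → x ∉ Q → ∀ v ∈ P, (∀ A ∈ oneSided F x y P Q, v ∈ A) →
      ∀ w ∈ Q, (∀ A ∈ oneSided F x y Q P, w ∈ A) →
      #(oneSided F x y P Q) + #(oneSided F x y Q P) + #(twoSided F x y P Q) ≤ 16 :=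
    fun {x y} hx hx' v hv hs w hw hs' => by
    have k1 := h.card_oneSided_of_star (y := y) hx hv hs
    have k2 := h.card_oneSided_of_star (y := y) hx' hw hs'
    have k3 := h.card_twoSided_of_stars (y := y) hx hx' hPQ hP3 hQ3 hv hw
    rw [twoSided_comm x y Q P] at k2
    omega
  rcases cP with ⟨v, hv, s1, s2⟩ | cP
  · have p1 := starP xP xQ v hv s1
    have p2 := starP yP yQ v hv s2
    rcases cQ with ⟨w, hw, s3, s4⟩ | cQ
    · have q1 := starPQ xP xQ v hv s1 w hw s3
      have q2 := starPQ yP yQ v hv s2 w hw s4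
      omega
    · omega
  · rcases cQ with ⟨w, hw, s3, s4⟩ | cQ
    · have p1 := starQ xP xQ w hw s3
      have p2 := starQ yP yQ w hw s4
      omega
    · omega

end

/-! ### The optimisation problem for link edges in a triangle -/

section

/-- The nonempty subsets of `Fin 6` with at most three elements. -/
def patterns : List (Finset (Fin 6)) :=
  [{0}, {1}, {2}, {3}, {4}, {5},
   {0, 1}, {0, 2}, {1, 2}, {3, 4}, {3, 5}, {4, 5},
   {0, 3}, {0, 4}, {0, 5}, {1, 3}, {1, 4}, {1, 5}, {2, 3}, {2, 4}, {2, 5},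
   {0, 1, 2}, {3, 4, 5},
   {0, 1, 3}, {0, 1, 4}, {0, 1, 5}, {0, 2, 3}, {0, 2, 4}, {0, 2, 5},
   {1, 2, 3}, {1, 2, 4}, {1, 2, 5}, {0, 3, 4}, {0, 3, 5}, {0, 4, 5},
   {1, 3, 4}, {1, 3, 5}, {1, 4, 5}, {2, 3, 4}, {2, 3, 5}, {2, 4, 5}]

theorem mem_patterns : ∀ B : Finset (Fin 6), 1 ≤ #B → #B ≤ 3 → B ∈ patterns := by decide

/-- The optimisation problem for the numbers of edges with given patterns in the case that all
link edges outside the six vertices form a triangle. The rows `{0, 1, 2}` and `{3, 4, 5}` are edges.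
In `split`, the six labels are divided into a pair, a single label and a triple; if the triple is
an edge, the completions of the pair lie in every link edge of the single label. By `three`, every
edge of the triangle occurs in some link. -/
structure TriangleCounts (c : Finset (Fin 6) → ℕ) : Prop where
  pair : ∀ B, #B = 2 → c B ≤ 3
  triple : ∀ B, #B = 3 → c B ≤ 1
  row₁ : 1 ≤ c {0, 1, 2}
  row₂ : 1 ≤ c {3, 4, 5}
  split : ∀ B k T, #B = 2 ∧ k ∉ B ∧ T = univ \ insert k B → c T = 0 ∨ c B + c {k} ≤ 3
  three : 3 ≤ c {0} + c {1} + c {2} + c {3} + c {4} + c {5}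

namespace TriangleCounts

variable {c : Finset (Fin 6) → ℕ}

/-- A linear consequence of `split` for a label with nonempty link. -/
theorem relaxed (h : TriangleCounts c) (k : Fin 6) (hk : 1 ≤ c {k}) (B T : Finset (Fin 6))
    (hB : #B = 2 ∧ k ∉ B ∧ T = univ \ insert k B) : c B + c T ≤ 3 := by
  have h3 : #T = 3 := by
    rw [hB.2.2, card_sdiff_of_subset (subset_univ _), card_insert_of_notMem hB.2.1, hB.1]; rfl
  have := h.split B k T hB
  have := h.pair B hB.1
  have := h.triple T h3
  omega

theorem row01 (h : TriangleCounts c) : c {0, 1} + c {2} ≤ 3 := by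
  have := h.row₂
  exact (h.split {0, 1} 2 {3, 4, 5} (by decide)).resolve_left (by omega)

theorem row02 (h : TriangleCounts c) : c {0, 2} + c {1} ≤ 3 := by
  have := h.row₂
  exact (h.split {0, 2} 1 {3, 4, 5} (by decide)).resolve_left (by omega)

theorem row12 (h : TriangleCounts c) : c {1, 2} + c {0} ≤ 3 := by
  have := h.row₂
  exact (h.split {1, 2} 0 {3, 4, 5} (by decide)).resolve_left (by omega)

theorem row34 (h : TriangleCounts c) : c {3, 4} + c {5} ≤ 3 := by
  have := h.row₁
  exact (h.split {3, 4} 5 {0, 1, 2} (by decide)).resolve_left (by omega)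

theorem row35 (h : TriangleCounts c) : c {3, 5} + c {4} ≤ 3 := by
  have := h.row₁
  exact (h.split {3, 5} 4 {0, 1, 2} (by decide)).resolve_left (by omega)

theorem row45 (h : TriangleCounts c) : c {4, 5} + c {3} ≤ 3 := by
  have := h.row₁
  exact (h.split {4, 5} 3 {0, 1, 2} (by decide)).resolve_left (by omega)

theorem rows (h : TriangleCounts c) : c {0} + c {1} + c {2} + c {3} + c {4} + c {5} +
    (c {0, 1} + c {0, 2} + c {1, 2} + c {3, 4} + c {3, 5} + c {4, 5}) ≤ 18 := by
  linarith [h.row01, h.row02, h.row12, h.row34, h.row35, h.row45]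

theorem single_le (h : TriangleCounts c) (k : Fin 6) : c {k} ≤ 3 := by
  have := h.row01
  have := h.row02
  have := h.row12
  have := h.row34
  have := h.row35
  have := h.row45
  fin_cases k <;> simp <;> omega

theorem triple_le (h : TriangleCounts c) (T : Finset (Fin 6)) (hT : #T = 3 := by decide) :
    c T ≤ 1 := h.triple T hT

theorem pair_le (h : TriangleCounts c) (T : Finset (Fin 6)) (hT : #T = 2 := by decide) :
    c T ≤ 3 := h.pair T hT

/-- All labels with nonempty link are in one row. In this lemma and the next four, the hypotheses
describe the labels with nonempty link in the two rows, which come first in each row. -/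
theorem le_of_one_row (h : TriangleCounts c) (h0 : 1 ≤ c {0}) (h3 : c {3} = 0) (h4 : c {4} = 0)
    (h5 : c {5} = 0) : (patterns.map c).sum ≤ 56 := by
  have r0 := h.relaxed 0 h0
  simp only [patterns, List.map_cons, List.map_nil, List.sum_cons, List.sum_nil]
  linarith [h.row01, h.row02, h.row12,
    r0 {1, 3} {2, 4, 5} (by decide), r0 {1, 4} {2, 3, 5} (by decide),
    r0 {1, 5} {2, 3, 4} (by decide), r0 {2, 3} {1, 4, 5} (by decide),
    r0 {2, 4} {1, 3, 5} (by decide), r0 {2, 5} {1, 3, 4} (by decide),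
    r0 {3, 4} {1, 2, 5} (by decide), r0 {3, 5} {1, 2, 4} (by decide),
    r0 {4, 5} {1, 2, 3} (by decide), h.pair_le {0, 3}, h.pair_le {0, 4}, h.pair_le {0, 5},
    h.triple_le {0, 1, 2}, h.triple_le {3, 4, 5}, h.triple_le {0, 1, 3}, h.triple_le {0, 1, 4},
    h.triple_le {0, 1, 5}, h.triple_le {0, 2, 3}, h.triple_le {0, 2, 4}, h.triple_le {0, 2, 5},
    h.triple_le {0, 3, 4}, h.triple_le {0, 3, 5}, h.triple_le {0, 4, 5}]

theorem le_of_two_two (h : TriangleCounts c) (h0 : 1 ≤ c {0}) (h1 : 1 ≤ c {1}) (h3 : 1 ≤ c {3})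
    (h4 : 1 ≤ c {4}) : (patterns.map c).sum ≤ 56 := by
  have r0 := h.relaxed 0 h0
  have r1 := h.relaxed 1 h1
  have r3 := h.relaxed 3 h3
  have r4 := h.relaxed 4 h4
  simp only [patterns, List.map_cons, List.map_nil, List.sum_cons, List.sum_nil]
  linarith [h.rows,
    r1 {0, 3} {2, 4, 5} (by decide), r4 {0, 3} {1, 2, 5} (by decide),
    r1 {0, 4} {2, 3, 5} (by decide), r3 {0, 4} {1, 2, 5} (by decide),
    r1 {0, 5} {2, 3, 4} (by decide), r3 {0, 5} {1, 2, 4} (by decide),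
    r0 {1, 3} {2, 4, 5} (by decide), r4 {1, 3} {0, 2, 5} (by decide),
    r0 {1, 4} {2, 3, 5} (by decide), r3 {1, 4} {0, 2, 5} (by decide),
    r0 {1, 5} {2, 3, 4} (by decide), r3 {1, 5} {0, 2, 4} (by decide),
    r0 {2, 3} {1, 4, 5} (by decide), r1 {2, 3} {0, 4, 5} (by decide),
    r0 {2, 4} {1, 3, 5} (by decide), r1 {2, 4} {0, 3, 5} (by decide),
    r0 {2, 5} {1, 3, 4} (by decide), r1 {2, 5} {0, 3, 4} (by decide), h.triple_le {0, 1, 2},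
    h.triple_le {0, 1, 3}, h.triple_le {0, 1, 4}, h.triple_le {0, 1, 5}, h.triple_le {0, 2, 3},
    h.triple_le {0, 2, 4}, h.triple_le {0, 2, 5}, h.triple_le {0, 3, 4}, h.triple_le {0, 3, 5},
    h.triple_le {0, 4, 5}, h.triple_le {1, 2, 3}, h.triple_le {1, 2, 4}, h.triple_le {1, 2, 5},
    h.triple_le {1, 3, 4}, h.triple_le {1, 3, 5}, h.triple_le {1, 4, 5}, h.triple_le {2, 3, 4},
    h.triple_le {2, 3, 5}, h.triple_le {2, 4, 5}, h.triple_le {3, 4, 5}]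

theorem le_of_three_one (h : TriangleCounts c) (h0 : 1 ≤ c {0}) (h1 : 1 ≤ c {1}) (h2 : 1 ≤ c {2})
    (h3 : 1 ≤ c {3}) : (patterns.map c).sum ≤ 56 := by
  have r0 := h.relaxed 0 h0
  have r1 := h.relaxed 1 h1
  have r2 := h.relaxed 2 h2
  have r3 := h.relaxed 3 h3
  simp only [patterns, List.map_cons, List.map_nil, List.sum_cons, List.sum_nil]
  linarith [h.rows,
    r1 {0, 3} {2, 4, 5} (by decide), r2 {0, 3} {1, 4, 5} (by decide),
    r1 {0, 4} {2, 3, 5} (by decide), r2 {0, 4} {1, 3, 5} (by decide),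
    r1 {0, 5} {2, 3, 4} (by decide), r2 {0, 5} {1, 3, 4} (by decide),
    r0 {1, 3} {2, 4, 5} (by decide), r2 {1, 3} {0, 4, 5} (by decide),
    r0 {1, 4} {2, 3, 5} (by decide), r2 {1, 4} {0, 3, 5} (by decide),
    r0 {1, 5} {2, 3, 4} (by decide), r2 {1, 5} {0, 3, 4} (by decide),
    r0 {2, 3} {1, 4, 5} (by decide), r1 {2, 3} {0, 4, 5} (by decide),
    r0 {2, 4} {1, 3, 5} (by decide), r1 {2, 4} {0, 3, 5} (by decide),
    r0 {2, 5} {1, 3, 4} (by decide), r1 {2, 5} {0, 3, 4} (by decide), h.triple_le {0, 1, 2},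
    h.triple_le {0, 1, 3}, h.triple_le {0, 1, 4}, h.triple_le {0, 1, 5}, h.triple_le {0, 2, 3},
    h.triple_le {0, 2, 4}, h.triple_le {0, 2, 5}, h.triple_le {0, 3, 4}, h.triple_le {0, 3, 5},
    h.triple_le {0, 4, 5}, h.triple_le {1, 2, 3}, h.triple_le {1, 2, 4}, h.triple_le {1, 2, 5},
    h.triple_le {1, 3, 4}, h.triple_le {1, 3, 5}, h.triple_le {1, 4, 5}, h.triple_le {2, 3, 4},
    h.triple_le {2, 3, 5}, h.triple_le {2, 4, 5}, h.triple_le {3, 4, 5}]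

theorem le_of_two_one (h : TriangleCounts c) (h0 : 1 ≤ c {0}) (h1 : 1 ≤ c {1}) (h3 : 1 ≤ c {3})
    (h4 : c {4} = 0) (h5 : c {5} = 0) : (patterns.map c).sum ≤ 56 := by
  have r0 := h.relaxed 0 h0
  have r1 := h.relaxed 1 h1
  have r3 := h.relaxed 3 h3
  -- the pairs that join `0` to the other row, or those that join `1` to it, number at most `8`, or
  -- all six counts equal `3`
  by_cases e0 : c {0, 3} + c {0, 4} + c {0, 5} ≤ 8
  · simp only [patterns, List.map_cons, List.map_nil, List.sum_cons, List.sum_nil]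
    linarith [
      h.row01, h.row02, h.row12, h.row34, h.row35, h.row45, r0 {1, 3} {2, 4, 5} (by decide),
      r0 {1, 4} {2, 3, 5} (by decide), r0 {1, 5} {2, 3, 4} (by decide),
      r0 {2, 3} {1, 4, 5} (by decide), r0 {2, 4} {1, 3, 5} (by decide),
      r0 {2, 5} {1, 3, 4} (by decide), r0 {3, 4} {1, 2, 5} (by decide),
      r0 {3, 5} {1, 2, 4} (by decide), h.triple_le {0, 1, 2}, h.triple_le {0, 1, 3},
      h.triple_le {0, 1, 4}, h.triple_le {0, 1, 5}, h.triple_le {0, 2, 3}, h.triple_le {0, 2, 4},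
      h.triple_le {0, 2, 5}, h.triple_le {0, 3, 4}, h.triple_le {0, 3, 5}, h.triple_le {0, 4, 5},
      h.triple_le {1, 2, 3}, h.triple_le {3, 4, 5}]
  by_cases e1 : c {1, 3} + c {1, 4} + c {1, 5} ≤ 8
  · simp only [patterns, List.map_cons, List.map_nil, List.sum_cons, List.sum_nil]
    linarith [
      h.row01, h.row02, h.row12, h.row34, h.row35, h.row45, r1 {0, 3} {2, 4, 5} (by decide),
      r1 {0, 4} {2, 3, 5} (by decide), r1 {0, 5} {2, 3, 4} (by decide),
      r1 {2, 3} {0, 4, 5} (by decide), r1 {2, 4} {0, 3, 5} (by decide),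
      r1 {2, 5} {0, 3, 4} (by decide), r1 {3, 4} {0, 2, 5} (by decide),
      r1 {3, 5} {0, 2, 4} (by decide), h.triple_le {0, 1, 2}, h.triple_le {0, 1, 3},
      h.triple_le {0, 1, 4}, h.triple_le {0, 1, 5}, h.triple_le {0, 2, 3}, h.triple_le {1, 2, 3},
      h.triple_le {1, 2, 4}, h.triple_le {1, 2, 5}, h.triple_le {1, 3, 4}, h.triple_le {1, 3, 5},
      h.triple_le {1, 4, 5}, h.triple_le {3, 4, 5}]
  push Not at e0 e1
  simp only [patterns, List.map_cons, List.map_nil, List.sum_cons, List.sum_nil]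
  linarith [
    h.row01, h.row02, h.row12, h.row34, h.row35, h.row45, r0 {2, 3} {1, 4, 5} (by decide),
    r0 {2, 4} {1, 3, 5} (by decide), r0 {2, 5} {1, 3, 4} (by decide),
    r1 {0, 3} {2, 4, 5} (by decide), r1 {0, 4} {2, 3, 5} (by decide),
    r1 {0, 5} {2, 3, 4} (by decide), r3 {0, 4} {1, 2, 5} (by decide),
    r3 {0, 5} {1, 2, 4} (by decide), r3 {1, 4} {0, 2, 5} (by decide),
    r3 {1, 5} {0, 2, 4} (by decide), h.triple_le {0, 1, 2}, h.triple_le {0, 1, 3},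
    h.triple_le {0, 1, 4}, h.triple_le {0, 1, 5}, h.triple_le {0, 2, 3}, h.triple_le {0, 3, 4},
    h.triple_le {0, 3, 5}, h.triple_le {0, 4, 5}, h.triple_le {1, 2, 3}, h.triple_le {3, 4, 5},
    h.pair_le {0, 3}, h.pair_le {0, 4}, h.pair_le {0, 5}, h.pair_le {1, 3}, h.pair_le {1, 4},
    h.pair_le {1, 5}]

theorem le_of_one_one (h : TriangleCounts c) (h0 : 1 ≤ c {0}) (h3 : 1 ≤ c {3})
    (h1 : c {1} = 0) (h2 : c {2} = 0) (h4 : c {4} = 0) (h5 : c {5} = 0) :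
    (patterns.map c).sum ≤ 56 := by
  have r0 := h.relaxed 0 h0
  have r3 := h.relaxed 3 h3
  by_cases e : c {0, 1} + c {0, 2} + c {0, 4} + c {0, 5} ≤ 11
  · simp only [patterns, List.map_cons, List.map_nil, List.sum_cons, List.sum_nil]
    linarith [
      h.row12, h.row45, r0 {1, 3} {2, 4, 5} (by decide), r0 {1, 4} {2, 3, 5} (by decide),
      r0 {1, 5} {2, 3, 4} (by decide), r0 {2, 3} {1, 4, 5} (by decide),
      r0 {2, 4} {1, 3, 5} (by decide), r0 {2, 5} {1, 3, 4} (by decide),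
      r0 {3, 4} {1, 2, 5} (by decide), r0 {3, 5} {1, 2, 4} (by decide), h.triple_le {0, 1, 2},
      h.triple_le {0, 1, 3}, h.triple_le {0, 1, 4}, h.triple_le {0, 1, 5}, h.triple_le {0, 2, 3},
      h.triple_le {0, 2, 4}, h.triple_le {0, 2, 5}, h.triple_le {0, 3, 4}, h.triple_le {0, 3, 5},
      h.triple_le {0, 4, 5}, h.triple_le {1, 2, 3}, h.triple_le {3, 4, 5}, h.pair_le {0, 3}]
  -- for the pairs outside `0` and `3`, both triples completing the split are counted
  have two : ∀ B T T', (#B = 2 ∧ 0 ∉ B ∧ T = univ \ insert 0 B) →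
      (#B = 2 ∧ 3 ∉ B ∧ T' = univ \ insert 3 B) → #T = 3 → #T' = 3 → c B + c T + c T' ≤ 3 := by
    intro B T T' hT hT' c3 c3'
    have := h.split B 0 T hT
    have := h.split B 3 T' hT'
    have := h.triple T c3
    have := h.triple T' c3'
    have := h.pair B hT.1
    have := h.three
    omega
  push Not at e
  have s0 := h.single_le 0
  have s3 := h.single_le 3
  simp only [patterns, List.map_cons, List.map_nil, List.sum_cons, List.sum_nil]
  linarith [
    two {1, 2} {3, 4, 5} {0, 4, 5} (by decide) (by decide) (by decide) (by decide),
    two {1, 4} {2, 3, 5} {0, 2, 5} (by decide) (by decide) (by decide) (by decide),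
    two {1, 5} {2, 3, 4} {0, 2, 4} (by decide) (by decide) (by decide) (by decide),
    two {2, 4} {1, 3, 5} {0, 1, 5} (by decide) (by decide) (by decide) (by decide),
    two {2, 5} {1, 3, 4} {0, 1, 4} (by decide) (by decide) (by decide) (by decide),
    two {4, 5} {1, 2, 3} {0, 1, 2} (by decide) (by decide) (by decide) (by decide),
    r3 {0, 1} {2, 4, 5} (by decide), r3 {0, 2} {1, 4, 5} (by decide),
    r3 {0, 4} {1, 2, 5} (by decide), r3 {0, 5} {1, 2, 4} (by decide), h.triple_le {0, 1, 3},
    h.triple_le {0, 2, 3}, h.triple_le {0, 3, 4}, h.triple_le {0, 3, 5}, h.pair_le {0, 1},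
    h.pair_le {0, 2}, h.pair_le {0, 3}, h.pair_le {0, 4}, h.pair_le {0, 5}, h.pair_le {1, 3},
    h.pair_le {2, 3}, h.pair_le {3, 4}, h.pair_le {3, 5}, h.rows]

end TriangleCounts

end

/-! ### Rigid pairs of disjoint edges -/

section

variable {V : Type*} [DecidableEq V] {F : Finset (Finset V)}

/-- Labels `0, …, 5` for the vertices of two disjoint edges, which occupy the rows `{0, 1, 2}` and
`{3, 4, 5}`, such that any two disjoint edges have at least three labelled vertices in their
union. -/
structure Rigid (F : Finset (Finset V)) (v : Fin 6 ↪ V) : Prop where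
  row₁ : ({0, 1, 2} : Finset (Fin 6)).map v ∈ F
  row₂ : ({3, 4, 5} : Finset (Fin 6)).map v ∈ F
  meet : ∀ P ∈ F, ∀ Q ∈ F, Disjoint P Q → 3 ≤ #((P ∪ Q) ∩ univ.map v)

theorem exists_sorted {E : Finset V} (hE : #E = 3) (p : V → Prop) :
    ∃ x y z, E = {x, y, z} ∧ x ≠ y ∧ x ≠ z ∧ y ≠ z ∧ (p y → p x) ∧ (p z → p y) := by
  obtain ⟨x, y, z, hxy, hxz, hyz, rfl⟩ := card_eq_three.1 hE
  by_cases hx : p x <;> by_cases hy : p y <;> by_cases hz : p z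
  · exact ⟨x, y, z, rfl, hxy, hxz, hyz, by tauto, by tauto⟩
  · exact ⟨x, y, z, rfl, hxy, hxz, hyz, by tauto, by tauto⟩
  · exact ⟨x, z, y, by grind, hxz, hxy, hyz.symm, by tauto, by tauto⟩
  · exact ⟨x, y, z, rfl, hxy, hxz, hyz, by tauto, by tauto⟩
  · exact ⟨y, z, x, by grind, hyz, hxy.symm, hxz.symm, by tauto, by tauto⟩
  · exact ⟨y, x, z, by grind, hxy.symm, hyz, hxz, by tauto, by tauto⟩
  · exact ⟨z, x, y, by grind, hxz.symm, hyz.symm, hxy, by tauto, by tauto⟩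
  · exact ⟨x, y, z, rfl, hxy, hxz, hyz, by tauto, by tauto⟩

/-- The vertices of two disjoint triples can be labelled so that within each triple the vertices
with property `p` come first. -/
theorem exists_labels {E₁ E₂ : Finset V} (h1 : #E₁ = 3) (h2 : #E₂ = 3) (hd : Disjoint E₁ E₂)
    (p : V → Prop) : ∃ v : Fin 6 ↪ V, ({0, 1, 2} : Finset (Fin 6)).map v = E₁ ∧
      ({3, 4, 5} : Finset (Fin 6)).map v = E₂ ∧ (p (v 1) → p (v 0)) ∧ (p (v 2) → p (v 1)) ∧
      (p (v 4) → p (v 3)) ∧ (p (v 5) → p (v 4)) := by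
  obtain ⟨a, b, c, rfl, hab, hac, hbc, p1, p2⟩ := exists_sorted h1 p
  obtain ⟨d, e, f, rfl, hde, hdf, hef, p3, p4⟩ := exists_sorted h2 p
  simp only [disjoint_insert_left, disjoint_singleton_left, mem_insert, mem_singleton,
    not_or] at hd
  obtain ⟨⟨h1, h2, h3⟩, ⟨h4, h5, h6⟩, h7, h8, h9⟩ := hd
  refine ⟨⟨![a, b, c, d, e, f], ?_⟩, ?_, ?_, p1, p2, p3, p4⟩
  · intro i j hij
    fin_cases i <;> fin_cases j <;> simp_all
  · simp only [map_insert, map_singleton]; rfl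
  · simp only [map_insert, map_singleton]; rfl

/-- The link of the labelled vertex `v i`, restricted to the unlabelled vertices. -/
def link (F : Finset (Finset V)) (v : Fin 6 ↪ V) (i : Fin 6) : Finset (Finset V) :=
  {A ∈ F | pat v A = {i}}.image (· \ univ.map v)

theorem eq_insert_of_pat {v : Fin 6 ↪ V} {i : Fin 6} {A : Finset V} (h : pat v A = {i}) :
    A = insert (v i) (A \ univ.map v) := by
  have := map_pat v A
  rw [h, map_singleton] at this
  rw [insert_eq, this, union_comm, sdiff_union_inter]

theorem mem_link (h3 : ∀ A ∈ F, #A = 3) {v : Fin 6 ↪ V} {i : Fin 6} {e : Finset V}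
    (he : e ∈ link F v i) : insert (v i) e ∈ F ∧ #e = 2 ∧ Disjoint e (univ.map v) := by
  obtain ⟨A, hA, rfl⟩ := mem_image.1 he
  rw [mem_filter] at hA
  have h1 := eq_insert_of_pat hA.2
  refine ⟨h1 ▸ hA.1, ?_, sdiff_disjoint⟩
  have h2 := card_sdiff_add_card_inter A (univ.map v)
  rw [← card_pat, hA.2, card_singleton, h3 A hA.1] at h2
  omega

theorem card_link (v : Fin 6 ↪ V) (i : Fin 6) : #(link F v i) = cnt F v {i} := by
  refine card_image_of_injOn fun A hA B hB hAB => ?_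
  simp only [coe_filter, Set.mem_ofPred_eq] at hA hB
  rw [eq_insert_of_pat hA.2, eq_insert_of_pat hB.2]
  rw [show A \ univ.map v = B \ univ.map v from hAB]

theorem disjoint_link_map {v : Fin 6 ↪ V} {i : Fin 6} {e : Finset V}
    (he : Disjoint e (univ.map v)) {B : Finset (Fin 6)} (hi : i ∉ B) :
    Disjoint (insert (v i) e) (B.map v) := by
  rw [disjoint_insert_left]
  refine ⟨by simpa using hi, disjoint_of_subset_right (map_subset_map.2 (subset_univ _)) he⟩

theorem one_le_card_pat (h : Resilient F) {v : Fin 6 ↪ V} (r : Rigid F v) {A : Finset V}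
    (hA : A ∈ F) : 1 ≤ #(pat v A) := by
  obtain ⟨z, hz, hz'⟩ := h.hits r.row₁ r.row₂ (by rw [disjoint_map]; decide) hA
  rw [← map_union, mem_map] at hz'
  obtain ⟨i, -, rfl⟩ := hz'
  exact card_pos.2 ⟨i, by simpa using hz⟩

namespace Rigid

/-- Disjoint link edges of two labelled vertices would give two disjoint edges with only two
labelled vertices in their union. -/
theorem link_cross (h : Resilient F) {v : Fin 6 ↪ V} (r : Rigid F v) {i j : Fin 6} (hij : i ≠ j)
    {e f : Finset V} (he : e ∈ link F v i) (hf : f ∈ link F v j) : ¬ Disjoint e f := by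
  intro hef
  obtain ⟨e1, -, e3⟩ := mem_link h.card3 he
  obtain ⟨f1, -, f3⟩ := mem_link h.card3 hf
  have hmem : ∀ {i} {e : Finset V}, Disjoint e (univ.map v) → v i ∉ e := fun {i e} h hi =>
    disjoint_left.1 h hi (by simp)
  have := r.meet _ e1 _ f1 (by
    rw [disjoint_insert_left, disjoint_insert_right, mem_insert, not_or]
    exact ⟨⟨fun hc => hij (v.injective hc), hmem f3⟩, hmem e3, hef⟩)
  have hsub : (insert (v i) e ∪ insert (v j) f) ∩ univ.map v ⊆ {v i, v j} := by
    intro z hz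
    simp only [mem_inter, mem_union, mem_insert, mem_singleton] at hz ⊢
    have h1 : z ∈ e → z ∉ univ.map v := fun h => disjoint_left.1 e3 h
    have h2 : z ∈ f → z ∉ univ.map v := fun h => disjoint_left.1 f3 h
    tauto
  have := (card_le_card hsub).trans card_le_two
  omega

variable [Fintype V]

/-- A completion lies in the union of two disjoint edges that avoid the pair, and at least three of
the six vertices of this union are labelled. -/
theorem ext_pair_le (h : Resilient F) {v : Fin 6 ↪ V} (r : Rigid F v) {B : Finset (Fin 6)}
    (hB : #B = 2) : #(ext F v B) ≤ 3 := by
  obtain ⟨i, j, hij, rfl⟩ := card_eq_two.1 hB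
  obtain ⟨P, hP, Q, hQ, hPQ, h1, h2, h3, h4⟩ := h.avoid (v i) (v j)
  refine (card_le_card (h.ext_subset hP hQ hPQ (B := {i, j}) ?_)).trans ?_
  · intro l hl
    rw [mem_insert, mem_singleton] at hl
    rcases hl with rfl | rfl <;> tauto
  · have := r.meet P hP Q hQ hPQ
    have := card_sdiff_add_card_inter (P ∪ Q) (univ.map v)
    have := card_union_of_disjoint hPQ
    have := h.card3 P hP
    have := h.card3 Q hQ
    omega

theorem cnt_pair_le (h : Resilient F) {v : Fin 6 ↪ V} (r : Rigid F v) {B : Finset (Fin 6)}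
    (hB : #B = 2) : cnt F v B ≤ 3 :=
  (cnt_le_ext h.card3 v hB).trans (r.ext_pair_le h hB)

/-- An edge among the labelled vertices forces the completions of a pair disjoint from it into
each link edge of the remaining labelled vertex. -/
theorem ext_subset_link (h : Resilient F) {v : Fin 6 ↪ V} {B T : Finset (Fin 6)} {k : Fin 6}
    (hk : k ∉ B) (hkT : k ∉ T) (hBT : Disjoint B T) (hT : T.map v ∈ F) {e : Finset V}
    (he : e ∈ link F v k) : ext F v B ⊆ e := by
  intro z hz
  by_contra hze
  obtain ⟨e1, -, e3⟩ := mem_link h.card3 he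
  rw [mem_ext] at hz
  refine h.no_three _ e1 _ hz.2 _ hT ?_ (disjoint_link_map e3 hkT) (disjoint_insert_map' hBT hz.1)
  rw [disjoint_insert_right]
  refine ⟨?_, disjoint_link_map e3 hk⟩
  rw [mem_insert, not_or]
  exact ⟨by rintro rfl; exact hz.1 (by simp), hze⟩

/-- Distinct completions of two disjoint pairs cannot both avoid a link edge of a fifth label. -/
theorem ext_eq_of_link (h : Resilient F) {v : Fin 6 ↪ V} {B B' : Finset (Fin 6)} {k : Fin 6}
    (hk : k ∉ B) (hk' : k ∉ B') (hBB : Disjoint B B') {e : Finset V} (he : e ∈ link F v k)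
    {z z' : V} (hz : z ∈ ext F v B) (hz' : z' ∈ ext F v B') (hze : z ∉ e)
    (hze' : z' ∉ e) : z = z' := by
  obtain ⟨e1, -, e3⟩ := mem_link h.card3 he
  refine h.ext_eq hBB e1 (disjoint_link_map e3 hk) (disjoint_link_map e3 hk') hz hz' ?_ ?_ <;>
    rw [mem_insert, not_or]
  · exact ⟨by rintro rfl; exact (mem_ext.1 hz).1 (by simp), hze⟩
  · exact ⟨by rintro rfl; exact (mem_ext.1 hz').1 (by simp), hze'⟩

end Rigid

/-- Two disjoint pairs `e`, `f`, such that no two different elements of `N` and `N'` both avoid `e`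
or both avoid `f`. -/
theorem card_add_card_le_of_no_sdr {e f N N' : Finset V} (he : #e = 2) (hf : #f = 2)
    (hef : Disjoint e f) (h1 : ∀ z ∈ N, ∀ z' ∈ N', z ∉ e → z' ∉ e → z = z')
    (h2 : ∀ z ∈ N, ∀ z' ∈ N', z ∉ f → z' ∉ f → z = z') (hN : #N ≤ 3) (hN' : #N' ≤ 3) :
    #N + #N' ≤ 4 := by
  -- the case in which `N` has three elements, the roles of `N` and `N'` being symmetric
  have key : ∀ N N' : Finset V, (∀ z ∈ N, ∀ z' ∈ N', z ∉ e → z' ∉ e → z = z') →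
      (∀ z ∈ N, ∀ z' ∈ N', z ∉ f → z' ∉ f → z = z') → #N = 3 → #N' ≤ 1 := by
    intro N N' h1 h2 hN
    have two : ∀ g : Finset V, (∀ z ∈ N, ∀ z' ∈ N', z ∉ g → z' ∉ g → z = z') →
        2 ≤ #(N \ g) → N' ⊆ g := by
      intro g hg hc z' hz'
      by_contra hzg
      obtain ⟨a, ha, b, hb, hab⟩ := one_lt_card.1 hc
      rw [mem_sdiff] at ha hb
      exact hab ((hg a ha.1 z' hz' ha.2 hzg).trans (hg b hb.1 z' hz' hb.2 hzg).symm)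
    have one : ∀ g : Finset V, (∀ z ∈ N, ∀ z' ∈ N', z ∉ g → z' ∉ g → z = z') →
        1 ≤ #(N \ g) → #(N' \ g) ≤ 1 := by
      intro g hg hc
      obtain ⟨a, ha⟩ := card_pos.1 hc
      rw [mem_sdiff] at ha
      refine card_le_one.2 fun b hb b' hb' => ?_
      rw [mem_sdiff] at hb hb'
      exact (hg a ha.1 b hb.1 ha.2 hb.2).symm.trans (hg a ha.1 b' hb'.1 ha.2 hb'.2)
    have ce := card_sdiff_add_card_inter N e
    have cf := card_sdiff_add_card_inter N f
    have ie : #(N ∩ e) ≤ 2 := he ▸ card_le_card inter_subset_right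
    have jf : #(N ∩ f) ≤ 2 := hf ▸ card_le_card inter_subset_right
    have hdis : Disjoint (N ∩ e) (N ∩ f) :=
      disjoint_of_subset_left inter_subset_right (disjoint_of_subset_right inter_subset_right hef)
    have hcard : #(N ∩ e) + #(N ∩ f) ≤ 3 := by
      rw [← card_union_of_disjoint hdis, ← hN]
      exact card_le_card (union_subset inter_subset_left inter_subset_left)
    have oe := one e h1 (by omega)
    have of := one f h2 (by omega)
    by_cases h : 2 ≤ #(N \ e)
    · have hs := two e h1 h
      rwa [sdiff_eq_self_of_disjoint (disjoint_of_subset_left hs hef)] at of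
    · have hs := two f h2 (by omega)
      rwa [sdiff_eq_self_of_disjoint (disjoint_of_subset_left hs hef.symm)] at oe
  have k1 := key N N' h1 h2
  have k2 := key N' N (fun z hz z' hz' a b => (h1 z' hz' z hz b a).symm)
    (fun z hz z' hz' a b => (h2 z' hz' z hz b a).symm)
  omega

variable [Fintype V]

namespace Rigid

/-- Two disjoint pairs `B`, `B'` among the labels `1, …, 5`, counted with the triples `T`, `T'` that
complete them to a division of these labels. If such a triple is an edge, the completions of its
pair lie in two disjoint link edges of `0`, so there are none. -/
theorem couple_le (h : Resilient F) {v : Fin 6 ↪ V} (r : Rigid F v) {e f : Finset V}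
    (he : e ∈ link F v 0) (hf : f ∈ link F v 0) (hef : Disjoint e f) (B B' T T' : Finset (Fin 6))
    (hB : #B = 2 ∧ 0 ∉ B ∧ T = univ \ insert 0 B)
    (hB' : #B' = 2 ∧ 0 ∉ B' ∧ T' = univ \ insert 0 B') (hd : Disjoint B B') :
    cnt F v B + cnt F v T + (cnt F v B' + cnt F v T') ≤ 4 := by
  have hempty : ∀ B T : Finset (Fin 6), #B = 2 ∧ 0 ∉ B ∧ T = univ \ insert 0 B →
      cnt F v T ≤ 1 ∧ (cnt F v T ≠ 0 → cnt F v B = 0) := by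
    rintro B T ⟨hB, h0, rfl⟩
    have h3 : #(univ \ insert 0 B) = 3 := by
      rw [card_sdiff_of_subset (subset_univ _), card_insert_of_notMem h0, hB]; rfl
    refine ⟨cnt_le_one h.card3 v h3, fun hT => ?_⟩
    have hT' := map_mem_of_cnt h.card3 h3 hT
    have hdis : Disjoint B (univ \ insert 0 B) :=
      disjoint_of_subset_left (subset_insert _ _) disjoint_sdiff
    have s1 := ext_subset_link h h0 (by simp) hdis hT' he
    have s2 := ext_subset_link h h0 (by simp) hdis hT' hf
    have : ext F v B = ∅ := by
      rw [← subset_empty, ← disjoint_iff_inter_eq_empty.1 hef]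
      exact subset_inter s1 s2
    have h1 := cnt_le_ext h.card3 v hB
    rw [this, card_empty] at h1
    omega
  obtain ⟨t1, t2⟩ := hempty B T hB
  obtain ⟨t3, t4⟩ := hempty B' T' hB'
  have b1 := r.cnt_pair_le h hB.1
  have b2 := r.cnt_pair_le h hB'.1
  have c1 := cnt_le_ext h.card3 v hB.1
  have c2 := cnt_le_ext h.card3 v hB'.1
  have := card_add_card_le_of_no_sdr (mem_link h.card3 he).2.1 (mem_link h.card3 hf).2.1 hef
    (fun z hz z' hz' a b => ext_eq_of_link h hB.2.1 hB'.2.1 hd he hz hz' a b)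
    (fun z hz z' hz' a b => ext_eq_of_link h hB.2.1 hB'.2.1 hd hf hz hz' a b)
    (r.ext_pair_le h hB.1) (r.ext_pair_le h hB'.1)
  omega

/-- Two disjoint link edges at one label: at most `24` edges contain this label, at most `10` of the
others have a single labelled vertex, by averaging over a `5`-cycle of labels, and at most `20` have
two or three, by averaging `couple_le` over the `15` couples of disjoint pairs. -/
theorem card_le_of_disjoint_links (h : Resilient F) {v : Fin 6 ↪ V} (r : Rigid F v)
    {e f : Finset V} (he : e ∈ link F v 0) (hf : f ∈ link F v 0) (hef : Disjoint e f) :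
    #F ≤ 56 := by
  have e2 := (mem_link h.card3 he).2.1
  have f2 := (mem_link h.card3 hf).2.1
  have hcyc : ∀ i ≠ 0, link F v i ⊆ (e ×ˢ f).image fun w => {w.1, w.2} := fun i hi =>
    subset_cycle (fun k hk => (mem_link h.card3 hk).2.1) hef
      (fun k hk => r.link_cross h hi.symm he hk) (fun k hk => r.link_cross h hi.symm hf hk)
  have hsum : ∀ i j, i ≠ 0 → j ≠ 0 → i ≠ j → cnt F v {i} + cnt F v {j} ≤ 4 := by
    intro i j hi hj hij
    rw [← card_link, ← card_link]
    exact card_add_card_le_four e2 f2 hef (hcyc i hi) (hcyc j hj) fun k hk k' hk' =>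
      r.link_cross h hij hk hk'
  have hrest : #{A ∈ F | v 0 ∉ A} ≤
      ((patterns.filter fun B => 0 ∉ B).map (cnt F v)).sum := by
    refine (card_le_sum_cnt v (patterns.filter fun B => 0 ∉ B) ?_).trans ?_
    · intro A hA
      rw [mem_filter] at hA
      rw [List.mem_filter]
      refine ⟨mem_patterns _ (one_le_card_pat h r hA.1) ?_, by simpa using hA.2⟩
      exact (card_pat_le v A).trans (h.card3 A hA.1).le
    · refine List.sum_le_sum fun B _ => ?_
      exact card_le_card (filter_subset_filter _ (filter_subset _ _))
  have hdeg := h.degree_le (v 0)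
  have htot := card_filter_add_card_filter_not (s := F) (fun A => v 0 ∈ A)
  have hl : (patterns.filter fun B => 0 ∉ B) = [{1}, {2}, {3}, {4}, {5},
      {1, 2}, {3, 4}, {3, 5}, {4, 5}, {1, 3}, {1, 4}, {1, 5}, {2, 3}, {2, 4}, {2, 5}, {3, 4, 5},
      {1, 2, 3}, {1, 2, 4}, {1, 2, 5}, {1, 3, 4}, {1, 3, 5}, {1, 4, 5}, {2, 3, 4}, {2, 3, 5},
      {2, 4, 5}] := by decide
  rw [hl] at hrest
  simp only [List.map_cons, List.map_nil, List.sum_cons, List.sum_nil] at hrest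
  have c := fun B B' T T' hB hB' hd => r.couple_le h he hf hef B B' T T' hB hB' hd
  have q1 := c {1, 2} {3, 4} {3, 4, 5} {1, 2, 5} (by decide) (by decide) (by decide)
  have q2 := c {1, 2} {3, 5} {3, 4, 5} {1, 2, 4} (by decide) (by decide) (by decide)
  have q3 := c {1, 2} {4, 5} {3, 4, 5} {1, 2, 3} (by decide) (by decide) (by decide)
  have q4 := c {1, 3} {2, 4} {2, 4, 5} {1, 3, 5} (by decide) (by decide) (by decide)
  have q5 := c {1, 3} {2, 5} {2, 4, 5} {1, 3, 4} (by decide) (by decide) (by decide)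
  have q6 := c {1, 3} {4, 5} {2, 4, 5} {1, 2, 3} (by decide) (by decide) (by decide)
  have q7 := c {1, 4} {2, 3} {2, 3, 5} {1, 4, 5} (by decide) (by decide) (by decide)
  have q8 := c {1, 4} {2, 5} {2, 3, 5} {1, 3, 4} (by decide) (by decide) (by decide)
  have q9 := c {1, 4} {3, 5} {2, 3, 5} {1, 2, 4} (by decide) (by decide) (by decide)
  have q10 := c {1, 5} {2, 3} {2, 3, 4} {1, 4, 5} (by decide) (by decide) (by decide)
  have q11 := c {1, 5} {2, 4} {2, 3, 4} {1, 3, 5} (by decide) (by decide) (by decide)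
  have q12 := c {1, 5} {3, 4} {2, 3, 4} {1, 2, 5} (by decide) (by decide) (by decide)
  have q13 := c {2, 3} {4, 5} {1, 4, 5} {1, 2, 3} (by decide) (by decide) (by decide)
  have q14 := c {2, 4} {3, 5} {1, 3, 5} {1, 2, 4} (by decide) (by decide) (by decide)
  have q15 := c {2, 5} {3, 4} {1, 3, 4} {1, 2, 5} (by decide) (by decide) (by decide)
  have s1 := hsum 1 2 (by decide) (by decide) (by decide)
  have s2 := hsum 2 3 (by decide) (by decide) (by decide)
  have s3 := hsum 3 4 (by decide) (by decide) (by decide)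
  have s4 := hsum 4 5 (by decide) (by decide) (by decide)
  have s5 := hsum 5 1 (by decide) (by decide) (by decide)
  linarith

/-- The case in which all link edges lie in a triangle, and no vertex of it is in all of them. -/
theorem triangleCounts (h : Resilient F) {v : Fin 6 ↪ V} (r : Rigid F v) {T : Finset V}
    (hT : #T = 3) (hsub : ∀ i, ∀ e ∈ link F v i, e ⊆ T)
    (hmiss : ∀ w ∈ T, ∃ i, ∃ e ∈ link F v i, w ∉ e) : TriangleCounts (cnt F v) where
  pair B hB := r.cnt_pair_le h hB
  triple B hB := cnt_le_one h.card3 v hB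
  row₁ := cnt_pos r.row₁
  row₂ := cnt_pos r.row₂
  split := by
    rintro B k _ ⟨hB, hk, rfl⟩
    rw [or_iff_not_imp_left]
    intro h0
    have h3 : #(univ \ insert k B) = 3 := by
      rw [card_sdiff_of_subset (subset_univ _), card_insert_of_notMem hk, hB]; rfl
    have hF := map_mem_of_cnt h.card3 h3 h0
    have hs : ∀ e ∈ link F v k, ext F v B ⊆ e := fun e he =>
      ext_subset_link h hk (by simp)
        (disjoint_of_subset_left (subset_insert _ _) disjoint_sdiff) hF he
    rw [← card_link]
    have hN := cnt_le_ext h.card3 v hB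
    rcases (link F v k).eq_empty_or_nonempty with hl | ⟨e₀, he₀⟩
    · rw [hl, card_empty]
      exact r.cnt_pair_le h hB
    have hNT := (hs e₀ he₀).trans (hsub k e₀ he₀)
    -- a link edge is determined by the vertex of the triangle that it misses
    have hle : #(link F v k) ≤ #(powersetCard 1 (T \ ext F v B)) := by
      refine card_le_card_of_injOn (fun e => T \ e) (fun e he => ?_) fun e he e' he' hee => ?_
      · rw [mem_coe, mem_powersetCard]
        refine ⟨sdiff_subset_sdiff subset_rfl (hs e he), ?_⟩
        rw [card_sdiff_of_subset (hsub k e he), hT, (mem_link h.card3 he).2.1]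
      · have := congrArg (fun s => T \ s) hee
        simpa only [Finset.sdiff_sdiff_eq_self (hsub k e he),
          Finset.sdiff_sdiff_eq_self (hsub k e' he')] using this
    rw [card_powersetCard, Nat.choose_one_right, card_sdiff_of_subset hNT, hT] at hle
    have := card_le_card hNT
    omega
  three := by
    have hall : ∀ w ∈ T, T.erase w ∈ univ.biUnion fun i => link F v i := by
      intro w hw
      obtain ⟨i, e, he, hwe⟩ := hmiss w hw
      have : e = T.erase w := by
        refine eq_of_subset_of_card_le (fun z hz => mem_erase.2 ⟨?_, hsub i e he hz⟩) ?_
        · rintro rfl; exact hwe hz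
        · rw [card_erase_of_mem hw, hT, (mem_link h.card3 he).2.1]
      rw [mem_biUnion]
      exact ⟨i, mem_univ _, this ▸ he⟩
    have h1 : #T ≤ #(univ.biUnion fun i => link F v i) :=
      card_le_card_of_injOn (fun w => T.erase w) hall fun w hw w' hw' hww => by
        by_contra hne
        have : w ∈ T.erase w' := mem_erase.2 ⟨hne, hw⟩
        rw [← show T.erase w = T.erase w' from hww] at this
        simp at this
    have h2 := h1.trans card_biUnion_le
    rw [hT] at h2
    simp only [card_link, Fin.sum_univ_six] at h2
    exact h2

end Rigid

theorem sorted_compare {a b c d e f : Prop} (h1 : b → a) (h2 : c → b) (h3 : e → d) (h4 : f → e)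
    (h : ¬ ((d → a) ∧ (e → b) ∧ (f → c))) : (a → d) ∧ (b → e) ∧ (c → f) := by
  tauto

/-- If any two disjoint edges have at least three vertices in `E₁ ∪ E₂`, there are at most `56`
edges. Two disjoint link edges at one vertex of `E₁ ∪ E₂` are excluded by
`Rigid.card_le_of_disjoint_links`. Otherwise all link edges pairwise intersect: they have a common
vertex, which together with `E₁ ∪ E₂` is met twice by every edge, or they form a triangle. -/
theorem Resilient.card_le_of_rigid (h : Resilient F) {E₁ E₂ : Finset V} (hE₁ : E₁ ∈ F)
    (hE₂ : E₂ ∈ F) (hE : Disjoint E₁ E₂)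
    (hmeet : ∀ P ∈ F, ∀ Q ∈ F, Disjoint P Q → 3 ≤ #((P ∪ Q) ∩ (E₁ ∪ E₂))) : #F ≤ 56 := by
  have huniv : ∀ v : Fin 6 ↪ V,
      univ.map v = ({0, 1, 2} : Finset (Fin 6)).map v ∪ ({3, 4, 5} : Finset (Fin 6)).map v := by
    intro v; rw [← map_union]; congr 1
  have mk : ∀ v : Fin 6 ↪ V, ∀ E₁ ∈ F, ∀ E₂ ∈ F,
      (∀ P ∈ F, ∀ Q ∈ F, Disjoint P Q → 3 ≤ #((P ∪ Q) ∩ (E₁ ∪ E₂))) →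
      ({0, 1, 2} : Finset (Fin 6)).map v = E₁ → ({3, 4, 5} : Finset (Fin 6)).map v = E₂ →
      Rigid F v := by
    rintro v _ h1 _ h2 hm rfl rfl
    exact ⟨h1, h2, by simpa only [huniv] using hm⟩
  have hmeet' : ∀ P ∈ F, ∀ Q ∈ F, Disjoint P Q → 3 ≤ #((P ∪ Q) ∩ (E₂ ∪ E₁)) := by
    rwa [union_comm E₂]
  have c1 := h.card3 _ hE₁
  have c2 := h.card3 _ hE₂
  -- a labelling without any preference
  obtain ⟨v, v1, v2, -⟩ := exists_labels c1 c2 hE fun _ => True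
  have r := mk v E₁ hE₁ E₂ hE₂ hmeet v1 v2
  by_cases hdis : ∃ i, ∃ e ∈ link F v i, ∃ f ∈ link F v i, Disjoint e f
  · obtain ⟨i, e, he, f, hf, hef⟩ := hdis
    have tr : ∀ w : Fin 6 ↪ V, univ.map w = univ.map v → w 0 = v i →
        link F w 0 = link F v i := by
      intro w hw hwi
      unfold link
      rw [hw]
      congr 1
      refine filter_congr fun A _ => ?_
      rw [← map_inj (f := w), ← map_inj (f := v) (s₁ := pat v A), map_pat, map_pat, hw,
        map_singleton, map_singleton, hwi]
    have hvi : v i ∈ E₁ ∪ E₂ := by rw [← v1, ← v2, ← huniv]; simp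
    rcases mem_union.1 hvi with hvi | hvi
    · obtain ⟨w, w1, w2, p1, p2, -⟩ := exists_labels c1 c2 hE (· = v i)
      have hw : univ.map w = univ.map v := by rw [huniv, huniv, w1, w2, v1, v2]
      have hw0 : w 0 = v i := by
        rw [← w1] at hvi
        simp only [map_insert, map_singleton, mem_insert, mem_singleton] at hvi
        rcases hvi with hv | hv | hv
        exacts [hv.symm, p1 hv.symm, p1 (p2 hv.symm)]
      rw [← tr w hw hw0] at he hf
      exact (mk w E₁ hE₁ E₂ hE₂ hmeet w1 w2).card_le_of_disjoint_links h he hf hef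
    · obtain ⟨w, w1, w2, p1, p2, -⟩ := exists_labels c2 c1 hE.symm (· = v i)
      have hw : univ.map w = univ.map v := by
        rw [huniv, huniv, w1, w2, v1, v2, union_comm]
      have hw0 : w 0 = v i := by
        rw [← w1] at hvi
        simp only [map_insert, map_singleton, mem_insert, mem_singleton] at hvi
        rcases hvi with hv | hv | hv
        exacts [hv.symm, p1 hv.symm, p1 (p2 hv.symm)]
      rw [← tr w hw hw0] at he hf
      exact (mk w E₂ hE₂ E₁ hE₁ hmeet' w1 w2).card_le_of_disjoint_links h he hf hef
  push Not at hdis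
  by_cases hstar : ∃ w, w ∉ univ.map v ∧ ∀ i, ∀ e ∈ link F v i, w ∈ e
  · -- all edges meet the seven vertices consisting of the labelled ones and `w` at least twice
    obtain ⟨w, hw, hwl⟩ := hstar
    refine h.card_le_of_seven ⟨Fin.cons w v, Fin.cons_injective_iff.2 ⟨?_, v.injective⟩⟩ ?_
    · rintro ⟨i, hi⟩; exact hw (by simp [← hi])
    intro A hA
    have h1 := one_le_card_pat h r hA
    by_cases h2 : #(pat v A) = 1
    · obtain ⟨i, hi⟩ := card_eq_one.1 h2
      have hwA : w ∈ A \ univ.map v := hwl i _ (mem_image_of_mem _ (mem_filter.2 ⟨hA, hi⟩))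
      have hiA : v i ∈ A := by rw [← mem_pat, hi]; simp
      have : ({0, i.succ} : Finset (Fin 7)) ⊆
          pat ⟨Fin.cons w v, Fin.cons_injective_iff.2 ⟨by
            rintro ⟨i, hi⟩; exact hw (by simp [← hi]), v.injective⟩⟩ A := by
        intro j hj
        rw [mem_insert, mem_singleton] at hj
        rcases hj with rfl | rfl
        · simpa using (mem_sdiff.1 hwA).1
        · simpa using hiA
      have := card_le_card this
      rwa [card_pair (Fin.succ_ne_zero i).symm] at this
    · have : (pat v A).map (Fin.succEmb 6) ⊆
          pat ⟨Fin.cons w v, Fin.cons_injective_iff.2 ⟨by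
            rintro ⟨i, hi⟩; exact hw (by simp [← hi]), v.injective⟩⟩ A := by
        intro j hj
        obtain ⟨i, hi, rfl⟩ := mem_map.1 hj
        simpa using hi
      have := card_le_card this
      rw [card_map] at this
      omega
  -- otherwise the link edges form a triangle
  have hint : ∀ e ∈ univ.biUnion fun i => link F v i, ∀ f ∈ univ.biUnion fun i => link F v i,
      ¬ Disjoint e f := by
    intro e he f hf
    rw [mem_biUnion] at he hf
    obtain ⟨i, -, he⟩ := he
    obtain ⟨j, -, hf⟩ := hf
    by_cases hij : i = j
    · subst hij; exact hdis i e he f hf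
    · exact r.link_cross h hij he hf
  have h2 : ∀ e ∈ univ.biUnion fun i => link F v i, #e = 2 := by
    intro e he
    rw [mem_biUnion] at he
    obtain ⟨i, -, he⟩ := he
    exact (mem_link h.card3 he).2.1
  have hmem : ∀ {i e}, e ∈ link F v i → e ∈ univ.biUnion fun i => link F v i := fun {i e} he =>
    mem_biUnion.2 ⟨i, mem_univ _, he⟩
  rcases (univ.biUnion fun i => link F v i).eq_empty_or_nonempty with h0 | hne
  · exfalso
    apply hstar
    obtain ⟨P, hP, Q, hQ, hPQ, p1, q1, -⟩ := h.avoid (v 0) (v 0)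
    have : ¬ P ∪ Q ⊆ univ.map v := by
      intro hc
      have hlt : P ∪ Q ⊂ univ.map v := by
        refine ⟨hc, fun hc' => ?_⟩
        have := hc' (mem_map_of_mem v (mem_univ 0))
        simp [p1, q1] at this
      have := card_lt_card hlt
      rw [card_union_of_disjoint hPQ, h.card3 P hP, h.card3 Q hQ, card_map, card_univ,
        Fintype.card_fin] at this
      omega
    obtain ⟨w, -, hw⟩ := not_subset.1 this
    refine ⟨w, hw, fun i e he => ?_⟩
    have := hmem he
    rw [h0] at this
    simp at this
  rcases star_or_triangle h2 hne hint with ⟨w, hw⟩ | ⟨T, hT, hTs, hTm⟩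
  · exfalso
    apply hstar
    obtain ⟨e, he⟩ := hne
    have hwe := hw e he
    rw [mem_biUnion] at he
    obtain ⟨i, -, he⟩ := he
    exact ⟨w, fun hc => disjoint_left.1 (mem_link h.card3 he).2.2 hwe hc,
      fun i e he => hw e (hmem he)⟩
  have tri : ∀ w : Fin 6 ↪ V, univ.map w = univ.map v → Rigid F w → TriangleCounts (cnt F w) := by
    intro w hw rw'
    have hl : ∀ i, ∀ e ∈ link F w i, e ∈ univ.biUnion fun i => link F v i := by
      intro i e he
      obtain ⟨A, hA, rfl⟩ := mem_image.1 he
      rw [mem_filter] at hA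
      have hwi : w i ∈ univ.map v := by rw [← hw]; simp
      obtain ⟨j, -, hj⟩ := mem_map.1 hwi
      refine hmem (i := j) (mem_image.2 ⟨A, mem_filter.2 ⟨hA.1, ?_⟩, by rw [hw]⟩)
      rw [← map_inj (f := v), map_pat, ← hw, ← map_pat, hA.2, map_singleton, map_singleton, hj]
    have hl' : ∀ e ∈ univ.biUnion fun i => link F v i, ∃ i, e ∈ link F w i := by
      intro e he
      obtain ⟨i, -, he⟩ := mem_biUnion.1 he
      obtain ⟨A, hA, rfl⟩ := mem_image.1 he
      rw [mem_filter] at hA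
      have hwi : v i ∈ univ.map w := by rw [hw]; simp
      obtain ⟨j, -, hj⟩ := mem_map.1 hwi
      refine ⟨j, mem_image.2 ⟨A, mem_filter.2 ⟨hA.1, ?_⟩, by rw [hw]⟩⟩
      rw [← map_inj (f := w), map_pat, hw, ← map_pat, hA.2, map_singleton, map_singleton, hj]
    refine rw'.triangleCounts h hT (fun i e he => hTs e (hl i e he)) fun z hz => ?_
    obtain ⟨e, he, hze⟩ := hTm z hz
    obtain ⟨i, hi⟩ := hl' e he
    exact ⟨i, e, hi, hze⟩
  have fin : ∀ w : Fin 6 ↪ V, Rigid F w → (patterns.map (cnt F w)).sum ≤ 56 → #F ≤ 56 := by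
    intro w hr hs
    refine (card_le_sum_cnt w patterns fun A hA => ?_).trans hs
    exact mem_patterns _ (one_le_card_pat h hr hA) ((card_pat_le w A).trans (h.card3 A hA).le)
  have hp : ∀ (w : Fin 6 ↪ V) i, univ.map w = univ.map v → cnt F w {i} =
      #{A ∈ F | A ∩ univ.map v = {w i}} := by
    intro w i hw
    unfold cnt
    congr 1
    refine filter_congr fun A _ => ?_
    rw [← map_inj (f := w), map_pat, hw, map_singleton]
  set p : V → Prop := fun x => 1 ≤ #{A ∈ F | A ∩ univ.map v = {x}} with hpdef
  have hpw : ∀ (w : Fin 6 ↪ V), univ.map w = univ.map v → ∀ i, p (w i) ↔ 1 ≤ cnt F w {i} := by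
    intro w hw i; rw [hp w i hw]
  -- label the vertices with nonempty link first, in the row with more of them
  have main : ∀ w : Fin 6 ↪ V, univ.map w = univ.map v → Rigid F w →
      (p (w 1) → p (w 0)) → (p (w 2) → p (w 1)) → (p (w 4) → p (w 3)) → (p (w 5) → p (w 4)) →
      (p (w 3) → p (w 0)) → (p (w 4) → p (w 1)) → (p (w 5) → p (w 2)) → #F ≤ 56 := by
    intro w hw hr a1 a2 a3 a4 a5 a6 a7
    have t := tri w hw hr
    have t3 := t.three
    simp only [hpw w hw] at a1 a2 a3 a4 a5 a6 a7
    refine fin w hr ?_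
    by_cases b3 : 1 ≤ cnt F w {3}
    · by_cases b4 : 1 ≤ cnt F w {4}
      · exact t.le_of_two_two (a5 b3) (a6 b4) b3 b4
      · by_cases b2 : 1 ≤ cnt F w {2}
        · exact t.le_of_three_one (a5 b3) (a2 b2) b2 b3
        · by_cases b1 : 1 ≤ cnt F w {1}
          · exact t.le_of_two_one (a5 b3) b1 b3 (by omega) (by omega)
          · exact t.le_of_one_one (a5 b3) b3 (by omega) (by omega) (by omega) (by omega)
    · exact t.le_of_one_row (by omega) (by omega) (by omega) (by omega)
  obtain ⟨w, w1, w2, a1, a2, a3, a4⟩ := exists_labels c1 c2 hE p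
  have hw : univ.map w = univ.map v := by rw [huniv, huniv, w1, w2, v1, v2]
  by_cases hcmp : (p (w 3) → p (w 0)) ∧ (p (w 4) → p (w 1)) ∧ (p (w 5) → p (w 2))
  · exact main w hw (mk w E₁ hE₁ E₂ hE₂ hmeet w1 w2) a1 a2 a3 a4 hcmp.1 hcmp.2.1 hcmp.2.2
  · have hcmp' : (p (w 0) → p (w 3)) ∧ (p (w 1) → p (w 4)) ∧ (p (w 2) → p (w 5)) :=
      sorted_compare a1 a2 a3 a4 hcmp
    let s : Fin 6 ↪ Fin 6 := ⟨![3, 4, 5, 0, 1, 2], by decide⟩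
    have s1 : ({0, 1, 2} : Finset (Fin 6)).map s = {3, 4, 5} := by decide
    have s2 : ({3, 4, 5} : Finset (Fin 6)).map s = {0, 1, 2} := by decide
    have m1 : ({0, 1, 2} : Finset (Fin 6)).map (s.trans w) = E₂ := by
      rw [← map_map, s1, w2]
    have m2 : ({3, 4, 5} : Finset (Fin 6)).map (s.trans w) = E₁ := by
      rw [← map_map, s2, w1]
    refine main (s.trans w) ?_ (mk _ E₂ hE₂ E₁ hE₁ hmeet' m1 m2) a3 a4 a1 a2 hcmp'.1
      hcmp'.2.1 hcmp'.2.2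
    rw [huniv, m1, m2, huniv v, v1, v2, union_comm]

end

/-! ### The optimisation problems for the edges meeting all edges of a triangle -/

section

/-- Constraints on the numbers `c B` of edges with pattern `B`, valid on a set of labelled vertices
that is disjoint from sufficiently many edges. Two disjoint labelled triples are not both edges
(`compl`), and a labelled triple is not an edge if a pair disjoint from it is extended to an edge
(`kill`). The parameter `m` bounds the number of edges that extend one of two disjoint
pairs, if both pairs are extended. -/
structure PatternBounds {k : ℕ} (c : Finset (Fin k) → ℕ) (m : ℕ) : Prop where
  one : ∀ T, #T = 3 → c T ≤ 1
  compl : ∀ T T', #T = 3 ∧ #T' = 3 ∧ Disjoint T T' → c T + c T' ≤ 1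
  kill : ∀ B T, #B = 2 ∧ #T = 3 ∧ Disjoint B T → c B = 0 ∨ c T = 0
  couple : ∀ B B', #B = 2 ∧ #B' = 2 ∧ Disjoint B B' → c B = 0 ∨ c B' = 0 ∨ c B + c B' ≤ m
  codegree : ∀ B, ∀ L : List (Finset (Fin k)), (#B = 2 ∧ L.Nodup ∧ ∀ T ∈ L, B ⊆ T) →
    (L.map c).sum ≤ 6

/-- The patterns of edges that meet all edges of the triangle `{1, 2, 3}`, `{0, 2, 4}`,
`{0, 1, 5}`. -/
def patternsSix : List (Finset (Fin 6)) :=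
  [{1, 2}, {0, 2}, {0, 1}, {0, 3}, {1, 4}, {2, 5},
   {0, 1, 2}, {3, 4, 5}, {1, 2, 3}, {0, 4, 5}, {0, 2, 4}, {1, 3, 5}, {0, 1, 5}, {2, 3, 4},
   {1, 2, 4}, {0, 3, 5}, {1, 2, 5}, {0, 3, 4}, {0, 2, 3}, {1, 4, 5}, {0, 2, 5}, {1, 3, 4},
   {0, 1, 3}, {2, 4, 5}, {0, 1, 4}, {2, 3, 5}]

/-- The patterns of edges that meet all edges of the triangle `{0, 1, 2}`, `{0, 1, 3}`,
`{2, 3, 4}`. -/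
def patternsFive : List (Finset (Fin 5)) :=
  [{2, 3}, {0, 2}, {0, 3}, {1, 2}, {1, 3}, {0, 4}, {1, 4},
   {0, 1, 2}, {0, 1, 3}, {2, 3, 4}, {0, 1, 4}, {1, 3, 4}, {1, 2, 4}, {0, 3, 4}, {0, 2, 4},
   {1, 2, 3}, {0, 2, 3}]

theorem mem_patternsSix : ∀ B : Finset (Fin 6), #B ≤ 3 → ¬ Disjoint B {1, 2, 3} →
    ¬ Disjoint B {0, 2, 4} → ¬ Disjoint B {0, 1, 5} → B ∈ patternsSix := by decide

theorem mem_patternsFive : ∀ B : Finset (Fin 5), #B ≤ 3 → ¬ Disjoint B {0, 1, 2} →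
    ¬ Disjoint B {0, 1, 3} → ¬ Disjoint B {2, 3, 4} → B ∈ patternsFive := by decide

namespace PatternBounds

variable {k m : ℕ}

theorem pair_le {c : Finset (Fin k) → ℕ} (h : PatternBounds c m) (B : Finset (Fin k))
    (hB : #B = 2) : c B ≤ 6 := by
  have := h.codegree B [B] ⟨hB, by simp, by simp⟩
  simpa using this

theorem couple_six {c : Finset (Fin k) → ℕ} (h : PatternBounds c 6) (B B' : Finset (Fin k))
    (hB : #B = 2 ∧ #B' = 2 ∧ Disjoint B B') : c B + c B' ≤ 6 := by
  have := h.couple B B' hB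
  have := h.pair_le B hB.1
  have := h.pair_le B' hB.2.1
  omega

/-- Three couples of disjoint pairs contribute `6` each, and the `20` triples contribute `10`. -/
theorem sum_six_le {c : Finset (Fin 6) → ℕ} (h : PatternBounds c 6) :
    (patternsSix.map c).sum ≤ 28 := by
  simp only [patternsSix, List.map_cons, List.map_nil, List.sum_cons, List.sum_nil]
  linarith [h.couple_six {1, 2} {0, 3} (by decide), h.couple_six {0, 2} {1, 4} (by decide),
    h.couple_six {0, 1} {2, 5} (by decide), h.compl {0, 1, 2} {3, 4, 5} (by decide),
    h.compl {1, 2, 3} {0, 4, 5} (by decide), h.compl {0, 2, 4} {1, 3, 5} (by decide),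
    h.compl {0, 1, 5} {2, 3, 4} (by decide), h.compl {1, 2, 4} {0, 3, 5} (by decide),
    h.compl {1, 2, 5} {0, 3, 4} (by decide), h.compl {0, 2, 3} {1, 4, 5} (by decide),
    h.compl {0, 2, 5} {1, 3, 4} (by decide), h.compl {0, 1, 3} {2, 4, 5} (by decide),
    h.compl {0, 1, 4} {2, 3, 5} (by decide)]

/-- A linear consequence of `kill`. -/
theorem six_mul_add_le {c : Finset (Fin k) → ℕ} (h : PatternBounds c m) (B T : Finset (Fin k))
    (hB : #B = 2 ∧ #T = 3 ∧ Disjoint B T) : 6 * c T + c B ≤ 6 := by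
  have := h.kill B T hB
  have := h.pair_le B hB.1
  have := h.one T hB.2.1
  omega

theorem sum_five_le {c : Finset (Fin 5) → ℕ} (h : PatternBounds c 6) :
    (patternsFive.map c).sum ≤ 28 := by
  simp only [patternsFive, List.map_cons, List.map_nil, List.sum_cons, List.sum_nil]
  have a1 := h.couple_six {0, 4} {1, 2} (by decide)
  have a2 := h.couple_six {1, 2} {0, 3} (by decide)
  have a3 := h.couple_six {0, 3} {1, 4} (by decide)
  have a4 := h.couple_six {1, 4} {2, 3} (by decide)
  have a5 := h.couple_six {2, 3} {0, 4} (by decide)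
  have a6 := h.couple_six {0, 2} {1, 3} (by decide)
  have b1 := h.six_mul_add_le {2, 3} {0, 1, 4} (by decide)
  have b2 := h.six_mul_add_le {0, 2} {1, 3, 4} (by decide)
  have b3 := h.six_mul_add_le {0, 3} {1, 2, 4} (by decide)
  have b4 := h.six_mul_add_le {1, 2} {0, 3, 4} (by decide)
  have b5 := h.six_mul_add_le {1, 3} {0, 2, 4} (by decide)
  have b6 := h.six_mul_add_le {0, 4} {1, 2, 3} (by decide)
  have b7 := h.six_mul_add_le {1, 4} {0, 2, 3} (by decide)
  have x1 := h.one {0, 1, 2} (by decide)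
  have x2 := h.one {0, 1, 3} (by decide)
  have x3 := h.one {2, 3, 4} (by decide)
  by_contra hc
  push Not at hc
  linarith

/-- The total count `G` of the patterns assigned to an edge of a triangle with six vertices: `p`
counts the pair of its corners, `q` the disjoint pair of the third corner and the other vertex of
the edge, `n₁`, `n₂` two triples that contain the first pair, and `n₁'`, `n₂'` their complements. -/
theorem group_le {p q n₁ n₁' n₂ n₂' : ℕ} (c1 : n₁ + n₁' ≤ 1) (c2 : n₂ + n₂' ≤ 1)
    (k1 : p = 0 ∨ n₁' = 0) (k2 : p = 0 ∨ n₂' = 0) (k3 : q = 0 ∨ n₁ = 0) (k4 : q = 0 ∨ n₂ = 0)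
    (hp : p + n₁ + n₂ ≤ 5) (hq : q + n₁' + n₂' ≤ 6) (hpq : p = 0 ∨ q = 0 ∨ p + q ≤ 4) :
    ∃ G, p + q + n₁ + n₁' + n₂ + n₂' = G ∧ G ≤ 6 ∧ (q = 0 → G ≤ 5) ∧
      (p = 0 ∧ G ≤ q + 2 ∨ q = 0 ∨ G ≤ 4) := by
  refine ⟨_, rfl, ?_⟩
  omega

theorem two_groups_le {p q G p' q' G' : ℕ} (h : G ≤ 6) (h' : G' ≤ 6)
    (k : p = 0 ∧ G ≤ q + 2 ∨ q = 0 ∨ G ≤ 4) (k' : p' = 0 ∧ G' ≤ q' + 2 ∨ q' = 0 ∨ G' ≤ 4)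
    (hq : q = 0 ∨ q' = 0 ∨ q + q' ≤ 4) : q = 0 ∨ q' = 0 ∨ G + G' ≤ 10 := by
  omega

theorem three_groups_le {q q' q'' G G' G'' : ℕ} (h : G ≤ 6) (h' : G' ≤ 6) (h'' : G'' ≤ 6)
    (k : q = 0 → G ≤ 5) (k' : q' = 0 → G' ≤ 5) (k'' : q'' = 0 → G'' ≤ 5)
    (s : q = 0 ∨ q' = 0 ∨ G + G' ≤ 10) (s' : q = 0 ∨ q'' = 0 ∨ G + G'' ≤ 10)
    (s'' : q' = 0 ∨ q'' = 0 ∨ G' + G'' ≤ 10) : G + G' + G'' ≤ 16 := by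
  omega

/-- The groups of the three edges of the triangle contribute at most `16` in total. The edges of the
triangle, the triple of the corners and their complements contribute at most `4`. -/
theorem sum_six_le_twenty {c : Finset (Fin 6) → ℕ} (h : PatternBounds c 4)
    (h0 : 1 ≤ c {1, 2, 3}) (h1 : 1 ≤ c {0, 2, 4}) (h2 : 1 ≤ c {0, 1, 5}) :
    (patternsSix.map c).sum ≤ 20 := by
  simp only [patternsSix, List.map_cons, List.map_nil, List.sum_cons, List.sum_nil]
  have p0 := h.codegree {1, 2} [{1, 2}, {1, 2, 3}, {1, 2, 4}, {1, 2, 5}] (by decide)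
  have p1 := h.codegree {0, 2} [{0, 2}, {0, 2, 4}, {0, 2, 3}, {0, 2, 5}] (by decide)
  have p2 := h.codegree {0, 1} [{0, 1}, {0, 1, 5}, {0, 1, 3}, {0, 1, 4}] (by decide)
  have q0 := h.codegree {0, 3} [{0, 3}, {0, 3, 5}, {0, 3, 4}] (by decide)
  have q1 := h.codegree {1, 4} [{1, 4}, {1, 4, 5}, {1, 3, 4}] (by decide)
  have q2 := h.codegree {2, 5} [{2, 5}, {2, 4, 5}, {2, 3, 5}] (by decide)
  simp only [List.map_cons, List.map_nil, List.sum_cons, List.sum_nil] at p0 p1 p2 q0 q1 q2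
  obtain ⟨G₀, e0, a0, b0, f0⟩ := group_le (h.compl {1, 2, 4} {0, 3, 5} (by decide))
    (h.compl {1, 2, 5} {0, 3, 4} (by decide)) (h.kill {1, 2} {0, 3, 5} (by decide))
    (h.kill {1, 2} {0, 3, 4} (by decide)) (h.kill {0, 3} {1, 2, 4} (by decide))
    (h.kill {0, 3} {1, 2, 5} (by decide)) (by omega) (by omega)
    (h.couple {1, 2} {0, 3} (by decide))
  obtain ⟨G₁, e1, a1, b1, f1⟩ := group_le (h.compl {0, 2, 3} {1, 4, 5} (by decide))
    (h.compl {0, 2, 5} {1, 3, 4} (by decide)) (h.kill {0, 2} {1, 4, 5} (by decide))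
    (h.kill {0, 2} {1, 3, 4} (by decide)) (h.kill {1, 4} {0, 2, 3} (by decide))
    (h.kill {1, 4} {0, 2, 5} (by decide)) (by omega) (by omega)
    (h.couple {0, 2} {1, 4} (by decide))
  obtain ⟨G₂, e2, a2, b2, f2⟩ := group_le (h.compl {0, 1, 3} {2, 4, 5} (by decide))
    (h.compl {0, 1, 4} {2, 3, 5} (by decide)) (h.kill {0, 1} {2, 4, 5} (by decide))
    (h.kill {0, 1} {2, 3, 5} (by decide)) (h.kill {2, 5} {0, 1, 3} (by decide))
    (h.kill {2, 5} {0, 1, 4} (by decide)) (by omega) (by omega)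
    (h.couple {0, 1} {2, 5} (by decide))
  have x0 := h.compl {0, 1, 2} {3, 4, 5} (by decide)
  have x1 := h.compl {1, 2, 3} {0, 4, 5} (by decide)
  have x2 := h.compl {0, 2, 4} {1, 3, 5} (by decide)
  have x3 := h.compl {0, 1, 5} {2, 3, 4} (by decide)
  have := three_groups_le a0 a1 a2 b0 b1 b2
    (two_groups_le a0 a1 f0 f1 (h.couple {0, 3} {1, 4} (by decide)))
    (two_groups_le a0 a2 f0 f2 (h.couple {0, 3} {2, 5} (by decide)))
    (two_groups_le a1 a2 f1 f2 (h.couple {1, 4} {2, 5} (by decide)))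
  linarith

/-- Counts `s`, `t` of two disjoint pairs, and `n`, `n'` of a triple containing the respective
pair and disjoint from the other one. -/
theorem couple_five {s t n n' : ℕ} (k : s = 0 ∨ n' = 0) (k' : t = 0 ∨ n = 0) (hn : n ≤ 1)
    (hn' : n' ≤ 1) (hs : s + n ≤ 5) (ht : t + n' ≤ 5) (hst : s = 0 ∨ t = 0 ∨ s + t ≤ 4) :
    s + t + n + n' ≤ 5 := by
  omega

/-- Counts `y` of a pair, `s` and `s'` of two pairs disjoint from it, `n` of the triple that is the
union of the latter, and `m`, `m'` of triples that contain the former and are disjoint from one of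
the latter. -/
theorem path_seven {y s s' n m m' : ℕ} (k : y = 0 ∨ n = 0) (k1 : s = 0 ∨ m = 0)
    (k2 : s' = 0 ∨ m' = 0) (hn : n ≤ 1) (hm : m ≤ 1) (hm' : m' ≤ 1) (hy : y + m + m' ≤ 5)
    (hs : s + n ≤ 6) (hs' : s' + n ≤ 6) (c : y = 0 ∨ s = 0 ∨ y + s ≤ 4)
    (c' : y = 0 ∨ s' = 0 ∨ y + s' ≤ 4) (hne : ¬ (y = 0 ∧ s ≠ 0 ∧ s' ≠ 0)) :
    y + s + s' + n + m + m' ≤ 7 := by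
  omega

theorem add_le_three {s t n : ℕ} (k : t = 0 ∨ n = 0) (hn : n ≤ 1) (hs : s ≠ 0)
    (hst : s = 0 ∨ t = 0 ∨ s + t ≤ 4) : t + n ≤ 3 := by
  omega

theorem le_three {s t t' : ℕ} (h : ¬ (t = 0 ∧ t' = 0)) (hs : s = 0 ∨ t = 0 ∨ s + t ≤ 4)
    (hs' : s = 0 ∨ t' = 0 ∨ s + t' ≤ 4) : s ≤ 3 := by
  omega

/-- The edges of the triangle contribute `3`, two couples of pairs with two triples at most `5`
each, and the remaining three pairs and three triples at most `7`, unless `{0, 4}` and `{1, 4}` are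
completed but `{2, 3}` is not. -/
theorem sum_five_le_twenty {c : Finset (Fin 5) → ℕ} (h : PatternBounds c 4)
    (h0 : 1 ≤ c {0, 1, 2}) (h1 : 1 ≤ c {0, 1, 3}) (h2 : 1 ≤ c {2, 3, 4}) :
    (patternsFive.map c).sum ≤ 20 := by
  simp only [patternsFive, List.map_cons, List.map_nil, List.sum_cons, List.sum_nil]
  have x0 := h.one {0, 1, 2} (by decide)
  have x1 := h.one {0, 1, 3} (by decide)
  have x2 := h.one {2, 3, 4} (by decide)
  have p1 := h.codegree {0, 2} [{0, 2}, {0, 1, 2}, {0, 2, 4}] (by decide)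
  have p2 := h.codegree {1, 3} [{1, 3}, {0, 1, 3}, {1, 3, 4}] (by decide)
  have p3 := h.codegree {0, 3} [{0, 3}, {0, 1, 3}, {0, 3, 4}] (by decide)
  have p4 := h.codegree {1, 2} [{1, 2}, {0, 1, 2}, {1, 2, 4}] (by decide)
  have p5 := h.codegree {2, 3} [{2, 3}, {2, 3, 4}, {1, 2, 3}, {0, 2, 3}] (by decide)
  have p6 := h.codegree {0, 4} [{0, 4}, {0, 1, 4}, {0, 2, 4}, {0, 3, 4}] (by decide)
  have p7 := h.codegree {1, 4} [{1, 4}, {0, 1, 4}, {1, 2, 4}, {1, 3, 4}] (by decide)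
  simp only [List.map_cons, List.map_nil, List.sum_cons, List.sum_nil] at p1 p2 p3 p4 p5 p6 p7
  have k1 := h.kill {2, 3} {0, 1, 4} (by decide)
  have k2 := h.kill {0, 2} {1, 3, 4} (by decide)
  have k3 := h.kill {0, 3} {1, 2, 4} (by decide)
  have k4 := h.kill {1, 2} {0, 3, 4} (by decide)
  have k5 := h.kill {1, 3} {0, 2, 4} (by decide)
  have k6 := h.kill {0, 4} {1, 2, 3} (by decide)
  have k7 := h.kill {1, 4} {0, 2, 3} (by decide)
  have o1 := h.one {0, 1, 4} (by decide)
  have o2 := h.one {1, 3, 4} (by decide)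
  have o3 := h.one {1, 2, 4} (by decide)
  have o4 := h.one {0, 3, 4} (by decide)
  have o5 := h.one {0, 2, 4} (by decide)
  have o6 := h.one {1, 2, 3} (by decide)
  have o7 := h.one {0, 2, 3} (by decide)
  have a1 := h.couple {0, 4} {1, 2} (by decide)
  have a5 := h.couple {2, 3} {0, 4} (by decide)
  have a6 := h.couple {0, 2} {1, 3} (by decide)
  have a7 := h.couple {0, 4} {1, 3} (by decide)
  have a8 := h.couple {1, 4} {0, 2} (by decide)
  have a9 := h.couple {1, 4} {0, 3} (by decide)
  have a10 := h.couple {2, 3} {1, 4} (by decide)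
  -- two couples contribute at most `5` each
  have C1 := couple_five k2 k5 o5 o2 (by linarith) (by linarith) a6
  have C2 := couple_five k3 k4 o4 o3 (by linarith) (by linarith)
    (h.couple {0, 3} {1, 2} (by decide))
  by_cases hs : c {2, 3} = 0 ∧ c {0, 4} ≠ 0 ∧ c {1, 4} ≠ 0
  · obtain ⟨z1, z2, z3⟩ := hs
    have y1 : c {1, 2, 3} = 0 := k6.resolve_left z2
    have y2 : c {0, 2, 3} = 0 := k7.resolve_left z3
    by_cases w1 : c {0, 2} = 0 ∧ c {0, 3} = 0
    · by_cases w2 : c {1, 2} = 0 ∧ c {1, 3} = 0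
      · linarith
      · have b1 := le_three w2 a1 a7
        have b2 := add_le_three k5 o5 z2 a7
        have b3 := add_le_three k4 o4 z2 a1
        linarith
    · by_cases w2 : c {1, 2} = 0 ∧ c {1, 3} = 0
      · have b1 := le_three w1 a8 a9
        have b2 := add_le_three k2 o2 z3 a8
        have b3 := add_le_three k3 o3 z3 a9
        linarith
      · have b1 := le_three w2 a1 a7
        have b2 := le_three w1 a8 a9
        linarith
  · have D := path_seven k1 k6 k7 o1 o6 o7 (by linarith) (by linarith) (by linarith) a5 a10 hs
    linarith

end PatternBounds

end

/-! ### Counting the edges that meet all edges of a triangle -/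

section

variable {V : Type*} [DecidableEq V]

/-- If any two different vertices of `N` and `N'` together meet all members of `𝒲`, then two
vertices in a common part of size at most `2` missed by a member of `𝒲` cannot be used in both
`N` and `N'`. -/
theorem card_add_card_le_of_cover {𝒲 : Finset (Finset V)} {N N' : Finset V}
    (parts : List (Finset V)) (hlen : 1 ≤ parts.length)
    (hparts : ∀ I ∈ parts, #I ≤ 2 ∧ ∃ W ∈ 𝒲, Disjoint I W)
    (hcover : ∀ W ∈ 𝒲, ∀ z ∈ W, z ∈ N ∪ N' → ∃ I ∈ parts, z ∈ I)
    (hmiss : ∀ z ∈ N ∪ N', ∃ W ∈ 𝒲, z ∉ W) (hN : N.Nonempty) (hN' : N'.Nonempty)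
    (h : ∀ z ∈ N, ∀ z' ∈ N', z ≠ z' → ∀ W ∈ 𝒲, z ∈ W ∨ z' ∈ W) :
    #N + #N' ≤ 2 * parts.length := by
  -- a vertex outside all parts is the only vertex of both sets
  have key : ∀ M M' : Finset V, M ∪ M' = N ∪ N' → M'.Nonempty →
      (∀ z ∈ M, ∀ z' ∈ M', z ≠ z' → ∀ W ∈ 𝒲, z ∈ W ∨ z' ∈ W) →
      (∃ z ∈ M, ∀ I ∈ parts, z ∉ I) → #M + #M' ≤ 2 := by
    rintro M M' hM ⟨w, hw⟩ hR ⟨z, hz, hzI⟩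
    have hzW : ∀ W ∈ 𝒲, z ∉ W := fun W hW hzW => by
      obtain ⟨I, hI, hzI'⟩ := hcover W hW z hzW (hM ▸ mem_union_left _ hz)
      exact hzI I hI hzI'
    have h' : ∀ z' ∈ M', z' = z := fun z' hz' => by
      by_contra hne
      obtain ⟨W, hW, hzW'⟩ := hmiss z' (hM ▸ mem_union_right _ hz')
      exact (hR z hz z' hz' (Ne.symm hne) W hW).elim (hzW W hW) hzW'
    have h'' : ∀ y ∈ M, y = z := fun y hy => by
      by_contra hne
      obtain ⟨W, hW, hyW⟩ := hmiss y (hM ▸ mem_union_left _ hy)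
      exact (hR y hy z (h' w hw ▸ hw) hne W hW).elim hyW (hzW W hW)
    have := card_le_one_of_forall_eq (fun z hz w hw => (h' z hz).trans (h' w hw).symm) ⟨w, hw⟩
    have := card_le_one_of_forall_eq (fun y hy w hw => (h'' y hy).trans (h'' w hw).symm)
      ⟨z, hz⟩
    omega
  by_cases h1 : ∃ z ∈ N, ∀ I ∈ parts, z ∉ I
  · have := key N N' rfl hN' h h1
    omega
  by_cases h2 : ∃ z ∈ N', ∀ I ∈ parts, z ∉ I
  · have := key N' N (union_comm _ _) hN
      (fun z hz z' hz' hne W hW => (h z' hz' z hz hne.symm W hW).symm) h2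
    omega
  push Not at h1 h2
  have hsum : ∀ (L : List (Finset V)), (∀ I ∈ L, #I ≤ 2 ∧ ∃ W ∈ 𝒲, Disjoint I W) →
      ∀ M M' : Finset V, M ⊆ N → M' ⊆ N' → (∀ z ∈ M, ∃ I ∈ L, z ∈ I) →
      (∀ z ∈ M', ∃ I ∈ L, z ∈ I) → #M + #M' ≤ 2 * L.length := by
    intro L
    induction L with
    | nil =>
      intro _ M M' _ _ hM hM'
      have h1 : M = ∅ := eq_empty_of_forall_notMem fun z hz => by simpa using hM z hz
      have h2 : M' = ∅ := eq_empty_of_forall_notMem fun z hz => by simpa using hM' z hz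
      simp [h1, h2]
    | cons I L ih =>
      intro hL M M' hMN hMN' hM hM'
      have h1 := ih (fun J hJ => hL J (List.mem_cons_of_mem _ hJ)) (M \ I) (M' \ I)
        (sdiff_subset.trans hMN) (sdiff_subset.trans hMN')
        (fun z hz => by
          rw [mem_sdiff] at hz
          obtain ⟨J, hJ, hzJ⟩ := hM z hz.1
          rcases List.mem_cons.1 hJ with rfl | hJ
          exacts [absurd hzJ hz.2, ⟨J, hJ, hzJ⟩])
        (fun z hz => by
          rw [mem_sdiff] at hz
          obtain ⟨J, hJ, hzJ⟩ := hM' z hz.1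
          rcases List.mem_cons.1 hJ with rfl | hJ
          exacts [absurd hzJ hz.2, ⟨J, hJ, hzJ⟩])
      obtain ⟨hI, W, hW, hIW⟩ := hL I List.mem_cons_self
      rw [disjoint_left] at hIW
      have heq : ∀ z ∈ M ∩ I, ∀ z' ∈ M' ∩ I, z = z' := fun z hz z' hz' => by
        rw [mem_inter] at hz hz'
        by_contra hne
        exact (h z (hMN hz.1) z' (hMN' hz'.1) hne W hW).elim (hIW hz.2) (hIW hz'.2)
      have h2 : #(M ∩ I) + #(M' ∩ I) ≤ 2 := by
        have a1 : #(M ∩ I) ≤ #I := card_le_card inter_subset_right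
        have a2 : #(M' ∩ I) ≤ #I := card_le_card inter_subset_right
        rcases (M ∩ I).eq_empty_or_nonempty with he | ⟨y, hy⟩
        · rw [he, card_empty]; omega
        rcases (M' ∩ I).eq_empty_or_nonempty with he | ⟨y', hy'⟩
        · rw [he, card_empty]; omega
        have := card_le_one_of_forall_eq heq ⟨y', hy'⟩
        have := card_le_one_of_forall_eq (fun z hz w hw => (heq w hw z hz).symm) ⟨y, hy⟩
        omega
      have h3 := card_inter_add_card_sdiff M I
      have h4 := card_inter_add_card_sdiff M' I
      rw [List.length_cons]
      omega
  exact hsum parts hparts N N' subset_rfl subset_rfl h1 h2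

theorem not_disjoint_pat {k : ℕ} {v : Fin k ↪ V} {A : Finset V} {B : Finset (Fin k)}
    (h : ¬ Disjoint A (B.map v)) : ¬ Disjoint (pat v A) B := by
  rw [not_disjoint_iff] at *
  obtain ⟨z, hz, hz'⟩ := h
  obtain ⟨i, hi, rfl⟩ := mem_map.1 hz'
  exact ⟨i, mem_pat.2 hz, hi⟩

/-- The constraints on patterns for a subfamily `F'` and labelled vertices that are disjoint from
edges `𝒲`. As there are no three pairwise disjoint edges, two disjoint members of `F'` together meet
every member of `𝒲`, which is only possible in unlabelled vertices. -/
theorem Resilient.patternBounds [Fintype V] {F F' : Finset (Finset V)} (h : Resilient F)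
    (hF : F' ⊆ F) {k m : ℕ} (v : Fin k ↪ V) {𝒲 : Finset (Finset V)} (hne : 𝒲.Nonempty)
    (h𝒲 : ∀ W ∈ 𝒲, W ∈ F ∧ Disjoint (univ.map v) W)
    (hmiss : ∀ A ∈ F', ∀ z ∈ A, ∃ W ∈ 𝒲, z ∉ W)
    (hcov : ∀ N N' : Finset V, N.Nonempty → N'.Nonempty →
      (∀ z ∈ N ∪ N', ∃ A ∈ F', z ∈ A) →
      (∀ z ∈ N, ∀ z' ∈ N', z ≠ z' → ∀ W ∈ 𝒲, z ∈ W ∨ z' ∈ W) → #N + #N' ≤ m) :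
    PatternBounds (cnt F' v) m := by
  have h3 : ∀ A ∈ F', #A = 3 := fun A hA => h.card3 A (hF hA)
  have hvW : ∀ W ∈ 𝒲, ∀ B : Finset (Fin k), Disjoint (B.map v) W := fun W hW B =>
    disjoint_of_subset_left (map_subset_map.2 (subset_univ B)) (h𝒲 W hW).2
  refine ⟨fun T hT => cnt_le_one h3 v hT, ?_, ?_, ?_, ?_⟩
  · rintro T T' ⟨hT, hT', hd⟩
    by_contra! hc
    have := cnt_le_one h3 v hT
    have := cnt_le_one h3 v hT'
    obtain ⟨W, hW⟩ := hne
    exact h.no_three _ (hF (map_mem_of_cnt h3 hT (by omega))) _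
      (hF (map_mem_of_cnt h3 hT' (by omega))) W (h𝒲 W hW).1 ((disjoint_map v).2 hd)
      (hvW W hW T) (hvW W hW T')
  · rintro B T ⟨hB, hT, hd⟩
    by_contra! hc
    obtain ⟨z, hz⟩ := card_pos.1 (lt_of_lt_of_le (Nat.pos_of_ne_zero hc.1) (cnt_le_ext h3 v hB))
    rw [mem_ext] at hz
    obtain ⟨W, hW, hzW⟩ := hmiss _ hz.2 z (mem_insert_self _ _)
    exact h.no_three _ (hF hz.2) _ (hF (map_mem_of_cnt h3 hT hc.2)) W (h𝒲 W hW).1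
      (disjoint_insert_map' hd hz.1) (disjoint_insert_left.2 ⟨hzW, hvW W hW B⟩) (hvW W hW T)
  · rintro B B' ⟨hB, hB', hd⟩
    by_contra! hc
    have h1 := cnt_le_ext h3 v hB
    have h2 := cnt_le_ext h3 v hB'
    have := hcov (ext F' v B) (ext F' v B') (card_pos.1 (by omega)) (card_pos.1 (by omega)) (by
        intro z hz
        rw [mem_union, mem_ext, mem_ext] at hz
        exact hz.elim (fun hz => ⟨_, hz.2, mem_insert_self _ _⟩)
          (fun hz => ⟨_, hz.2, mem_insert_self _ _⟩)) (by
        intro z hz z' hz' hne W hW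
        rw [mem_ext] at hz hz'
        by_contra! hc
        exact h.no_three _ (hF hz.2) _ (hF hz'.2) W (h𝒲 W hW).1
          (disjoint_insert_map hd hz.1 hz'.1 hne) (disjoint_insert_left.2 ⟨hc.1, hvW W hW B⟩)
          (disjoint_insert_left.2 ⟨hc.2, hvW W hW B'⟩))
    omega
  · rintro B L ⟨hB, hL, hBL⟩
    obtain ⟨i, j, hij, rfl⟩ := card_eq_two.1 hB
    refine (sum_cnt_le_card v L hL).trans (le_trans (card_le_card ?_)
      (h.codegree_le (fun hc => hij (v.injective hc) : v i ≠ v j)))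
    intro A hA
    rw [mem_filter] at hA ⊢
    have := hBL _ hA.2
    exact ⟨hF hA.1, mem_pat.1 (this (by simp)), mem_pat.1 (this (by simp))⟩

/-- A triangle: three triples, any two of which meet, without a common vertex. Up to the labelling
these are the triples `{1, 2, 3}`, `{0, 2, 4}`, `{0, 1, 5}` or `{0, 1, 2}`, `{0, 1, 3}`,
`{2, 3, 4}`. -/
def IsTriangle (𝒳 : Finset (Finset V)) : Prop :=
  (∃ u : Fin 6 ↪ V, 𝒳 = {({1, 2, 3} : Finset (Fin 6)).map u, ({0, 2, 4} : Finset (Fin 6)).map u,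
    ({0, 1, 5} : Finset (Fin 6)).map u}) ∨
  ∃ u : Fin 5 ↪ V, 𝒳 = {({0, 1, 2} : Finset (Fin 5)).map u, ({0, 1, 3} : Finset (Fin 5)).map u,
    ({2, 3, 4} : Finset (Fin 5)).map u}

theorem IsTriangle.nonempty {𝒳 : Finset (Finset V)} (h : IsTriangle 𝒳) : 𝒳.Nonempty := by
  rcases h with ⟨u, rfl⟩ | ⟨u, rfl⟩ <;> exact insert_nonempty _ _

theorem IsTriangle.exists_notMem {𝒳 : Finset (Finset V)} (h : IsTriangle 𝒳) (z : V) :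
    ∃ X ∈ 𝒳, z ∉ X := by
  by_contra! hc
  rcases h with ⟨u, rfl⟩ | ⟨u, rfl⟩
  · simp only [mem_insert, mem_singleton, forall_eq_or_imp, forall_eq] at hc
    obtain ⟨i, hi, rfl⟩ := mem_map.1 hc.1
    simp only [mem_map'] at hc
    revert i; decide
  · simp only [mem_insert, mem_singleton, forall_eq_or_imp, forall_eq] at hc
    obtain ⟨i, hi, rfl⟩ := mem_map.1 hc.1
    simp only [mem_map'] at hc
    revert i; decide

/-- The vertices of a triangle split into three parts of size at most `2`, each missed by an
edge of the triangle. -/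
theorem IsTriangle.card_add_card_le {𝒳 : Finset (Finset V)} (h : IsTriangle 𝒳) {N N' : Finset V}
    (hN : N.Nonempty) (hN' : N'.Nonempty)
    (hR : ∀ z ∈ N, ∀ z' ∈ N', z ≠ z' → ∀ X ∈ 𝒳, z ∈ X ∨ z' ∈ X) : #N + #N' ≤ 6 := by
  have hmiss : ∀ z ∈ N ∪ N', ∃ X ∈ 𝒳, z ∉ X := fun z _ => h.exists_notMem z
  rcases h with ⟨u, rfl⟩ | ⟨u, rfl⟩
  · refine card_add_card_le_of_cover [({0, 4} : Finset (Fin 6)).map u,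
      ({1, 5} : Finset (Fin 6)).map u, ({2, 3} : Finset (Fin 6)).map u] (by simp)
      ?_ ?_ hmiss hN hN' hR
    · simp only [List.forall_mem_cons, List.not_mem_nil, false_imp_iff, implies_true, and_true,
        card_map, mem_insert, mem_singleton, exists_eq_or_imp, exists_eq_left, disjoint_map]
      decide
    · simp only [mem_insert, mem_singleton, forall_eq_or_imp, forall_eq, mem_map,
        List.mem_cons, List.not_mem_nil, or_false, exists_eq_or_imp, exists_eq_left]
      refine ⟨?_, ?_, ?_⟩ <;> rintro z (rfl | rfl | rfl) - <;> simp
  · refine card_add_card_le_of_cover [({0, 1} : Finset (Fin 5)).map u,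
      ({2, 4} : Finset (Fin 5)).map u, ({3} : Finset (Fin 5)).map u] (by simp)
      ?_ ?_ hmiss hN hN' hR
    · simp only [List.forall_mem_cons, List.not_mem_nil, false_imp_iff, implies_true, and_true,
        card_map, mem_insert, mem_singleton, exists_eq_or_imp, exists_eq_left, disjoint_map]
      decide
    · simp only [mem_insert, mem_singleton, forall_eq_or_imp, forall_eq, mem_map,
        List.mem_cons, List.not_mem_nil, or_false, exists_eq_or_imp, exists_eq_left]
      refine ⟨?_, ?_, ?_⟩ <;> rintro z (rfl | rfl | rfl) - <;> simp

theorem disjoint_univ_map_six {u : Fin 6 ↪ V} {W : Finset V}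
    (h0 : Disjoint (({1, 2, 3} : Finset (Fin 6)).map u) W)
    (h1 : Disjoint (({0, 2, 4} : Finset (Fin 6)).map u) W)
    (h2 : Disjoint (({0, 1, 5} : Finset (Fin 6)).map u) W) : Disjoint (univ.map u) W := by
  have : (univ : Finset (Fin 6)) = {1, 2, 3} ∪ ({0, 2, 4} ∪ {0, 1, 5}) := by decide
  rw [this, map_union, map_union, disjoint_union_left, disjoint_union_left]
  exact ⟨h0, h1, h2⟩

theorem disjoint_univ_map_five {u : Fin 5 ↪ V} {W : Finset V}
    (h0 : Disjoint (({0, 1, 2} : Finset (Fin 5)).map u) W)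
    (h1 : Disjoint (({0, 1, 3} : Finset (Fin 5)).map u) W)
    (h2 : Disjoint (({2, 3, 4} : Finset (Fin 5)).map u) W) : Disjoint (univ.map u) W := by
  have : (univ : Finset (Fin 5)) = {0, 1, 2} ∪ ({0, 1, 3} ∪ {2, 3, 4}) := by decide
  rw [this, map_union, map_union, disjoint_union_left, disjoint_union_left]
  exact ⟨h0, h1, h2⟩

/-- Given two triangles on disjoint vertex sets, at most `28` edges meet all edges of the first
one. -/
theorem Resilient.card_le_of_triangles [Fintype V] {F : Finset (Finset V)} (h : Resilient F)
    {𝒳 𝒴 : Finset (Finset V)} (h𝒳 : IsTriangle 𝒳) (h𝒴 : IsTriangle 𝒴) (hF : 𝒴 ⊆ F)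
    (hXY : ∀ X ∈ 𝒳, ∀ Y ∈ 𝒴, Disjoint X Y) :
    #{A ∈ F | ∀ X ∈ 𝒳, ¬ Disjoint A X} ≤ 28 := by
  have hb : ∀ {k : ℕ} (u : Fin k ↪ V), (∀ Y ∈ 𝒴, Disjoint (univ.map u) Y) →
      PatternBounds (cnt {A ∈ F | ∀ X ∈ 𝒳, ¬ Disjoint A X} u) 6 := fun u hu =>
    h.patternBounds (filter_subset _ _) u h𝒴.nonempty (fun Y hY => ⟨hF hY, hu Y hY⟩)
      (fun A _ z _ => h𝒴.exists_notMem z) (fun N N' hN hN' _ hR => h𝒴.card_add_card_le hN hN' hR)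
  rcases h𝒳 with ⟨u, rfl⟩ | ⟨u, rfl⟩
  · simp only [mem_insert, mem_singleton, forall_eq_or_imp, forall_eq] at hXY hb ⊢
    refine (card_le_sum_cnt u patternsSix fun A hA => ?_).trans
      (hb u fun Y hY => disjoint_univ_map_six (hXY.1 Y hY) (hXY.2.1 Y hY)
        (hXY.2.2 Y hY)).sum_six_le
    rw [mem_filter] at hA
    exact mem_patternsSix _ ((card_pat_le u A).trans (h.card3 A hA.1).le)
      (not_disjoint_pat hA.2.1) (not_disjoint_pat hA.2.2.1) (not_disjoint_pat hA.2.2.2)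
  · simp only [mem_insert, mem_singleton, forall_eq_or_imp, forall_eq] at hXY hb ⊢
    refine (card_le_sum_cnt u patternsFive fun A hA => ?_).trans
      (hb u fun Y hY => disjoint_univ_map_five (hXY.1 Y hY) (hXY.2.1 Y hY)
        (hXY.2.2 Y hY)).sum_five_le
    rw [mem_filter] at hA
    exact mem_patternsFive _ ((card_pat_le u A).trans (h.card3 A hA.1).le)
      (not_disjoint_pat hA.2.1) (not_disjoint_pat hA.2.2.1) (not_disjoint_pat hA.2.2.2)

/-- Given a triangle and two edges `W₁`, `W₂` that meet in a single vertex `o` and are disjoint from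
the triangle, at most `20` edges without `o` meet all edges of the triangle. -/
theorem Resilient.card_le_of_triangle [Fintype V] {F : Finset (Finset V)} (h : Resilient F)
    {𝒳 : Finset (Finset V)} (h𝒳 : IsTriangle 𝒳) (hF : 𝒳 ⊆ F) {W₁ W₂ : Finset V} {o : V}
    (h₁ : W₁ ∈ F) (h₂ : W₂ ∈ F) (ho : W₁ ∩ W₂ = {o}) (hXW₁ : ∀ X ∈ 𝒳, Disjoint X W₁)
    (hXW₂ : ∀ X ∈ 𝒳, Disjoint X W₂) :
    #{A ∈ F | o ∉ A ∧ ∀ X ∈ 𝒳, ¬ Disjoint A X} ≤ 20 := by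
  have hmem : ∀ z, z ∈ W₁ ∧ z ∈ W₂ ↔ z = o := fun z => by rw [← mem_inter, ho, mem_singleton]
  have hoW := (hmem o).2 rfl
  have hb : ∀ {k : ℕ} (u : Fin k ↪ V), Disjoint (univ.map u) W₁ → Disjoint (univ.map u) W₂ →
      PatternBounds (cnt {A ∈ F | o ∉ A ∧ ∀ X ∈ 𝒳, ¬ Disjoint A X} u) 4 := by
    intro k u hu₁ hu₂
    have hno : ∀ z, z ≠ o → ∃ W ∈ ({W₁, W₂} : Finset (Finset V)), z ∉ W := fun z hz => by
      by_contra! hc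
      exact hz ((hmem z).1 ⟨hc W₁ (by simp), hc W₂ (by simp)⟩)
    refine h.patternBounds (filter_subset _ _) u (𝒲 := {W₁, W₂}) (insert_nonempty _ _)
      (by simp [h₁, h₂, hu₁, hu₂]) ?_ ?_
    · intro A hA z hz
      rw [mem_filter] at hA
      exact hno z (by rintro rfl; exact hA.2.1 hz)
    · intro N N' hN hN' hNo hR
      have hNo : ∀ z ∈ N ∪ N', z ≠ o := by
        rintro z hz rfl
        obtain ⟨A, hA, hzA⟩ := hNo z hz
        exact (mem_filter.1 hA).2.1 hzA
      refine card_add_card_le_of_cover [W₁.erase o, W₂.erase o] (by simp) ?_ ?_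
        (fun z hz => hno z (hNo z hz)) hN hN' hR
      · simp only [List.forall_mem_cons, List.not_mem_nil, false_imp_iff, implies_true, and_true,
          card_erase_of_mem hoW.1, card_erase_of_mem hoW.2, h.card3 _ h₁, h.card3 _ h₂]
        refine ⟨⟨le_rfl, W₂, by simp, ?_⟩, le_rfl, W₁, by simp, ?_⟩ <;> rw [disjoint_left] <;>
          intro z hz hz' <;> rw [mem_erase] at hz
        exacts [hz.1 ((hmem z).1 ⟨hz.2, hz'⟩), hz.1 ((hmem z).1 ⟨hz', hz.2⟩)]
      · intro W hW z hz hz'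
        rw [mem_insert, mem_singleton] at hW
        rcases hW with rfl | rfl
        exacts [⟨_, by simp, mem_erase.2 ⟨hNo z hz', hz⟩⟩, ⟨W.erase o, by simp,
          mem_erase.2 ⟨hNo z hz', hz⟩⟩]
  have hoX : ∀ X ∈ 𝒳, o ∉ X := fun X hX hc => disjoint_left.1 (hXW₁ X hX) hc hoW.1
  have hmeet : IsTriangle 𝒳 → ∀ X ∈ 𝒳, X ∈ {A ∈ F | o ∉ A ∧ ∀ X ∈ 𝒳, ¬ Disjoint A X} := by
    intro h𝒳 X hX
    refine mem_filter.2 ⟨hF hX, hoX X hX, ?_⟩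
    revert X
    rcases h𝒳 with ⟨u, rfl⟩ | ⟨u, rfl⟩ <;>
      simp only [mem_insert, mem_singleton, forall_eq_or_imp, forall_eq, disjoint_map] <;> decide
  have hmeet := hmeet h𝒳
  rcases h𝒳 with ⟨u, rfl⟩ | ⟨u, rfl⟩
  · simp only [mem_insert, mem_singleton, forall_eq_or_imp, forall_eq] at hXW₁ hXW₂ hb hmeet ⊢
    refine (card_le_sum_cnt u patternsSix fun A hA => ?_).trans
      ((hb u (disjoint_univ_map_six hXW₁.1 hXW₁.2.1 hXW₁.2.2)
        (disjoint_univ_map_six hXW₂.1 hXW₂.2.1 hXW₂.2.2)).sum_six_le_twenty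
        (cnt_pos hmeet.1) (cnt_pos hmeet.2.1) (cnt_pos hmeet.2.2))
    rw [mem_filter] at hA
    exact mem_patternsSix _ ((card_pat_le u A).trans (h.card3 A hA.1).le)
      (not_disjoint_pat hA.2.2.1) (not_disjoint_pat hA.2.2.2.1) (not_disjoint_pat hA.2.2.2.2)
  · simp only [mem_insert, mem_singleton, forall_eq_or_imp, forall_eq] at hXW₁ hXW₂ hb hmeet ⊢
    refine (card_le_sum_cnt u patternsFive fun A hA => ?_).trans
      ((hb u (disjoint_univ_map_five hXW₁.1 hXW₁.2.1 hXW₁.2.2)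
        (disjoint_univ_map_five hXW₂.1 hXW₂.2.1 hXW₂.2.2)).sum_five_le_twenty
        (cnt_pos hmeet.1) (cnt_pos hmeet.2.1) (cnt_pos hmeet.2.2))
    rw [mem_filter] at hA
    exact mem_patternsFive _ ((card_pat_le u A).trans (h.card3 A hA.1).le)
      (not_disjoint_pat hA.2.2.1) (not_disjoint_pat hA.2.2.2.1) (not_disjoint_pat hA.2.2.2.2)

end

/-! ### Two pairs of edges that meet in single vertices -/

section

variable {V : Type*} [DecidableEq V]

theorem exists_third {E : Finset V} (hE : #E = 3) {o a : V} (ho : o ∈ E) (ha : a ∈ E)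
    (hoa : o ≠ a) : ∃ b, o ≠ b ∧ a ≠ b ∧ E = {o, a, b} := by
  obtain ⟨b, hb⟩ := card_eq_one.1 (show #((E.erase o).erase a) = 1 by
    rw [card_erase_of_mem (mem_erase.2 ⟨hoa.symm, ha⟩), card_erase_of_mem ho, hE])
  have hb' : b ∈ (E.erase o).erase a := by rw [hb]; exact mem_singleton_self b
  simp only [mem_erase] at hb'
  refine ⟨b, hb'.2.1.symm, hb'.1.symm, ?_⟩
  rw [← hb, insert_erase (mem_erase.2 ⟨hoa.symm, ha⟩), insert_erase ho]

/-- Labels for two triples that meet in a single vertex. -/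
theorem exists_labels_of_inter {E D : Finset V} {o : V} (hE : #E = 3) (hD : #D = 3)
    (ho : E ∩ D = {o}) : ∃ w : Fin 4 ↪ V, E = insert o (({0, 1} : Finset (Fin 4)).map w) ∧
      D = insert o (({2, 3} : Finset (Fin 4)).map w) ∧ o ∉ univ.map w := by
  have hmem : ∀ z, z ∈ E ∧ z ∈ D ↔ z = o := fun z => by rw [← mem_inter, ho, mem_singleton]
  obtain ⟨hoE, hoD⟩ := (hmem o).2 rfl
  obtain ⟨a, haE, hao⟩ := exists_mem_ne (by omega : 1 < #E) o
  obtain ⟨b, hbD, hbo⟩ := exists_mem_ne (by omega : 1 < #D) o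
  obtain ⟨a', hoa', haa', rfl⟩ := exists_third hE hoE haE hao.symm
  obtain ⟨b', hob', hbb', rfl⟩ := exists_third hD hoD hbD hbo.symm
  have h1 := (hmem a).1
  have h2 := (hmem a').1
  simp only [mem_insert, mem_singleton, true_or, or_true, true_and, hao, hoa'.symm, false_or,
    imp_false, not_or] at h1 h2
  refine ⟨⟨![a, a', b, b'], ?_⟩, ?_, ?_, ?_⟩
  · intro i j hij
    fin_cases i <;> fin_cases j <;> simp_all
  · simp only [map_insert, map_singleton]; rfl
  · simp only [map_insert, map_singleton]; rfl
  · simp only [mem_map, mem_univ, true_and, not_exists]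
    intro i
    fin_cases i
    exacts [hao, hoa'.symm, hbo, hob'.symm]

/-- The triangle has five vertices if `P` has its third vertex in common with `E` or `D`, and six
otherwise. -/
theorem isTriangle_of_inter {E D P : Finset V} {o : V} (hE : #E = 3) (hD : #D = 3) (hP : #P = 3)
    (ho : E ∩ D = {o}) (hoP : o ∉ P) (hPE : ¬ Disjoint P E) (hPD : ¬ Disjoint P D) :
    IsTriangle {E, D, P} := by
  have hmem : ∀ z, z ∈ E ∧ z ∈ D ↔ z = o := fun z => by rw [← mem_inter, ho, mem_singleton]
  obtain ⟨a, haP, haE⟩ := not_disjoint_iff.1 hPE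
  obtain ⟨b, hbP, hbD⟩ := not_disjoint_iff.1 hPD
  obtain ⟨hoE, hoD⟩ := (hmem o).2 rfl
  have hao : a ≠ o := by rintro rfl; exact hoP haP
  have hbo : b ≠ o := by rintro rfl; exact hoP hbP
  have haD : a ∉ D := fun hc => hao ((hmem a).1 ⟨haE, hc⟩)
  have hbE : b ∉ E := fun hc => hbo ((hmem b).1 ⟨hc, hbD⟩)
  have hab : a ≠ b := by rintro rfl; exact haD hbD
  obtain ⟨a', hoa', haa', rfl⟩ := exists_third hE hoE haE hao.symm
  obtain ⟨b', hob', hbb', rfl⟩ := exists_third hD hoD hbD hbo.symm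
  obtain ⟨x, hax, hbx, rfl⟩ := exists_third hP haP hbP hab
  have ha'b' : a' ≠ b' := fun hc => hoa' ((hmem a').1 ⟨by simp, by simp [hc]⟩).symm
  simp only [mem_insert, mem_singleton, not_or] at hoP haD hbE
  by_cases hxa : x = a'
  · subst hxa
    refine .inr ⟨⟨![a, x, o, b, b'], ?_⟩, ?_⟩
    · refine List.nodup_ofFn.1 ?_
      simp only [List.ofFn_succ, List.ofFn_zero, Matrix.cons_val_zero, Matrix.cons_val_succ]
      grind
    · have h0 : ({0, 1, 2} : Finset (Fin 5)) = {2, 0, 1} := by decide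
      have h1 : ({0, 1, 3} : Finset (Fin 5)) = {0, 3, 1} := by decide
      rw [h0, h1, pair_comm ({o, b, b'} : Finset V)]
      simp only [map_insert, map_singleton]
      rfl
  by_cases hxb : x = b'
  · subst hxb
    refine .inr ⟨⟨![b, x, o, a, a'], ?_⟩, ?_⟩
    · refine List.nodup_ofFn.1 ?_
      simp only [List.ofFn_succ, List.ofFn_zero, Matrix.cons_val_zero, Matrix.cons_val_succ]
      grind
    · have h0 : ({0, 1, 2} : Finset (Fin 5)) = {2, 0, 1} := by decide
      have h1 : ({0, 1, 3} : Finset (Fin 5)) = {3, 0, 1} := by decide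
      rw [h0, h1, insert_comm ({o, a, a'} : Finset V), pair_comm ({o, a, a'} : Finset V)]
      simp only [map_insert, map_singleton]
      rfl
  · refine .inl ⟨⟨![o, a, b, x, b', a'], ?_⟩, ?_⟩
    · refine List.nodup_ofFn.1 ?_
      simp only [List.ofFn_succ, List.ofFn_zero, Matrix.cons_val_zero, Matrix.cons_val_succ]
      grind
    · rw [insert_comm ({o, a, a'} : Finset V), pair_comm ({o, a, a'} : Finset V),
        insert_comm ({o, b, b'} : Finset V)]
      simp only [map_insert, map_singleton]
      rfl

/-- Two pairs of edges `E₁`, `D₁` and `E₂`, `D₂`, which meet in single vertices `o₁` and `o₂`, and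
are disjoint otherwise. -/
structure CrossedPairs (F : Finset (Finset V)) (E₁ D₁ E₂ D₂ : Finset V) (o₁ o₂ : V) : Prop where
  memE₁ : E₁ ∈ F
  memD₁ : D₁ ∈ F
  memE₂ : E₂ ∈ F
  memD₂ : D₂ ∈ F
  inter₁ : E₁ ∩ D₁ = {o₁}
  inter₂ : E₂ ∩ D₂ = {o₂}
  disjEE : Disjoint E₁ E₂
  disjED : Disjoint E₁ D₂
  disjDE : Disjoint D₁ E₂
  disjDD : Disjoint D₁ D₂

theorem CrossedPairs.symm {F : Finset (Finset V)} {E₁ D₁ E₂ D₂ : Finset V} {o₁ o₂ : V}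
    (c : CrossedPairs F E₁ D₁ E₂ D₂ o₁ o₂) : CrossedPairs F E₂ D₂ E₁ D₁ o₂ o₁ :=
  ⟨c.memE₂, c.memD₂, c.memE₁, c.memD₁, c.inter₂, c.inter₁, c.disjEE.symm, c.disjDE.symm,
    c.disjED.symm, c.disjDD.symm⟩

/-- If the union of `P` and `Q` has only two vertices in `E₁ ∪ E₂`, each of `P`, `Q` meets one of
`E₁`, `E₂` in a single vertex and misses the other one. -/
theorem Resilient.exists_crossedPairs {F : Finset (Finset V)} (h : Resilient F)
    {E₁ E₂ P Q : Finset V} (hE₁ : E₁ ∈ F) (hE₂ : E₂ ∈ F) (hE : Disjoint E₁ E₂) (hP : P ∈ F)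
    (hQ : Q ∈ F) (hPQ : Disjoint P Q) (hc : #((P ∪ Q) ∩ (E₁ ∪ E₂)) ≤ 2) :
    ∃ D₁ D₂ o₁ o₂, CrossedPairs F E₁ D₁ E₂ D₂ o₁ o₂ := by
  obtain ⟨p, hp, hpE⟩ := h.hits hE₁ hE₂ hE hP
  obtain ⟨q, hq, hqE⟩ := h.hits hE₁ hE₂ hE hQ
  have hpq : p ≠ q := by rintro rfl; exact disjoint_left.1 hPQ hp hq
  have heq : {p, q} = (P ∪ Q) ∩ (E₁ ∪ E₂) := eq_of_subset_of_card_le (by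
    intro z hz
    rw [mem_insert, mem_singleton] at hz
    rw [mem_inter, mem_union]
    rcases hz with rfl | rfl
    exacts [⟨.inl hp, hpE⟩, ⟨.inr hq, hqE⟩]) (by rw [card_pair hpq]; exact hc)
  have hP' : ∀ z ∈ P, z ∈ E₁ ∪ E₂ → z = p := fun z hz hz' => by
    have : z ∈ ({p, q} : Finset V) := heq ▸ mem_inter.2 ⟨mem_union_left _ hz, hz'⟩
    rw [mem_insert, mem_singleton] at this
    refine this.resolve_right ?_
    rintro rfl
    exact disjoint_left.1 hPQ hz hq
  have hQ' : ∀ z ∈ Q, z ∈ E₁ ∪ E₂ → z = q := fun z hz hz' => by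
    have : z ∈ ({p, q} : Finset V) := heq ▸ mem_inter.2 ⟨mem_union_right _ hz, hz'⟩
    rw [mem_insert, mem_singleton] at this
    refine this.resolve_left ?_
    rintro rfl
    exact disjoint_left.1 hPQ hp hz
  -- the roles of the edges, if the two vertices lie in different edges
  have main : ∀ E E', E ∪ E' = E₁ ∪ E₂ → Disjoint E E' → ∀ D D' o o', Disjoint D D' → o ∈ D →
      o' ∈ D' → (∀ z ∈ D, z ∈ E₁ ∪ E₂ → z = o) → (∀ z ∈ D', z ∈ E₁ ∪ E₂ → z = o') → o ∈ E →
      o' ∈ E' → E ∩ D = {o} ∧ E' ∩ D' = {o'} ∧ Disjoint E D' ∧ Disjoint D E' := by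
    intro E E' hEE hd D D' o o' hDD ho ho' hD hD' hoE hoE'
    rw [← hEE] at hD hD'
    rw [disjoint_left] at hd
    refine ⟨?_, ?_, ?_, ?_⟩
    · ext z
      rw [mem_inter, mem_singleton]
      exact ⟨fun hz => hD z hz.2 (mem_union_left _ hz.1), by rintro rfl; exact ⟨hoE, ho⟩⟩
    · ext z
      rw [mem_inter, mem_singleton]
      exact ⟨fun hz => hD' z hz.2 (mem_union_right _ hz.1), by rintro rfl; exact ⟨hoE', ho'⟩⟩
    · rw [disjoint_left]
      intro z hz hz'
      have := hD' z hz' (mem_union_left _ hz)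
      exact hd hz (this ▸ hoE')
    · rw [disjoint_left]
      intro z hz hz'
      have := hD z hz (mem_union_right _ hz')
      exact hd hoE (this ▸ hz')
  rw [mem_union] at hpE hqE
  rcases hpE with hpE | hpE <;> rcases hqE with hqE | hqE
  · obtain ⟨z, hz, hz'⟩ := h.hits hP hQ hPQ hE₂
    rw [mem_union] at hz'
    rw [disjoint_left] at hE
    rcases hz' with hz' | hz'
    · exact absurd hz (hP' z hz' (mem_union_right _ hz) ▸ hE hpE)
    · exact absurd hz (hQ' z hz' (mem_union_right _ hz) ▸ hE hqE)
  · obtain ⟨h1, h2, h3, h4⟩ := main E₁ E₂ rfl hE P Q p q hPQ hp hq hP' hQ' hpE hqE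
    exact ⟨P, Q, p, q, hE₁, hP, hE₂, hQ, h1, h2, hE, h3, h4, hPQ⟩
  · obtain ⟨h1, h2, h3, h4⟩ := main E₁ E₂ rfl hE Q P q p hPQ.symm hq hp hQ' hP' hqE hpE
    exact ⟨Q, P, q, p, hE₁, hQ, hE₂, hP, h1, h2, hE, h3, h4, hPQ.symm⟩
  · obtain ⟨z, hz, hz'⟩ := h.hits hP hQ hPQ hE₁
    rw [mem_union] at hz'
    rw [disjoint_right] at hE
    rcases hz' with hz' | hz'
    · exact absurd hz (hP' z hz' (mem_union_left _ hz) ▸ hE hpE)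
    · exact absurd hz (hQ' z hz' (mem_union_left _ hz) ▸ hE hqE)

/-- An edge meets both edges of the first pair or both edges of the
second pair. -/
theorem Resilient.meets_of_crossedPairs {F : Finset (Finset V)} (h : Resilient F)
    {E₁ D₁ E₂ D₂ : Finset V} {o₁ o₂ : V} (c : CrossedPairs F E₁ D₁ E₂ D₂ o₁ o₂) {A : Finset V}
    (hA : A ∈ F) : ¬ Disjoint A E₁ ∧ ¬ Disjoint A D₁ ∨ ¬ Disjoint A E₂ ∧ ¬ Disjoint A D₂ := by
  have h1 := fun hd hd' => h.no_three A hA E₁ c.memE₁ E₂ c.memE₂ hd hd' c.disjEE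
  have h2 := fun hd hd' => h.no_three A hA E₁ c.memE₁ D₂ c.memD₂ hd hd' c.disjED
  have h3 := fun hd hd' => h.no_three A hA D₁ c.memD₁ E₂ c.memE₂ hd hd' c.disjDE
  have h4 := fun hd hd' => h.no_three A hA D₁ c.memD₁ D₂ c.memD₂ hd hd' c.disjDD
  tauto

/-- The triples on eight vertices, in two halves of two pairs each, that meet both pairs of one
half and also the other half. -/
def mixedTriples : Finset (Finset (Fin 8)) :=
  {B | #B = 3 ∧ (¬ Disjoint B {0, 1} ∧ ¬ Disjoint B {2, 3} ∧ ¬ Disjoint B {4, 5, 6, 7} ∨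
    ¬ Disjoint B {4, 5} ∧ ¬ Disjoint B {6, 7} ∧ ¬ Disjoint B {0, 1, 2, 3})}

/-- The permutation that exchanges the two vertices of each of four pairs. -/
def pairSwap : Fin 8 ↪ Fin 8 := ⟨![1, 0, 3, 2, 5, 4, 7, 6], by decide⟩

theorem card_mixedTriples : #mixedTriples = 32 := by decide +kernel

theorem map_pairSwap : ∀ B ∈ mixedTriples, B.map pairSwap ∈ mixedTriples ∧
    Disjoint B (B.map pairSwap) ∧
    ∃ I ∈ ({{0, 1}, {2, 3}, {4, 5}, {6, 7}} : Finset (Finset (Fin 8))),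
      Disjoint B I ∧ Disjoint (B.map pairSwap) I := by decide +kernel

/-- If `σ` moves every member of `P` out of `P`, then `P` fills at most half of a `σ`-invariant
set. -/
theorem two_mul_card_le {α : Type*} [DecidableEq α] {P S : Finset α} (σ : α ↪ α) (hP : P ⊆ S)
    (hσ : ∀ x ∈ P, σ x ∈ S ∧ σ x ∉ P) : 2 * #P ≤ #S := by
  have h1 : Disjoint P (P.map σ) := by
    rw [disjoint_right]
    intro x hx
    obtain ⟨y, hy, rfl⟩ := mem_map.1 hx
    exact (hσ y hy).2
  have h2 : P ∪ P.map σ ⊆ S := by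
    refine union_subset hP fun x hx => ?_
    obtain ⟨y, hy, rfl⟩ := mem_map.1 hx
    exact (hσ y hy).1
  have := card_le_card h2
  rw [card_union_of_disjoint h1, card_map] at this
  omega

/-- The case that every edge without `o₁` and `o₂` has vertices in both halves of the configuration.
Edges without `o₁` and `o₂` are mixed triples on the other eight vertices. A mixed triple and its
image under `pairSwap` are not both edges, as one of `E₁`, `D₁`, `E₂`, `D₂` is disjoint from both.
This leaves `16` such edges, and at most `40` edges contain `o₁` or `o₂`. -/
theorem Resilient.card_le_of_mixed {F : Finset (Finset V)} (h : Resilient F)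
    {E₁ D₁ E₂ D₂ : Finset V} {o₁ o₂ : V} (c : CrossedPairs F E₁ D₁ E₂ D₂ o₁ o₂)
    (hmix : ∀ A ∈ F, o₁ ∉ A → o₂ ∉ A → ¬ Disjoint A (E₁ ∪ D₁) ∧ ¬ Disjoint A (E₂ ∪ D₂)) :
    #F ≤ 56 := by
  obtain ⟨v, hv₁, hv₂, hv₃, hv₄, ho₁, ho₂⟩ : ∃ v : Fin 8 ↪ V,
      E₁ = insert o₁ (({0, 1} : Finset (Fin 8)).map v) ∧
      D₁ = insert o₁ (({2, 3} : Finset (Fin 8)).map v) ∧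
      E₂ = insert o₂ (({4, 5} : Finset (Fin 8)).map v) ∧
      D₂ = insert o₂ (({6, 7} : Finset (Fin 8)).map v) ∧ o₁ ∉ univ.map v ∧ o₂ ∉ univ.map v := by
    obtain ⟨w, hw₁, hw₂, ho₁⟩ :=
      exists_labels_of_inter (h.card3 _ c.memE₁) (h.card3 _ c.memD₁) c.inter₁
    obtain ⟨w', hw₃, hw₄, ho₂⟩ :=
      exists_labels_of_inter (h.card3 _ c.memE₂) (h.card3 _ c.memD₂) c.inter₂
    have hw : ∀ z, z ∈ univ.map w ∨ z = o₁ ↔ z ∈ E₁ ∪ D₁ := fun z => by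
      have : (univ : Finset (Fin 4)) = {0, 1} ∪ {2, 3} := by decide
      rw [this, map_union, hw₁, hw₂]; simp only [mem_union, mem_insert]; tauto
    have hw' : ∀ z, z ∈ univ.map w' ∨ z = o₂ ↔ z ∈ E₂ ∪ D₂ := fun z => by
      have : (univ : Finset (Fin 4)) = {0, 1} ∪ {2, 3} := by decide
      rw [this, map_union, hw₃, hw₄]; simp only [mem_union, mem_insert]; tauto
    have hdisj : Disjoint (E₁ ∪ D₁) (E₂ ∪ D₂) := by
      simp [disjoint_union_left, disjoint_union_right, c.disjEE, c.disjED, c.disjDE, c.disjDD]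
    have hd : ∀ z, z ∈ E₁ ∪ D₁ → z ∉ E₂ ∪ D₂ := fun z hz => disjoint_left.1 hdisj hz
    have hne : ∀ i j, w i ≠ w' j := fun i j hij =>
      hd (w i) ((hw _).1 (.inl (mem_map_of_mem w (mem_univ i))))
        ((hw' _).1 (.inl (hij ▸ mem_map_of_mem w' (mem_univ j))))
    refine ⟨⟨Fin.append (m := 4) (n := 4) w w', ?_⟩, ?_, ?_, ?_, ?_, ?_, ?_⟩
    · rw [Fin.append_injective_iff]
      exact ⟨w.injective, w'.injective, hne⟩
    · rw [hw₁]; simp only [map_insert, map_singleton]; rfl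
    · rw [hw₂]; simp only [map_insert, map_singleton]; rfl
    · rw [hw₃]; simp only [map_insert, map_singleton]; rfl
    · rw [hw₄]; simp only [map_insert, map_singleton]; rfl
    · intro hc
      obtain ⟨i, -, hi⟩ := mem_map.1 hc
      refine Fin.addCases (motive := fun i : Fin (4 + 4) => Fin.append w w' i ≠ o₁) ?_ ?_ i hi
      · intro i hi
        rw [Fin.append_left] at hi
        exact ho₁ (hi ▸ mem_map_of_mem w (mem_univ i))
      · intro i hi
        rw [Fin.append_right] at hi
        exact hd o₁ ((hw _).1 (.inr rfl)) ((hw' _).1 (.inl (hi ▸ mem_map_of_mem w' (mem_univ i))))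
    · intro hc
      obtain ⟨i, -, hi⟩ := mem_map.1 hc
      refine Fin.addCases (motive := fun i : Fin (4 + 4) => Fin.append w w' i ≠ o₂) ?_ ?_ i hi
      · intro i hi
        rw [Fin.append_left] at hi
        exact hd o₂ ((hw _).1 (.inl (hi ▸ mem_map_of_mem w (mem_univ i)))) ((hw' _).1 (.inr rfl))
      · intro i hi
        rw [Fin.append_right] at hi
        exact ho₂ (hi ▸ mem_map_of_mem w' (mem_univ i))
  have hpat : ∀ A ∈ F, o₁ ∉ A → o₂ ∉ A → pat v A ∈ mixedTriples ∧ A = (pat v A).map v := by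
    intro A hA h1 h2
    have h3 := h.meets_of_crossedPairs c hA
    have h4 := hmix A hA h1 h2
    have h5 : E₁ ∪ D₁ = insert o₁ (({0, 1, 2, 3} : Finset (Fin 8)).map v) := by
      rw [hv₁, hv₂]; ext z; simp; tauto
    have h6 : E₂ ∪ D₂ = insert o₂ (({4, 5, 6, 7} : Finset (Fin 8)).map v) := by
      rw [hv₃, hv₄]; ext z; simp; tauto
    rw [h5, h6] at h4
    rw [hv₁, hv₂, hv₃, hv₄] at h3
    simp only [disjoint_insert_right, h1, h2, not_false_eq_true, true_and] at h3 h4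
    have h3' := h3.imp (And.imp not_disjoint_pat not_disjoint_pat)
      (And.imp not_disjoint_pat not_disjoint_pat)
    have h4' := h4.imp not_disjoint_pat not_disjoint_pat
    have h7 : 3 ≤ #(pat v A) := by
      generalize pat v A = B at h3' h4'
      revert B; decide +kernel
    have h8 := h.card3 A hA
    refine ⟨mem_filter.2 ⟨mem_univ _, ?_, by tauto⟩, pat_eq_map (by omega)⟩
    have := card_pat_le v A
    omega
  have hcard : #{A ∈ F | ¬ (o₁ ∈ A ∨ o₂ ∈ A)} ≤ 16 := by
    have himg : #({A ∈ F | ¬ (o₁ ∈ A ∨ o₂ ∈ A)}.image (pat v)) =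
        #{A ∈ F | ¬ (o₁ ∈ A ∨ o₂ ∈ A)} := by
      refine card_image_of_injOn fun A hA A' hA' heq => ?_
      simp only [coe_filter, Set.mem_ofPred_eq, not_or] at hA hA'
      rw [(hpat A hA.1 hA.2.1 hA.2.2).2, (hpat A' hA'.1 hA'.2.1 hA'.2.2).2]
      exact congrArg _ heq
    have := two_mul_card_le (P := {A ∈ F | ¬ (o₁ ∈ A ∨ o₂ ∈ A)}.image (pat v))
      (S := mixedTriples) (mapEmbedding pairSwap).toEmbedding ?_ ?_
    · rw [himg, card_mixedTriples] at this
      omega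
    · intro B hB
      obtain ⟨A, hA, rfl⟩ := mem_image.1 hB
      rw [mem_filter, not_or] at hA
      exact (hpat A hA.1 hA.2.1 hA.2.2).1
    · intro B hB
      obtain ⟨A, hA, rfl⟩ := mem_image.1 hB
      rw [mem_filter, not_or] at hA
      obtain ⟨h1, h2⟩ := hpat A hA.1 hA.2.1 hA.2.2
      obtain ⟨h3, h4, I, hI, h5, h6⟩ := map_pairSwap _ h1
      refine ⟨h3, fun hc => ?_⟩
      obtain ⟨A', hA', heq⟩ := mem_image.1 hc
      rw [mem_filter, not_or] at hA'
      obtain ⟨-, h2'⟩ := hpat A' hA'.1 hA'.2.1 hA'.2.2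
      replace heq : pat v A' = (pat v A).map pairSwap := heq
      rw [← heq] at h4 h6
      have hd : Disjoint A A' := by rw [h2, h2']; exact (disjoint_map v).2 h4
      -- one of the four edges of the configuration is disjoint from both
      have hW : ∃ W ∈ F, ∃ o, (o = o₁ ∨ o = o₂) ∧ W = insert o (I.map v) := by
        simp only [mem_insert, mem_singleton] at hI
        rcases hI with rfl | rfl | rfl | rfl
        exacts [⟨_, c.memE₁, _, .inl rfl, hv₁⟩, ⟨_, c.memD₁, _, .inl rfl, hv₂⟩,
          ⟨_, c.memE₂, _, .inr rfl, hv₃⟩, ⟨_, c.memD₂, _, .inr rfl, hv₄⟩]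
      obtain ⟨W, hW, o, ho, rfl⟩ := hW
      have hov : o ∉ univ.map v := by rcases ho with rfl | rfl <;> assumption
      refine h.no_three _ hW A hA.1 A' hA'.1 ?_ ?_ hd
      · rw [h2]; exact disjoint_insert_map' h5.symm hov
      · rw [h2']; exact disjoint_insert_map' h6.symm hov
  have h1 := card_filter_add_card_filter_not (s := F) (fun A => o₁ ∈ A ∨ o₂ ∈ A)
  have hne : o₁ ≠ o₂ := by
    rintro rfl
    exact disjoint_left.1 c.disjEE (hv₁ ▸ mem_insert_self _ _) (hv₃ ▸ mem_insert_self _ _)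
  have h2 := h.card_meet_pair_le hne
  omega

/-- The case that some edge `P` avoids `o₁` and the second pair of edges, so that `E₁`, `D₁`, `P` is
a triangle. Either there is a second triangle `E₂`, `D₂`, `Q` disjoint from it, and every edge meets
all edges of one of them, which gives `28 + 28`; or the edges split into at most `24` through `o₂`,
at most `20` others that meet all edges of the triangle, and at most `12` that do not. -/
theorem Resilient.card_le_of_notMixed [Fintype V] {F : Finset (Finset V)} (h : Resilient F)
    {E₁ D₁ E₂ D₂ : Finset V} {o₁ o₂ : V} (c : CrossedPairs F E₁ D₁ E₂ D₂ o₁ o₂) {P : Finset V}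
    (hP : P ∈ F) (ho₁ : o₁ ∉ P) (hPE : Disjoint P E₂) (hPD : Disjoint P D₂) : #F ≤ 56 := by
  have hPm : ¬ Disjoint P E₁ ∧ ¬ Disjoint P D₁ := by
    have := h.meets_of_crossedPairs c hP
    tauto
  have h𝒳 : IsTriangle {E₁, D₁, P} := isTriangle_of_inter (h.card3 _ c.memE₁) (h.card3 _ c.memD₁)
    (h.card3 _ hP) c.inter₁ ho₁ hPm.1 hPm.2
  obtain ⟨𝒳, hdef⟩ : ∃ 𝒳 : Finset (Finset V), 𝒳 = {E₁, D₁, P} := ⟨_, rfl⟩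
  rw [← hdef] at h𝒳
  have h𝒳F : 𝒳 ⊆ F := by
    rw [hdef]; simp [insert_subset_iff, c.memE₁, c.memD₁, hP]
  have hXE : ∀ X ∈ 𝒳, Disjoint X E₂ := by
    rw [hdef]; simp [c.disjEE, c.disjDE, hPE]
  have hXD : ∀ X ∈ 𝒳, Disjoint X D₂ := by
    rw [hdef]; simp [c.disjED, c.disjDD, hPD]
  -- an edge disjoint from some `X` meets both edges of the second pair
  have hmeet : ∀ A ∈ F, ∀ X ∈ 𝒳, Disjoint A X → ¬ Disjoint A E₂ ∧ ¬ Disjoint A D₂ :=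
    fun A hA X hX hd => ⟨fun hd' => h.no_three A hA X (h𝒳F hX) E₂ c.memE₂ hd hd' (hXE X hX),
      fun hd' => h.no_three A hA X (h𝒳F hX) D₂ c.memD₂ hd hd' (hXD X hX)⟩
  by_cases hQ : ∃ Q ∈ F, o₂ ∉ Q ∧ ∀ X ∈ 𝒳, Disjoint Q X
  · -- two triangles on disjoint vertex sets
    obtain ⟨Q, hQ, ho₂, hQX⟩ := hQ
    obtain ⟨X₀, hX₀⟩ := h𝒳.nonempty
    have hQm := hmeet Q hQ X₀ hX₀ (hQX X₀ hX₀)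
    have h𝒴 : IsTriangle {E₂, D₂, Q} := isTriangle_of_inter (h.card3 _ c.memE₂)
      (h.card3 _ c.memD₂) (h.card3 _ hQ) c.inter₂ ho₂ hQm.1 hQm.2
    have h𝒴F : ({E₂, D₂, Q} : Finset (Finset V)) ⊆ F := by
      simp [insert_subset_iff, c.memE₂, c.memD₂, hQ]
    have hXY : ∀ X ∈ 𝒳, ∀ Y ∈ ({E₂, D₂, Q} : Finset (Finset V)), Disjoint X Y := by
      intro X hX
      simp [hXE X hX, hXD X hX, (hQX X hX).symm]
    have h1 := h.card_le_of_triangles h𝒳 h𝒴 h𝒴F hXY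
    have h2 := h.card_le_of_triangles h𝒴 h𝒳 h𝒳F fun Y hY X hX => (hXY X hX Y hY).symm
    have h3 := card_filter_add_card_filter_not (s := F) (fun A => ∀ X ∈ 𝒳, ¬ Disjoint A X)
    have h4 : #{A ∈ F | ¬ ∀ X ∈ 𝒳, ¬ Disjoint A X} ≤
        #{A ∈ F | ∀ Y ∈ ({E₂, D₂, Q} : Finset (Finset V)), ¬ Disjoint A Y} := by
      refine card_le_card fun A hA => ?_
      rw [mem_filter] at hA ⊢
      refine ⟨hA.1, fun Y hY hd => hA.2 fun X hX hd' => ?_⟩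
      exact h.no_three A hA.1 X (h𝒳F hX) Y (h𝒴F hY) hd' hd (hXY X hX Y hY)
    omega
  · push Not at hQ
    have h1 := h.degree_le o₂
    have h2 := h.card_le_of_triangle h𝒳 h𝒳F c.memE₂ c.memD₂ c.inter₂ hXE hXD
    have h3 : #{A ∈ F | o₂ ∉ A ∧ ∃ X ∈ 𝒳, Disjoint A X} ≤ 12 := by
      obtain ⟨w, hw₁, hw₂, ho⟩ : ∃ w : Fin 4 ↪ V,
          E₂ = insert o₂ (({0, 1} : Finset (Fin 4)).map w) ∧
          D₂ = insert o₂ (({2, 3} : Finset (Fin 4)).map w) ∧ o₂ ∉ univ.map w :=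
        exists_labels_of_inter (h.card3 _ c.memE₂) (h.card3 _ c.memD₂) c.inter₂
      have hwX : ∀ X ∈ 𝒳, Disjoint (univ.map w) X := by
        intro X hX
        have h1 := hXE X hX
        have h2 := hXD X hX
        rw [hw₁, disjoint_insert_right] at h1
        rw [hw₂, disjoint_insert_right] at h2
        have : (univ : Finset (Fin 4)) = {0, 1} ∪ {2, 3} := by decide
        rw [this, map_union, disjoint_union_left]
        exact ⟨h1.2.symm, h2.2.symm⟩
      have hb : PatternBounds (cnt {A ∈ F | o₂ ∉ A ∧ ∃ X ∈ 𝒳, Disjoint A X} w) 6 :=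
        h.patternBounds (filter_subset _ _) w h𝒳.nonempty (fun X hX => ⟨h𝒳F hX, hwX X hX⟩)
          (fun A _ z _ => h𝒳.exists_notMem z)
          (fun N N' hN hN' _ hR => h𝒳.card_add_card_le hN hN' hR)
      have h1 := hb.couple_six {0, 2} {1, 3} (by decide)
      have h2 := hb.couple_six {0, 3} {1, 2} (by decide)
      have h3 := card_le_sum_cnt (F := {A ∈ F | o₂ ∉ A ∧ ∃ X ∈ 𝒳, Disjoint A X}) w
        [{0, 2}, {1, 3}, {0, 3}, {1, 2}] fun A hA => ?_
      · simp only [List.map_cons, List.map_nil, List.sum_cons, List.sum_nil] at h3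
        omega
      · rw [mem_filter] at hA
        obtain ⟨hA, hoA, X, hX, hd⟩ := hA
        obtain ⟨h1, h2⟩ := hmeet A hA X hX hd
        rw [hw₁, disjoint_insert_right] at h1
        rw [hw₂, disjoint_insert_right] at h2
        have h1 := not_disjoint_pat fun hc => h1 ⟨hoA, hc⟩
        have h2 := not_disjoint_pat fun hc => h2 ⟨hoA, hc⟩
        -- the third vertex lies in the triangle
        have h3 : #(pat w A) ≤ 2 := by
          obtain ⟨Y, hY, hd'⟩ := hQ A hA hoA
          obtain ⟨z, hzA, hzY⟩ := not_disjoint_iff.1 hd'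
          have hz : z ∉ univ.map w := fun hc => disjoint_left.1 (hwX Y hY) hc hzY
          have : #((pat w A).map w) < #A := card_lt_card ((ssubset_iff_of_subset
            (map_pat_subset w A)).2 ⟨z, hzA, fun hc => hz (map_subset_map.2 (subset_univ _) hc)⟩)
          rw [card_map, h.card3 A hA] at this
          omega
        generalize pat w A = B at h1 h2 h3
        revert B; decide
    have h4 : #F ≤ #{A ∈ F | o₂ ∈ A} + (#{A ∈ F | o₂ ∉ A ∧ ∀ X ∈ 𝒳, ¬ Disjoint A X} +
        #{A ∈ F | o₂ ∉ A ∧ ∃ X ∈ 𝒳, Disjoint A X}) := by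
      refine le_trans (card_le_card fun A hA => ?_)
        ((card_union_le _ _).trans (Nat.add_le_add_left (card_union_le _ _) _))
      simp only [mem_union, mem_filter]
      by_cases h1 : o₂ ∈ A
      · exact .inl ⟨hA, h1⟩
      by_cases h2 : ∃ X ∈ 𝒳, Disjoint A X
      · exact .inr (.inr ⟨hA, h1, h2⟩)
      · exact .inr (.inl ⟨hA, h1, fun X hX hd => h2 ⟨X, hX, hd⟩⟩)
    omega

/-- A resilient `3`-graph with matching number `2` has at most `56` edges. -/
theorem Resilient.card_le [Fintype V] {F : Finset (Finset V)} (h : Resilient F) : #F ≤ 56 := by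
  rcases F.eq_empty_or_nonempty with rfl | ⟨A, hA⟩
  · simp
  obtain ⟨x, hx⟩ : A.Nonempty := card_pos.1 (by rw [h.card3 A hA]; omega)
  obtain ⟨E₁, hE₁, E₂, hE₂, hE, -⟩ := h.avoid x x
  by_cases hr : ∀ P ∈ F, ∀ Q ∈ F, Disjoint P Q → 3 ≤ #((P ∪ Q) ∩ (E₁ ∪ E₂))
  · exact h.card_le_of_rigid hE₁ hE₂ hE hr
  push Not at hr
  obtain ⟨P, hP, Q, hQ, hPQ, hc⟩ := hr
  obtain ⟨D₁, D₂, o₁, o₂, c⟩ := h.exists_crossedPairs hE₁ hE₂ hE hP hQ hPQ (by omega)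
  by_cases hm : ∀ A ∈ F, o₁ ∉ A → o₂ ∉ A → ¬ Disjoint A (E₁ ∪ D₁) ∧ ¬ Disjoint A (E₂ ∪ D₂)
  · exact h.card_le_of_mixed c hm
  push Not at hm
  obtain ⟨A, hA, h1, h2, h3⟩ := hm
  by_cases hd : Disjoint A (E₁ ∪ D₁)
  · rw [disjoint_union_right] at hd
    exact h.card_le_of_notMixed c.symm hA h2 hd.1 hd.2
  · have hd := h3 hd
    rw [disjoint_union_right] at hd
    exact h.card_le_of_notMixed c hA h1 hd.1 hd.2

end

/-! ### Matching numbers and the complete 3-graph on eight vertices -/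

section

variable {V : Type*} [DecidableEq V]

theorem card_le_matchingNumber {F M : Finset (Finset V)} (hM : M ⊆ F)
    (hd : ∀ A ∈ M, ∀ B ∈ M, A ≠ B → Disjoint A B) : #M ≤ matchingNumber F :=
  le_sup (f := card) (mem_filter.2 ⟨mem_powerset.2 hM, hd⟩)

theorem exists_card_eq_matchingNumber (F : Finset (Finset V)) :
    ∃ M ⊆ F, (∀ A ∈ M, ∀ B ∈ M, A ≠ B → Disjoint A B) ∧ #M = matchingNumber F := by
  obtain ⟨M, hM, h⟩ := exists_mem_eq_sup
    (F.powerset.filter fun M => ∀ A ∈ M, ∀ B ∈ M, A ≠ B → Disjoint A B)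
    ⟨∅, mem_filter.2 ⟨mem_powerset.2 (empty_subset F), by simp⟩⟩ card
  rw [mem_filter, mem_powerset] at hM
  exact ⟨M, hM.1, hM.2, h.symm⟩

theorem two_le_matchingNumber {F : Finset (Finset V)} {P Q : Finset V} (hP : P ∈ F) (hQ : Q ∈ F)
    (hne : P ≠ Q) (hd : Disjoint P Q) : 2 ≤ matchingNumber F := by
  rw [← card_pair hne]
  refine card_le_matchingNumber (by simp [insert_subset_iff, hP, hQ]) ?_
  simp only [mem_insert, mem_singleton]
  rintro A (rfl | rfl) B (rfl | rfl) h
  exacts [absurd rfl h, hd, hd.symm, absurd rfl h]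

theorem IsResilient.resilient {F : Finset (Finset V)} (h3 : ∀ A ∈ F, #A = 3)
    (hres : IsResilient 2 F) (hF : matchingNumber F = 2) : Resilient F := by
  have hne : ∀ A ∈ F, ∀ B, Disjoint A B → A ≠ B := by
    rintro A hA _ hd rfl
    rw [disjoint_self_iff_empty] at hd
    simpa [hd] using h3 A hA
  refine ⟨h3, ?_, ?_⟩
  · intro A hA B hB C hC hAB hAC hBC
    have h : #({A, B, C} : Finset (Finset V)) = 3 :=
      card_eq_three.2 ⟨A, B, C, hne A hA B hAB, hne A hA C hAC, hne B hB C hBC, rfl⟩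
    have := card_le_matchingNumber (F := F) (M := {A, B, C})
      (by simp [insert_subset_iff, hA, hB, hC]) (by
        simp only [mem_insert, mem_singleton]
        rintro _ (rfl | rfl | rfl) _ (rfl | rfl | rfl) hne
        exacts [absurd rfl hne, hAB, hAC, hAB.symm, absurd rfl hne, hBC, hAC.symm, hBC.symm,
          absurd rfl hne])
    omega
  · intro x y
    obtain ⟨M, hM, hd, hc⟩ := exists_card_eq_matchingNumber (deleteVerts F {x, y})
    rw [hres {x, y} card_le_two, hF, card_eq_two] at hc
    obtain ⟨P, Q, hPQ, rfl⟩ := hc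
    have hP := mem_filter.1 (hM (mem_insert_self P {Q}))
    have hQ := mem_filter.1 (hM (mem_insert_of_mem (mem_singleton_self Q)))
    simp only [disjoint_insert_right, disjoint_singleton_right] at hP hQ
    exact ⟨P, hP.1, Q, hQ.1, hd P (by simp) Q (by simp) hPQ, hP.2.1, hQ.2.1, hP.2.2, hQ.2.2⟩

theorem mem_completeKGraph {n k : ℕ} {A : Finset (Fin n)} : A ∈ completeKGraph n k ↔ #A = k := by
  simp [completeKGraph]

theorem matchingNumber_deleteVerts_completeKGraph (T : Finset (Fin 8)) (hT : #T ≤ 2) :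
    matchingNumber (deleteVerts (completeKGraph 8 3) T) = 2 := by
  refine le_antisymm ?_ ?_
  · obtain ⟨M, hM, hd, hc⟩ := exists_card_eq_matchingNumber (deleteVerts (completeKGraph 8 3) T)
    have h3 : ∀ A ∈ M, #A = 3 := fun A hA => mem_completeKGraph.1 (mem_filter.1 (hM hA)).1
    have h1 : #(M.biUnion fun A => A) = #M * 3 := by
      rw [card_biUnion (fun A hA B hB h => hd A hA B hB h)]
      exact sum_const_nat h3
    have h2 := card_le_univ (M.biUnion fun A => A)
    rw [Fintype.card_fin] at h2
    omega
  · have hTc := card_compl T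
    rw [Fintype.card_fin] at hTc
    obtain ⟨P, hP, hP3⟩ := exists_subset_card_eq (show 3 ≤ #Tᶜ by omega)
    have hd := card_sdiff_of_subset hP
    obtain ⟨Q, hQ, hQ3⟩ := exists_subset_card_eq (show 3 ≤ #(Tᶜ \ P) by omega)
    have hPQ : Disjoint P Q := disjoint_sdiff.mono_right hQ
    refine two_le_matchingNumber (P := P) (Q := Q)
      (mem_filter.2 ⟨mem_completeKGraph.2 hP3, (le_compl_iff_disjoint_right).1 hP⟩)
      (mem_filter.2 ⟨mem_completeKGraph.2 hQ3,
        (le_compl_iff_disjoint_right).1 (hQ.trans sdiff_subset)⟩) ?_ hPQ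
    rintro rfl
    rw [disjoint_self_iff_empty] at hPQ
    simp [hPQ] at hP3

theorem matchingNumber_completeKGraph : matchingNumber (completeKGraph 8 3) = 2 := by
  have := matchingNumber_deleteVerts_completeKGraph ∅ (by simp)
  rwa [deleteVerts, filter_true_of_mem fun A _ => disjoint_empty_right A] at this

theorem isResilient_completeKGraph : IsResilient 2 (completeKGraph 8 3) := fun T hT => by
  rw [matchingNumber_deleteVerts_completeKGraph T hT, matchingNumber_completeKGraph]

theorem card_completeKGraph (n k : ℕ) : #(completeKGraph n k) = n.choose k := by
  rw [completeKGraph, card_powersetCard, card_univ, Fintype.card_fin]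

theorem isGreatest_resilientSizes : IsGreatest (resilientSizes 3 2) (Nat.choose 8 3) := by
  refine ⟨⟨8, completeKGraph 8 3, subset_rfl, isResilient_completeKGraph,
    matchingNumber_completeKGraph, card_completeKGraph 8 3⟩, ?_⟩
  rintro _ ⟨n, F, hF, hres, hν, rfl⟩
  exact (IsResilient.resilient (fun A hA => mem_completeKGraph.1 (hF hA)) hres hν).card_le

end

end ResilientHypergraph

/-- The maximum `m(3, 2)` exists, equals `8.choose 3 = 56`, and is attained by the complete
3-graph on 8 vertices. -/
theorem theorem1p6 :
    IsGreatest (ResilientHypergraph.resilientSizes 3 2) (ResilientHypergraph.m 3 2) ∧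
    ResilientHypergraph.m 3 2 = Nat.choose 8 3 ∧
    Nat.choose 8 3 = 56 ∧
    ResilientHypergraph.IsResilient 2 (ResilientHypergraph.completeKGraph 8 3) ∧
    ResilientHypergraph.matchingNumber (ResilientHypergraph.completeKGraph 8 3) = 2 ∧
    (ResilientHypergraph.completeKGraph 8 3).card = ResilientHypergraph.m 3 2 := by
  have hm : ResilientHypergraph.m 3 2 = Nat.choose 8 3 :=
    ResilientHypergraph.isGreatest_resilientSizes.csSup_eq
  rw [hm]
  exact ⟨ResilientHypergraph.isGreatest_resilientSizes, rfl, rfl,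
    ResilientHypergraph.isResilient_completeKGraph,
    ResilientHypergraph.matchingNumber_completeKGraph,
    ResilientHypergraph.card_completeKGraph 8 3⟩
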